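/- Let $\mathbb F=\mathbb C$ or $\mathbb R$. A contraction $\mathfrak g\to\mathfrak g_0$ of $n$-dimensional Lie algebras on $V=\mathbb F^n$ is given by a continuous map $\varepsilon\mapsto U_\varepsilon\in GL(V)$, $\varepsilon\in(0,1]$, such that $[x,y]_0=\lim_{\varepsilon\to+0}U_\varepsilon^{-1}[U_\varepsilon x,U_\varepsilon y]$ for all $x,y\in V$, where $[\cdot,\cdot]$ and $[\cdot,\cdot]_0$ are the brackets of $\mathfrak g$ and $\mathfrak g_0$. Two contractions $\mathfrak g\to\mathfrak g_0$ and $\tilde{\mathfrak g}\to\tilde{\mathfrak g}_0$ are equivalent if $\mathfrak g\cong\tilde{\mathfrak g}$ and $\mathfrak g_0\cong\tilde{\mathfrak g}_0$. A contraction is a generalized Inönü–Wigner (IW) contraction with signature $(\alpha_1,\dots,\alpha_n)\in\mathbb R^n$ if $U_\varepsilon=A\,\mathrm{diag}(\varepsilon^{\alpha_1},\dots,\varepsilon^{\alpha_n})\,P$ with constant nonsingular matrices $A$, $P$. Consider the four-dimensional Lie algebras with the following nonzero commutators: $2A_{2.1}$: $[e_1,e_2]=e_1$, $[e_3,e_4]=e_3$;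 $A_{4.1}$: $[e_2,e_4]=e_1$, $[e_3,e_4]=e_2$; $A_{4.10}$: $[e_1,e_3]=e_1$, $[e_2,e_3]=e_2$, $[e_1,e_4]=-e_2$, $[e_2,e_4]=e_1$; $\mathrm{so}(3)\oplus A_1$: $[e_1,e_2]=e_3$, $[e_2,e_3]=e_1$, $[e_3,e_1]=e_2$. Let $2\mathfrak g_{2.1}$ and $\mathfrak g_{4.1}$ be the complexifications of $2A_{2.1}$ and $A_{4.1}$. Theorem. (i) Every generalized IW-contraction among complex (resp. real) four-dimensional Lie algebras is equivalent to a generalized IW-contraction whose signature consists of nonnegative integers not greater than $3$, and, over each of the two fields, $3$ cannot be replaced by a smaller number. (ii) The generalized IW-contractions that are not equivalent to any generalized IW-contraction with all exponents in $\{0,1,2\}$ are, up to equivalence, precisely $2\mathfrak g_{2.1}\to\mathfrak g_{4.1}$ in the complex case, and $2A_{2.1}\to A_{4.1}$, $A_{4.10}\to A_{4.1}$ and $\mathrm{so}(3)\oplus A_1\to A_{4.1}$ in the real case (and all of these do exist as generalized IW-contractions). (iii) For each of the contractions in (ii) the minimal signature is $(3,2,1,1)$: it is the lexicographically least one among the nonincreasing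 tuples of nonnegative integers that are signatures of generalized IW-contractions equivalent to the given one. (iv) In the canonical bases above, the matrix $$U_\varepsilon=\begin{pmatrix}1&0&0&1\\0&0&1&0\\0&0&0&1\\0&1&1&1\end{pmatrix}\mathrm{diag}(\varepsilon^3,\varepsilon^2,\varepsilon,\varepsilon)$$ realizes a contraction $2\mathfrak g_{2.1}\to\mathfrak g_{4.1}$. -/

import Mathlib

open Filter Topology Set

/-- An `n`-dimensional Lie algebra over `𝕜`, given on the space `𝕜ⁿ` by its structure constants
in the standard basis: `[e_i, e_j] = ∑ k, c i j k • e_k`. -/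
@[ext]
structure LieStructure (𝕜 : Type*) [RCLike 𝕜] (n : ℕ) where
  c : Fin n → Fin n → Fin n → 𝕜
  antisymm : ∀ i j k, c i j k + c j i k = 0
  jacobi : ∀ i j k l,
    (∑ m, c i j m * c m k l) + (∑ m, c k i m * c m j l) + (∑ m, c j k m * c m i l) = 0

namespace LieStructure

/-- The Lie bracket on `𝕜ⁿ` with the given structure constants. -/
def bracket {𝕜 : Type*} [RCLike 𝕜] {n : ℕ} (S : LieStructure 𝕜 n) (x y : Fin n → 𝕜) :
    Fin n → 𝕜 :=
  fun k => ∑ i, ∑ j, x i * y j * S.c i j k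

/-- The space `𝕜ⁿ` regarded as a Lie algebra with the bracket of `S`. -/
def Alg {𝕜 : Type*} [RCLike 𝕜] {n : ℕ} (_S : LieStructure 𝕜 n) : Type _ := Fin n → 𝕜

instance {𝕜 : Type*} [RCLike 𝕜] {n : ℕ} (S : LieStructure 𝕜 n) : AddCommGroup S.Alg :=
  inferInstanceAs (AddCommGroup (Fin n → 𝕜))

instance {𝕜 : Type*} [RCLike 𝕜] {n : ℕ} (S : LieStructure 𝕜 n) : Module 𝕜 S.Alg :=
  inferInstanceAs (Module 𝕜 (Fin n → 𝕜))

section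

variable {𝕜 : Type*} [RCLike 𝕜] {n : ℕ} (S : LieStructure 𝕜 n)

theorem bracket_add_left (x y z : Fin n → 𝕜) :
    S.bracket (x + y) z = S.bracket x z + S.bracket y z := by
  funext k
  simp only [bracket, Pi.add_apply, add_mul, Finset.sum_add_distrib]

theorem bracket_add_right (x y z : Fin n → 𝕜) :
    S.bracket x (y + z) = S.bracket x y + S.bracket x z := by
  funext k
  simp only [bracket, Pi.add_apply, mul_add, add_mul, Finset.sum_add_distrib]

theorem bracket_smul_right (t : 𝕜) (x y : Fin n → 𝕜) :
    S.bracket x (t • y) = t • S.bracket x y := by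
  funext k
  simp only [bracket, Pi.smul_apply, smul_eq_mul, Finset.mul_sum]
  refine Finset.sum_congr rfl fun i _ => Finset.sum_congr rfl fun j _ => ?_
  ring

theorem bracket_antisymm (x y : Fin n → 𝕜) : S.bracket x y = -S.bracket y x := by
  funext k
  simp only [bracket, Pi.neg_apply]
  rw [Finset.sum_comm, ← Finset.sum_neg_distrib]
  refine Finset.sum_congr rfl fun i _ => ?_
  rw [← Finset.sum_neg_distrib]
  refine Finset.sum_congr rfl fun j _ => ?_
  linear_combination (x j * y i) * S.antisymm i j k

theorem bracket_self (x : Fin n → 𝕜) : S.bracket x x = 0 := by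
  have h := S.bracket_antisymm x x
  funext k
  have hk : S.bracket x x k = -S.bracket x x k := congrFun h k
  exact self_eq_neg.mp hk

theorem bracket_bracket_apply (x y z : Fin n → 𝕜) (l : Fin n) :
    S.bracket (S.bracket x y) z l =
      ∑ i, ∑ j, ∑ k, x i * y j * z k * ∑ m, S.c i j m * S.c m k l := by
  simp only [bracket, Finset.sum_mul, Finset.mul_sum]
  rw [Finset.sum_comm]
  have h1 : ∀ k : Fin n, (∑ m, ∑ i, ∑ j, x i * y j * S.c i j m * z k * S.c m k l) =
      ∑ i, ∑ j, ∑ m, x i * y j * z k * (S.c i j m * S.c m k l) := by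
    intro k
    rw [Finset.sum_comm]
    refine Finset.sum_congr rfl fun i _ => ?_
    rw [Finset.sum_comm]
    refine Finset.sum_congr rfl fun j _ => Finset.sum_congr rfl fun m _ => ?_
    ring
  rw [Finset.sum_congr rfl fun k _ => h1 k, Finset.sum_comm]
  refine Finset.sum_congr rfl fun i _ => ?_
  rw [Finset.sum_comm]

theorem bracket_jacobi (x y z : Fin n → 𝕜) :
    S.bracket (S.bracket x y) z + S.bracket (S.bracket z x) y + S.bracket (S.bracket y z) x
      = 0 := by
  funext l
  simp only [Pi.add_apply, Pi.zero_apply, bracket_bracket_apply]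
  have h2 : (∑ i, ∑ j, ∑ k, z i * x j * y k * ∑ m, S.c i j m * S.c m k l) =
      ∑ i, ∑ j, ∑ k, x i * y j * z k * ∑ m, S.c k i m * S.c m j l := by
    rw [Finset.sum_comm]
    refine Finset.sum_congr rfl fun i _ => ?_
    rw [Finset.sum_comm]
    refine Finset.sum_congr rfl fun j _ => Finset.sum_congr rfl fun k _ => ?_
    ring
  have h3 : (∑ i, ∑ j, ∑ k, y i * z j * x k * ∑ m, S.c i j m * S.c m k l) =
      ∑ i, ∑ j, ∑ k, x i * y j * z k * ∑ m, S.c j k m * S.c m i l := by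
    rw [Finset.sum_congr rfl fun i _ => Finset.sum_comm, Finset.sum_comm]
    refine Finset.sum_congr rfl fun i _ => Finset.sum_congr rfl fun j _ =>
      Finset.sum_congr rfl fun k _ => ?_
    ring
  rw [h2, h3]
  simp only [← Finset.sum_add_distrib, ← mul_add]
  refine Finset.sum_eq_zero fun i _ => Finset.sum_eq_zero fun j _ =>
    Finset.sum_eq_zero fun k _ => ?_
  rw [Finset.sum_add_distrib, Finset.sum_add_distrib, S.jacobi, mul_zero]

theorem bracket_leibniz (x y z : Fin n → 𝕜) :
    S.bracket x (S.bracket y z) = S.bracket (S.bracket x y) z + S.bracket y (S.bracket x z) := by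
  have h := S.bracket_jacobi x y z
  have e1 : S.bracket x (S.bracket y z) = -S.bracket (S.bracket y z) x := S.bracket_antisymm _ _
  have e2 : S.bracket y (S.bracket x z) = S.bracket (S.bracket z x) y := by
    have h0 : S.bracket x z = (-1 : 𝕜) • S.bracket z x := by
      rw [neg_one_smul]; exact S.bracket_antisymm x z
    rw [h0, bracket_smul_right, neg_one_smul, ← S.bracket_antisymm]
  rw [e1, e2]
  exact neg_eq_of_add_eq_zero_left h

end

instance {𝕜 : Type*} [RCLike 𝕜] {n : ℕ} (S : LieStructure 𝕜 n) : LieRing S.Alg where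
  bracket := S.bracket
  add_lie := S.bracket_add_left
  lie_add := S.bracket_add_right
  lie_self := S.bracket_self
  leibniz_lie := S.bracket_leibniz

instance {𝕜 : Type*} [RCLike 𝕜] {n : ℕ} (S : LieStructure 𝕜 n) : LieAlgebra 𝕜 S.Alg where
  lie_smul := S.bracket_smul_right

end LieStructure

/-- The integer structure constants defined by a list of nonzero commutation relations
`[e_i, e_j] = v` with `i < j` (all brackets `[e_i, e_j]`, `i < j`, not listed vanish). -/
def tableConst {n : ℕ} (l : List (Fin n × Fin n × (Fin n → ℤ))) (i j k : Fin n) : ℤ :=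
  (l.map fun r =>
    if r.1 = i ∧ r.2.1 = j then r.2.2 k else if r.1 = j ∧ r.2.1 = i then -r.2.2 k else 0).sum

/-- The Lie algebra over `𝕜` with given integer structure constants. -/
def LieStructure.ofInt (𝕜 : Type*) [RCLike 𝕜] {n : ℕ} (c : Fin n → Fin n → Fin n → ℤ)
    (h1 : ∀ i j k, c i j k + c j i k = 0)
    (h2 : ∀ i j k l,
      (∑ m, c i j m * c m k l) + (∑ m, c k i m * c m j l) + (∑ m, c j k m * c m i l) = 0) :
    LieStructure 𝕜 n where
  c i j k := (c i j k : 𝕜)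
  antisymm i j k := by exact_mod_cast h1 i j k
  jacobi i j k l := by exact_mod_cast h2 i j k l

/-! The four Lie algebras below; the basis vectors `e₁, e₂, e₃, e₄` have the indices `0, 1, 2, 3`. -/

/-- `2A₂.₁` (over `ℂ`: `2g₂.₁`): `[e₁,e₂] = e₁`, `[e₃,e₄] = e₃`. -/
def twoA21 (𝕜 : Type*) [RCLike 𝕜] : LieStructure 𝕜 4 :=
  LieStructure.ofInt 𝕜 (tableConst [(0, 1, ![1, 0, 0, 0]), (2, 3, ![0, 0, 1, 0])])
    (by decide +kernel) (by decide +kernel)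

/-- `A₄.₁` (over `ℂ`: `g₄.₁`): `[e₂,e₄] = e₁`, `[e₃,e₄] = e₂`. -/
def A41 (𝕜 : Type*) [RCLike 𝕜] : LieStructure 𝕜 4 :=
  LieStructure.ofInt 𝕜 (tableConst [(1, 3, ![1, 0, 0, 0]), (2, 3, ![0, 1, 0, 0])])
    (by decide +kernel) (by decide +kernel)

/-- `A₄.₁₀`: `[e₁,e₃] = e₁`, `[e₂,e₃] = e₂`, `[e₁,e₄] = -e₂`, `[e₂,e₄] = e₁`. -/
noncomputable def A410 : LieStructure ℝ 4 :=
  LieStructure.ofInt ℝ (tableConst [(0, 2, ![1, 0, 0, 0]), (1, 2, ![0, 1, 0, 0]),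
      (0, 3, ![0, -1, 0, 0]), (1, 3, ![1, 0, 0, 0])])
    (by decide +kernel) (by decide +kernel)

/-- `so(3) ⊕ A₁`: `[e₁,e₂] = e₃`, `[e₁,e₃] = -e₂`, `[e₂,e₃] = e₁`, and `e₄` is central. -/
noncomputable def so3A1 : LieStructure ℝ 4 :=
  LieStructure.ofInt ℝ (tableConst [(0, 1, ![0, 0, 1, 0]), (0, 2, ![0, -1, 0, 0]),
      (1, 2, ![1, 0, 0, 0])])
    (by decide +kernel) (by decide +kernel)

/-- A one-parametric continuous contraction `source → target` of Lie algebras on `𝕜ⁿ`, with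
contraction matrix `U ε`, `ε ∈ (0, 1]`. -/
structure Contraction (𝕜 : Type*) [RCLike 𝕜] (n : ℕ) where
  source : LieStructure 𝕜 n
  target : LieStructure 𝕜 n
  U : ℝ → Matrix (Fin n) (Fin n) 𝕜
  continuousOn_U : ContinuousOn U (Ioc 0 1)
  isUnit_U : ∀ ε ∈ Ioc (0 : ℝ) 1, IsUnit (U ε)
  tendsto_bracket : ∀ x y : Fin n → 𝕜,
    Tendsto (fun ε => (U ε)⁻¹.mulVec (source.bracket ((U ε).mulVec x) ((U ε).mulVec y)))
      (𝓝[>] 0) (𝓝 (target.bracket x y))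

namespace Contraction

/-- The contraction is one from (an isomorphic copy of) `S` to (an isomorphic copy of) `T`. -/
def IsBetween {𝕜 : Type*} [RCLike 𝕜] {n : ℕ} (C : Contraction 𝕜 n) (S T : LieStructure 𝕜 n) :
    Prop :=
  Nonempty (C.source.Alg ≃ₗ⁅𝕜⁆ S.Alg) ∧ Nonempty (C.target.Alg ≃ₗ⁅𝕜⁆ T.Alg)

/-- (Weak) equivalence of contractions. -/
def Equivalent {𝕜 : Type*} [RCLike 𝕜] {n : ℕ} (C C' : Contraction 𝕜 n) : Prop :=
  C.IsBetween C'.source C'.target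

/-- The contraction has a contraction matrix `A W_ε P` with `A`, `P` constant and nonsingular and
`W_ε = diag(ε ^ α₁, …, ε ^ αₙ)`, i.e. it is a generalized Inönü–Wigner contraction with
signature `α`. -/
def HasSignature {𝕜 : Type*} [RCLike 𝕜] {n : ℕ} (C : Contraction 𝕜 n) (α : Fin n → ℝ) : Prop :=
  ∃ A P : Matrix (Fin n) (Fin n) 𝕜, IsUnit A ∧ IsUnit P ∧ ∀ ε ∈ Ioc (0 : ℝ) 1,
    C.U ε = A * Matrix.diagonal (fun i => ((ε ^ α i : ℝ) : 𝕜)) * P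

/-- Generalized Inönü–Wigner contractions. -/
def IsGenIW {𝕜 : Type*} [RCLike 𝕜] {n : ℕ} (C : Contraction 𝕜 n) : Prop :=
  ∃ α : Fin n → ℝ, C.HasSignature α

/-- `C` is equivalent to a generalized Inönü–Wigner contraction with signature `α`. -/
def RealizableWith {𝕜 : Type*} [RCLike 𝕜] {n : ℕ} (C : Contraction 𝕜 n) (α : Fin n → ℝ) : Prop :=
  ∃ C' : Contraction 𝕜 n, C.Equivalent C' ∧ C'.HasSignature α

/-- `α` is the minimal signature for `C`: among the nonincreasing tuples of nonnegative integers
that are signatures of generalized Inönü–Wigner contractions equivalent to `C`, it is the least one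
in the lexicographic order. -/
def IsMinimalSignature {𝕜 : Type*} [RCLike 𝕜] {n : ℕ} (C : Contraction 𝕜 n) (α : Fin n → ℕ) :
    Prop :=
  Antitone α ∧ C.RealizableWith (fun i => (α i : ℝ)) ∧
    ∀ β : Fin n → ℕ, Antitone β → C.RealizableWith (fun i => (β i : ℝ)) → toLex α ≤ toLex β

end Contraction

/-! Read in the bases given by $A$ and $P$, the matrix $A\,\mathrm{diag}(\varepsilon^{\alpha_i})P$
multiplies the structure constant $c_{ij}^k$ of the source by
$\varepsilon^{\alpha_i+\alpha_j-\alpha_k}$. The limit exists exactly when the constants of negative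
weight vanish, and the target keeps those of weight zero: it is the graded algebra of a filtration
of the source. This is `Degenerates`, and `realizableWith_iff` turns every claim about signatures
into a claim about such filtrations.

Target not isomorphic to $A_{4.1}$: weights at most 2 suffice (`Degenerates.exists_weights_le_two`).
Two principles carry properties of the target back to the source. Open conditions, such as having a
generating pair (`GPair`), hold already for the approximating bases. A homogeneous vector of nonzero
weight shifts weights in the target, so all traces of positive powers of its adjoint vanish; a
vector of weight zero is the limit of a constant family, so a fixed vector of the source has the
same traces (`Degenerates.exists_shadow`). The possible targets are listed by `classification` and
`GPair.normal_form`; for each, the spectrum and the open conditions leave few sources, and each of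
these is isomorphic to the target or has an explicit filtration with weights 0, 1, 2.

Target $A_{4.1}$: the source has a generating pair $x,y$, and the weights 1, 1, 2, 3 on $x$, $y$,
$[x,y]$, $[x,[x,y]]$ always work (`GPair.degenerates`). Conversely two homogeneous generators of
weights $m,n\ge 0$ force the weights $m,n,m+n,2m+n$ (`Degenerates.generator_or`). If $m=0$ or $n=0$,
the source has a generator of a special nilpotent kind, and then weights at most 2 suffice;
otherwise integrality gives $2m+n\ge 3$.

Special generators are absent exactly in the affine algebras of $K[\sqrt d]$, $d\ne 0$, and in the
reductive algebras with anisotropic simple part. Up to isomorphism these are $2\mathfrak g_{2.1}$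
over $\mathbb C$ and $2A_{2.1}$, $A_{4.10}$, $\mathrm{so}(3)\oplus A_1$ over $\mathbb R$. -/

namespace LieDegeneration

open Module

/-! ### Coordinates and determinants in dimension four -/

section Tools

variable {K L : Type*} [Field K] [AddCommGroup L] [Module K L]

theorem exists_coords (b : Basis (Fin 4) K L) (v : L) :
    ∃ p q r s : K, v = p • b 0 + q • b 1 + r • b 2 + s • b 3 :=
  ⟨b.repr v 0, b.repr v 1, b.repr v 2, b.repr v 3, by
    conv_lhs => rw [← b.sum_repr v, Fin.sum_univ_four]⟩

theorem repr_comb (b : Basis (Fin 4) K L) (p q r s : K) :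
    b.equivFun (p • b 0 + q • b 1 + r • b 2 + s • b 3) = ![p, q, r, s] := by
  funext i
  fin_cases i <;> simp

theorem coords_eq (b : Basis (Fin 4) K L) {p q r s p' q' r' s' : K}
    (h : p • b 0 + q • b 1 + r • b 2 + s • b 3 = p' • b 0 + q' • b 1 + r' • b 2 + s' • b 3) :
    p = p' ∧ q = q' ∧ r = r' ∧ s = s' := by
  have h1 := congrArg b.equivFun h
  rw [repr_comb, repr_comb] at h1
  exact ⟨congrFun h1 0, congrFun h1 1, congrFun h1 2, congrFun h1 3⟩

theorem coords_eq_zero (b : Basis (Fin 4) K L) {p q r s : K}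
    (h : p • b 0 + q • b 1 + r • b 2 + s • b 3 = 0) :
    p = 0 ∧ q = 0 ∧ r = 0 ∧ s = 0 :=
  coords_eq b (p' := 0) (q' := 0) (r' := 0) (s' := 0) (by rw [h]; module)

theorem exists_basis_of_linearIndependent (hd : finrank K L = 4) {v : Fin 4 → L}
    (hv : LinearIndependent K v) : ∃ b : Basis (Fin 4) K L, ∀ i, b i = v i :=
  ⟨basisOfLinearIndependentOfCardEqFinrank hv (by simp [hd]), fun i => by simp⟩

/-- Four vectors form a basis as soon as the determinant of their coordinates does not vanish. -/
theorem exists_basis_of_det (b : Basis (Fin 4) K L) (v : Fin 4 → L) (A : Matrix (Fin 4) (Fin 4) K)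
    (hv : ∀ i, v i = A i 0 • b 0 + A i 1 • b 1 + A i 2 • b 2 + A i 3 • b 3) (hA : A.det ≠ 0) :
    ∃ b' : Basis (Fin 4) K L, ∀ i, b' i = v i := by
  have hu : IsUnit A.transpose := by
    rw [Matrix.isUnit_iff_isUnit_det, Matrix.det_transpose]; exact isUnit_iff_ne_zero.mpr hA
  have hli : LinearIndependent K v := by
    have h1 : LinearIndependent K (fun i => b.equivFun (v i)) := by
      have h2 : (fun i => b.equivFun (v i)) = A.row := by
        funext i
        rw [hv i, repr_comb]
        funext j
        fin_cases j <;> rfl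
      rw [h2, Matrix.linearIndependent_rows_iff_isUnit]
      rw [Matrix.isUnit_iff_isUnit_det]; exact isUnit_iff_ne_zero.mpr hA
    exact LinearIndependent.of_comp b.equivFun.toLinearMap h1
  have : finrank K L = 4 := by simpa using finrank_eq_card_basis b
  exact exists_basis_of_linearIndependent this hli

theorem det_four (A : Matrix (Fin 4) (Fin 4) K) : A.det =
    A 0 0 * (A 1 1 * (A 2 2 * A 3 3 - A 2 3 * A 3 2) - A 1 2 * (A 2 1 * A 3 3 - A 2 3 * A 3 1)
      + A 1 3 * (A 2 1 * A 3 2 - A 2 2 * A 3 1))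
    - A 0 1 * (A 1 0 * (A 2 2 * A 3 3 - A 2 3 * A 3 2) - A 1 2 * (A 2 0 * A 3 3 - A 2 3 * A 3 0)
      + A 1 3 * (A 2 0 * A 3 2 - A 2 2 * A 3 0))
    + A 0 2 * (A 1 0 * (A 2 1 * A 3 3 - A 2 3 * A 3 1) - A 1 1 * (A 2 0 * A 3 3 - A 2 3 * A 3 0)
      + A 1 3 * (A 2 0 * A 3 1 - A 2 1 * A 3 0))
    - A 0 3 * (A 1 0 * (A 2 1 * A 3 2 - A 2 2 * A 3 1) - A 1 1 * (A 2 0 * A 3 2 - A 2 2 * A 3 0)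
      + A 1 2 * (A 2 0 * A 3 1 - A 2 1 * A 3 0)) := by
  rw [Matrix.det_succ_row_zero]
  simp [Fin.sum_univ_succ, Matrix.det_fin_three, Fin.succAbove]
  ring

theorem exists_basis_of_det4 (b : Basis (Fin 4) K L) {x y z w : L} {u v t s : Fin 4 → K}
    (hx : x = u 0 • b 0 + u 1 • b 1 + u 2 • b 2 + u 3 • b 3)
    (hy : y = v 0 • b 0 + v 1 • b 1 + v 2 • b 2 + v 3 • b 3)
    (hz : z = t 0 • b 0 + t 1 • b 1 + t 2 • b 2 + t 3 • b 3)
    (hw : w = s 0 • b 0 + s 1 • b 1 + s 2 • b 2 + s 3 • b 3) (h : (Matrix.of ![u, v, t, s]).det ≠ 0) :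
    ∃ b' : Basis (Fin 4) K L, b' 0 = x ∧ b' 1 = y ∧ b' 2 = z ∧ b' 3 = w := by
  obtain ⟨b', hb'⟩ := exists_basis_of_det b ![x, y, z, w] _ (by
    intro i; fin_cases i <;> simpa) h
  exact ⟨b', hb' 0, hb' 1, hb' 2, hb' 3⟩

end Tools

/-! ### Bracket tables and generating pairs -/

section Generation

variable {K L : Type*} [Field K] [LieRing L] [LieAlgebra K L]

/-- The brackets of four vectors. -/
structure Brackets (b : Fin 4 → L) (v01 v02 v03 v12 v13 v23 : L) : Prop where
  h01 : ⁅b 0, b 1⁆ = v01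
  h02 : ⁅b 0, b 2⁆ = v02
  h03 : ⁅b 0, b 3⁆ = v03
  h12 : ⁅b 1, b 2⁆ = v12
  h13 : ⁅b 1, b 3⁆ = v13
  h23 : ⁅b 2, b 3⁆ = v23

theorem Brackets.lie_comb {b : Fin 4 → L} {v01 v02 v03 v12 v13 v23 : L}
    (h : Brackets b v01 v02 v03 v12 v13 v23) (p q r s p' q' r' s' : K) :
    ⁅p • b 0 + q • b 1 + r • b 2 + s • b 3, p' • b 0 + q' • b 1 + r' • b 2 + s' • b 3⁆ =
      (p * q' - q * p') • v01 + (p * r' - r * p') • v02 + (p * s' - s * p') • v03 +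
      (q * r' - r * q') • v12 + (q * s' - s * q') • v13 + (r * s' - s * r') • v23 := by
  obtain ⟨h01, h02, h03, h12, h13, h23⟩ := h
  have h10 : ⁅b 1, b 0⁆ = -v01 := by rw [← lie_skew, h01]
  have h20 : ⁅b 2, b 0⁆ = -v02 := by rw [← lie_skew, h02]
  have h30 : ⁅b 3, b 0⁆ = -v03 := by rw [← lie_skew, h03]
  have h21 : ⁅b 2, b 1⁆ = -v12 := by rw [← lie_skew, h12]
  have h31 : ⁅b 3, b 1⁆ = -v13 := by rw [← lie_skew, h13]
  have h32 : ⁅b 3, b 2⁆ = -v23 := by rw [← lie_skew, h23]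
  simp only [add_lie, lie_add, smul_lie, lie_smul, lie_self, h01, h02, h03, h12, h13, h23, h10,
    h20, h30, h21, h31, h32]
  module

theorem brackets_jacobi (x y z : L) : ⁅x, ⁅y, z⁆⁆ - ⁅⁅x, y⁆, z⁆ - ⁅y, ⁅x, z⁆⁆ = 0 := by
  rw [leibniz_lie]; abel

/-- `x` and `y` generate the Lie algebra in the strong sense that `x`, `y`, `[x, y]`,
`[x, [x, y]]` form a basis. -/
def GPair (K : Type*) {L : Type*} [Field K] [LieRing L] [LieAlgebra K L] (x y : L) : Prop :=
  ∃ b : Basis (Fin 4) K L, b 0 = x ∧ b 1 = y ∧ b 2 = ⁅x, y⁆ ∧ b 3 = ⁅x, ⁅x, y⁆⁆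

/-- The Jacobi identity for the triples (0,1,2) and (0,1,3) determines `⁅b 1, b 3⁆` and `⁅b 2, b
3⁆`; the triples (0,2,3) and (1,2,3) then yield the polynomial relations. Callers first remove the
`b 3`-component of `⁅b 1, b 2⁆` by subtracting a multiple of `b 0` from `b 1`. -/
theorem generated_relations (b : Basis (Fin 4) K L) {a1 a2 a3 : K} (h01 : ⁅b 0, b 1⁆ = b 2)
    (h02 : ⁅b 0, b 2⁆ = b 3) (h12 : ⁅b 1, b 2⁆ = a1 • b 0 + a2 • b 1 + a3 • b 2) :
    ∃ p c d e : K, Brackets b (b 2) (b 3) (p • b 0 + c • b 1 + d • b 2 + e • b 3)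
      (a1 • b 0 + a2 • b 1 + a3 • b 2) (a2 • b 2 + a3 • b 3)
      ((a3 * p - d * a1) • b 0 + (a3 * c - d * a2) • b 1 + (p - e * a2) • b 2 + a2 • b 3) ∧
      2 * p = e * a2 ∧ 2 * a3 * c = e * (p - e * a2) ∧ 2 * a2 * c = e * (a3 * c - d * a2) ∧
      a2 * p = -c * a1 + e * (a3 * p - d * a1) ∧
      (p - e * a2) * a1 = a1 * p + 2 * a3 * (a3 * p - d * a1) ∧
      (p - e * a2) * a2 = a1 * c + 2 * a3 * (a3 * c - d * a2) ∧
      a1 * e = - 2 * a2 * a3 := by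
  obtain ⟨p, c, d, e, h03⟩ := exists_coords b ⁅b 0, b 3⁆
  have h21 : ⁅b 2, b 1⁆ = -(a1 • b 0 + a2 • b 1 + a3 • b 2) := by rw [← lie_skew, h12]
  have h20 : ⁅b 2, b 0⁆ = -b 3 := by rw [← lie_skew, h02]
  have h10 : ⁅b 1, b 0⁆ = -b 2 := by rw [← lie_skew, h01]
  have h13 : ⁅b 1, b 3⁆ = a2 • b 2 + a3 • b 3 := by
    have := brackets_jacobi (b 0) (b 1) (b 2)
    simp only [h01, h02, h12, lie_add, lie_smul, lie_self] at this
    linear_combination (norm := module) -this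
  have h23 : ⁅b 2, b 3⁆ = (a3 * p - d * a1) • b 0 + (a3 * c - d * a2) • b 1 + (p - e * a2) • b 2
      + a2 • b 3 := by
    have := brackets_jacobi (b 0) (b 1) (b 3)
    simp only [h01, h02, h12, h13, h03, h10, lie_add, lie_smul, lie_self] at this
    linear_combination (norm := module) -this
  have e1 := brackets_jacobi (b 0) (b 2) (b 3)
  have e2 := brackets_jacobi (b 1) (b 2) (b 3)
  simp only [h01, h02, h12, h13, h03, h10, h20, h21, h23, lie_add, lie_smul, lie_self, add_lie,
    smul_lie] at e1 e2
  obtain ⟨f1, f2, f3, f4⟩ := coords_eq_zero b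
    (p := a2 * p + c * a1 - e * (a3 * p - d * a1)) (q := 2 * a2 * c - e * (a3 * c - d * a2))
    (r := 2 * a3 * c - e * (p - e * a2)) (s := 2 * p - e * a2)
    (by linear_combination (norm := module) e1)
  obtain ⟨g1, g2, g3, g4⟩ := coords_eq_zero b
    (p := (p - e * a2) * a1 - a1 * p - 2 * a3 * (a3 * p - d * a1))
    (q := (p - e * a2) * a2 - a1 * c - 2 * a3 * (a3 * c - d * a2))
    (r := -(a3 * p - d * a1) + (p-e*a2)*a3  - a1 * d - 2 * a3 * (p - e * a2))
    (s := -a1 * e - 2 * a2 * a3)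
    (by linear_combination (norm := module) e2)
  exact ⟨p, c, d, e, ⟨h01, h02, h03, h12, h13, h23⟩, by linear_combination f4,
    by linear_combination f3, by linear_combination f2, by linear_combination f1,
    by linear_combination g1, by linear_combination g2, by linear_combination -g4⟩

end Generation

/-! ### Families of algebras with a generating pair, and the Killing form -/

section NormalForms

variable (K L : Type*) [Field K] [LieRing L] [LieAlgebra K L]

/-- An abelian ideal of codimension one with a cyclic action on it. -/
def IsCyclicExt (c d e : K) : Prop :=
  ∃ b : Basis (Fin 4) K L, Brackets b (b 2) (b 3) (c • b 1 + d • b 2 + e • b 3) 0 0 0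

/-- A Heisenberg ideal of codimension one with a cyclic action on its abelianization, of trace `τ`
and determinant `a`. -/
def IsHeisenbergExt (τ a : K) : Prop :=
  ∃ b : Basis (Fin 4) K L, Brackets b (b 2) (b 3) 0 (a • b 0 + τ • b 2) (τ • b 3) 0

/-- The affine Lie algebra of the quadratic algebra `K[√d]`. -/
def IsQuadraticAffine (d : K) : Prop :=
  ∃ b : Basis (Fin 4) K L, Brackets b (b 2) (b 3) (d • b 2) (b 2) (b 3) 0

/-- A three-dimensional simple Lie algebra plus a one-dimensional center. -/
def IsReductive (d f : K) : Prop :=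
  ∃ b : Basis (Fin 4) K L, Brackets b (b 2) (d • b 1) 0 (f • b 0) 0 0

variable {K L}

theorem trace_eq_sum (b : Basis (Fin 4) K L) (f : L →ₗ[K] L) :
    LinearMap.trace K L f = ∑ i, b.repr (f (b i)) i := by
  rw [LinearMap.trace_eq_matrix_trace K b, Matrix.trace]
  simp [LinearMap.toMatrix_apply]

theorem killing_eq_sum (b : Basis (Fin 4) K L) (x y : L) :
    killingForm K L x y = b.repr ⁅x, ⁅y, b 0⁆⁆ 0 + b.repr ⁅x, ⁅y, b 1⁆⁆ 1 + b.repr ⁅x, ⁅y, b 2⁆⁆ 2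
      + b.repr ⁅x, ⁅y, b 3⁆⁆ 3 := by
  rw [killingForm_apply_apply, trace_eq_sum b, Fin.sum_univ_four]
  rfl

variable (K) in
/-- The Gram determinant of two vectors with respect to the Killing form. -/
noncomputable def killingGram (x y : L) : K :=
  killingForm K L x x * killingForm K L y y - killingForm K L x y ^ 2

/-- Shears of a generating pair therefore preserve the Gram determinant, so it can be computed after
normalization. Being continuous, it also separates the normal forms near a limit. -/
theorem killingGram_comb (x y : L) (p q r s : K) :
    killingGram K (p • x + q • y) (r • x + s • y) = (p * s - q * r) ^ 2 * killingGram K x y := by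
  have h : killingForm K L y x = killingForm K L x y := LieModule.traceForm_comm K L L y x
  simp only [killingGram, map_add, map_smul, LinearMap.add_apply, LinearMap.smul_apply, smul_eq_mul,
    h]
  ring

theorem killing_of_brackets (b : Basis (Fin 4) K L) {p c d e a1 a2 a3 q1 q2 q3 q4 : K}
    (h : Brackets b (b 2) (b 3) (p • b 0 + c • b 1 + d • b 2 + e • b 3)
      (a1 • b 0 + a2 • b 1 + a3 • b 2) (a2 • b 2 + a3 • b 3)
      (q1 • b 0 + q2 • b 1 + q3 • b 2 + q4 • b 3)) :
    killingForm K L (b 0) (b 0) = 2 * d + e ^ 2 ∧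
    killingForm K L (b 0) (b 1) = a3 * e + 2 * a2 ∧
    killingForm K L (b 1) (b 1) = 2 * a3 ^ 2 - 2 * a1 := by
  obtain ⟨h01, h02, h03, h12, h13, h23⟩ := h
  have h10 : ⁅b 1, b 0⁆ = -b 2 := by rw [← lie_skew, h01]
  refine ⟨?_, ?_, ?_⟩ <;> rw [killing_eq_sum b] <;>
    simp [h01, h02, h03, h12, h13, h10] <;> ring

end NormalForms

/-! ### Normal forms of algebras with a generating pair -/

section NormalFormTheorem

variable {K L : Type*} [Field K] [CharZero K] [LieRing L] [LieAlgebra K L]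

theorem Brackets.congr {b b' : Fin 4 → L} {v01 v02 v03 v12 v13 v23 w01 w02 w03 w12 w13 w23 : L}
    (h : Brackets b v01 v02 v03 v12 v13 v23) (hb : b = b') (h01 : v01 = w01) (h02 : v02 = w02)
    (h03 : v03 = w03) (h12 : v12 = w12) (h13 : v13 = w13) (h23 : v23 = w23) :
    Brackets b' w01 w02 w03 w12 w13 w23 := by
  subst hb h01 h02 h03 h12 h13 h23; exact h

/-- A change of basis in the plane spanned by the two generators. -/
theorem exists_generators_shift (b : Basis (Fin 4) K L) {a1 a2 a3 : K} (h01 : ⁅b 0, b 1⁆ = b 2)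
    (h02 : ⁅b 0, b 2⁆ = b 3) (h12 : ⁅b 1, b 2⁆ = a1 • b 0 + a2 • b 1 + a3 • b 2) (η : K) :
    ∃ b' : Basis (Fin 4) K L, b' 0 = b 0 + η • b 1 ∧ b' 1 = b 1 ∧ b' 2 = b 2 ∧
      b' 3 = b 3 + η • (a1 • b 0 + a2 • b 1 + a3 • b 2) ∧
      ⁅b' 0, b' 1⁆ = b' 2 ∧ ⁅b' 0, b' 2⁆ = b' 3 ∧
      ⁅b' 1, b' 2⁆ = a1 • b' 0 + (a2 - a1 * η) • b' 1 + a3 • b' 2 := by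
  obtain ⟨b', h0, h1, h2, h3⟩ := exists_basis_of_det4 b (x := b 0 + η • b 1) (y := b 1) (z := b 2)
    (w := b 3 + η • (a1 • b 0 + a2 • b 1 + a3 • b 2)) (u := ![1, η, 0, 0]) (v := ![0, 1, 0, 0])
    (t := ![0, 0, 1, 0]) (s := ![η * a1, η * a2, η * a3, 1]) (by simp) (by simp) (by simp)
    (by simp; module) (by rw [det_four]; simp)
  refine ⟨b', h0, h1, h2, h3, ?_, ?_, ?_⟩
  · rw [h0, h1, h2, add_lie, smul_lie, lie_self, smul_zero, add_zero, h01]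
  · rw [h0, h2, h3, add_lie, smul_lie, h02, h12]
  · rw [h0, h1, h2, h12]; module

/-- The traces of `ad (b 0)` and `ad (b 1)` are `e` and `2 * a3`. As `a3 ≠ 0`, subtracting `e / (2 *
a3)` times `b 1` from `b 0` makes the first trace zero, and the Jacobi relations then kill almost
every other parameter. -/
theorem Brackets.nonunimodular {b : Basis (Fin 4) K L} {p c d e a1 a2 a3 q1 q2 q3 q4 : K}
    (h : Brackets b (b 2) (b 3) (p • b 0 + c • b 1 + d • b 2 + e • b 3)
      (a1 • b 0 + a2 • b 1 + a3 • b 2) (a2 • b 2 + a3 • b 3)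
      (q1 • b 0 + q2 • b 1 + q3 • b 2 + q4 • b 3)) (h3 : a3 ≠ 0) :
    ∃ b' : Basis (Fin 4) K L, b' 0 = b 0 + (-(e / (2 * a3))) • b 1 ∧ b' 1 = b 1 ∧ ∃ d' : K,
      d' * a1 = 0 ∧ Brackets b' (b' 2) (b' 3) (d' • b' 2) (a1 • b' 0 + a3 • b' 2) (a3 • b' 3) 0 := by
  obtain ⟨b', h0, h1, h2, h3', g01, g02, g12⟩ :=
    exists_generators_shift b h.h01 h.h02 h.h12 (-(e / (2 * a3)))
  refine ⟨b', h0, h1, ?_⟩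
  obtain ⟨p', c', d', e', hB, r1, r2, r3, r4, r5, r6, r7⟩ := generated_relations b' g01 g02 g12
  have he : e' = 0 := by
    have e1 := hB.h03
    rw [h0, h1, h2, h3'] at e1
    have e2 : ⁅b 0 + (-(e / (2 * a3))) • b 1, b 3 + (-(e / (2 * a3))) • (a1 • b 0 + a2 • b 1 +
      a3 • b 2)⁆ = ⁅(1 : K) • b 0 + (-(e / (2 * a3))) • b 1 + (0 : K) • b 2 + (0 : K) • b 3,
      ((-(e / (2 * a3))) * a1) • b 0 + ((-(e / (2 * a3))) * a2) • b 1 +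
      ((-(e / (2 * a3))) * a3) • b 2 + (1 : K) • b 3⁆ := by
      congr 1 <;> module
    rw [e2, h.lie_comb] at e1
    have e3 := congrArg (fun v => b.repr v 3) e1
    simp at e3
    field_simp at e3
    linear_combination -(1 / 2) * e3
  subst he
  have hp : p' = 0 := by linear_combination (1 / 2) * r1
  subst hp
  have hc : c' = 0 := by
    have : a3 * c' = 0 := by linear_combination (1 / 2) * r2
    exact (mul_eq_zero.mp this).resolve_left h3
  subst hc
  have ha : a2 - a1 * (-(e / (2 * a3))) = 0 := by
    have : (a2 - a1 * (-(e / (2 * a3)))) * a3 = 0 := by linear_combination (1 / 2) * r7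
    exact (mul_eq_zero.mp this).resolve_right h3
  rw [ha] at hB
  have hd : d' * a1 = 0 := by
    have : a3 * (d' * a1) = 0 := by linear_combination (1 / 2) * r5
    exact (mul_eq_zero.mp this).resolve_left h3
  refine ⟨d', hd, hB.congr rfl rfl rfl (by module) (by module) (by module) ?_⟩
  rw [hd]; module

/-- Normal form of a four-dimensional Lie algebra with a generating pair. -/
theorem GPair.normal_form {x y : L} (h : GPair K x y) :
    (∃ c d e : K, IsCyclicExt K L c d e ∧ killingGram K x y = 0) ∨
    (∃ τ a : K, (τ ≠ 0 ∨ a ≠ 0) ∧ IsHeisenbergExt K L τ a ∧ killingGram K x y = 0) ∨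
    (∃ d τ : K, d ≠ 0 ∧ τ ≠ 0 ∧ IsQuadraticAffine K L d ∧ killingGram K x y = 4 * d * τ ^ 2) ∨
    ∃ a1 a2 d : K, a2 ^ 2 + a1 * d ≠ 0 ∧ killingGram K x y = -4 * (a2 ^ 2 + a1 * d) ∧
      killingForm K L x x = 2 * d ∧ ∃ b : Basis (Fin 4) K L, Brackets b (b 2) (b 3) (d • b 2)
        (a1 • b 0 + a2 • b 1) (a2 • b 2)
        ((-(d * a1)) • b 0 + (-(d * a2)) • b 1 + a2 • b 3) := by
  obtain ⟨b0, h0, h1, h2, h3⟩ := h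
  obtain ⟨a1, a2, a3, a4, h12⟩ := exists_coords b0 ⁅b0 1, b0 2⁆
  rw [← h0, ← h1] at h2
  rw [← h0, ← h1, ← h2] at h3
  -- The shear by `a4` removes the `b 3`-component of `⁅b 1, b 2⁆`, as `generated_relations`
  -- requires.
  obtain ⟨b, g0, g1, g2, g3⟩ := exists_basis_of_det4 b0 (x := b0 0) (y := b0 1 - a4 • b0 0)
    (z := b0 2) (w := b0 3) (u := ![1, 0, 0, 0]) (v := ![-a4, 1, 0, 0]) (t := ![0, 0, 1, 0])
    (s := ![0, 0, 0, 1]) (by simp) (by simp; module) (by simp) (by simp) (by rw [det_four]; simp)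
  have g01 : ⁅b 0, b 1⁆ = b 2 := by
    rw [g0, g1, g2, lie_sub, lie_smul, lie_self, smul_zero, sub_zero, h2]
  have g02 : ⁅b 0, b 2⁆ = b 3 := by rw [g0, g2, g3, h3]
  have g12 : ⁅b 1, b 2⁆ = (a1 + a2 * a4) • b 0 + a2 • b 1 + a3 • b 2 := by
    rw [g1, g2, g0, sub_lie, smul_lie, h12, ← h3]; module
  have hx : x = b 0 := by rw [g0, h0]
  have hy : y = a4 • b 0 + b 1 := by rw [g0, g1, h1]; module
  have hgram : killingGram K x y = killingGram K (b 0) (b 1) := by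
    have := killingGram_comb (K := K) (b 0) (b 1) 1 0 a4 1
    simp only [one_smul, zero_smul, add_zero] at this
    rw [hx, hy, this]; ring
  rw [hgram, hx]
  clear hgram h0 h1 h2 h3 g0 g1 g2 g3 hx hy h12
  generalize a1 + a2 * a4 = a1 at g12
  obtain ⟨p, c, d, e, hB, r1, r2, r3, r4, r5, r6, r7⟩ := generated_relations b g01 g02 g12
  obtain ⟨k00, k01, k11⟩ := killing_of_brackets b hB
  -- Since `2 * a3` and `e` are the traces of `ad (b 1)` and `ad (b 0)`, the case `a3 = 0`, `e = 0`
  -- is the unimodular one.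
  by_cases ha3 : a3 = 0
  · subst ha3
    by_cases he : e = 0
    · subst he
      have hp : p = 0 := by linear_combination (1 / 2) * r1
      subst hp
      have hq : killingGram K (b 0) (b 1) = -4 * (a2 ^ 2 + a1 * d) := by
        rw [killingGram, k00, k01, k11]; ring
      by_cases hΔ : a2 ^ 2 + a1 * d = 0
      · have habel : a1 = 0 → a2 = 0 → (∃ c d e : K, IsCyclicExt K L c d e ∧
            killingGram K (b 0) (b 1) = 0) := by
          rintro rfl rfl
          exact ⟨c, d, 0, ⟨b, hB.congr rfl rfl rfl (by module) (by module) (by module)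
            (by module)⟩, by rw [hq]; ring⟩
        by_cases ha1 : a1 = 0
        · exact Or.inl (habel ha1 (by simpa [ha1] using hΔ))
        · have hc : c = 0 := by
            have : c * a1 = 0 := by linear_combination r4
            exact (mul_eq_zero.mp this).resolve_right ha1
          subst hc
          refine Or.inr (Or.inl ⟨0, a1, Or.inr ha1, ?_, by rw [hq, hΔ, mul_zero]⟩)
          -- The shift `a2 / a1` annihilates the `b 1`-coefficient `a2 - a1 * η` of `⁅b 1, b 2⁆`.
          obtain ⟨b', h0, h1, h2, h3, f01, f02, f12⟩ :=
            exists_generators_shift b g01 g02 g12 (a2 / a1)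
          have hd : d = -(a2 ^ 2 / a1) := by field_simp; linear_combination hΔ
          have e1 : b' 3 = (a2) • b 0 + (a2 ^ 2 / a1) • b 1 + (0 : K) • b 2 + (1 : K) • b 3 := by
            rw [h3]
            have e2 : (a2 / a1) * a1 = a2 := by field_simp
            linear_combination (norm := module) e2 • b 0
          have e0 : b' 0 = (1 : K) • b 0 + (a2 / a1) • b 1 + (0 : K) • b 2 + (0 : K) • b 3 := by
            rw [h0]; module
          have e2 : b' 1 = (0 : K) • b 0 + (1 : K) • b 1 + (0 : K) • b 2 + (0 : K) • b 3 := by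
            rw [h1]; module
          have e3 : b' 2 = (0 : K) • b 0 + (0 : K) • b 1 + (1 : K) • b 2 + (0 : K) • b 3 := by
            rw [h2]; module
          refine ⟨b', f01, f02, ?_, ?_, ?_, ?_⟩
          · rw [e0, e1, hB.lie_comb, hd]
            match_scalars <;> field_simp <;> ring
          · rw [f12]
            match_scalars <;> field_simp; ring
          · rw [e2, e1, hB.lie_comb]; module
          · rw [e3, e1, hB.lie_comb, hd]
            match_scalars <;> field_simp <;> ring
      · refine Or.inr (Or.inr (Or.inr ⟨a1, a2, d, hΔ, hq, by rw [k00]; ring, b, ?_⟩))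
        have hc : c = 0 := by
          have e1 : c * a1 = 0 := by linear_combination r4
          have e2 : c * a2 = 0 := by linear_combination (1 / 2) * r3
          by_contra hc
          have f1 := (mul_eq_zero.mp e1).resolve_left hc
          have f2 := (mul_eq_zero.mp e2).resolve_left hc
          exact hΔ (by rw [f1, f2]; ring)
        subst hc
        exact hB.congr rfl rfl rfl (by module) (by module) (by module) (by module)
    · have ha1 : a1 = 0 := by
        have : a1 * e = 0 := by linear_combination r7
        exact (mul_eq_zero.mp this).resolve_right he
      have ha2 : a2 = 0 := by
        have : e ^ 2 * a2 = 0 := by linear_combination 2 * r2 + e * r1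
        exact (mul_eq_zero.mp this).resolve_left (pow_ne_zero _ he)
      subst ha1 ha2
      have hp : p = 0 := by linear_combination (1 / 2) * r1
      subst hp
      refine Or.inl ⟨c, d, e, ⟨b, hB.congr rfl rfl rfl (by module) (by module) (by module)
        (by module)⟩, ?_⟩
      rw [killingGram, k00, k01, k11]; ring
  · obtain ⟨b', h0, h1, d', hd', hB'⟩ := hB.nonunimodular ha3
    have hgram : killingGram K (b 0) (b 1) = killingGram K (b' 0) (b' 1) := by
      have := killingGram_comb (K := K) (b 0) (b 1) 1 (-(e / (2 * a3))) 0 1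
      simp only [one_smul, zero_smul, zero_add] at this
      rw [h0, h1, this]; ring
    obtain ⟨l00, l01, l11⟩ := killing_of_brackets b' (p := 0) (c := 0) (d := d') (e := 0)
      (a1 := a1) (a2 := 0) (a3 := a3) (q1 := 0) (q2 := 0) (q3 := 0) (q4 := 0)
      (hB'.congr rfl rfl rfl (by module) (by module) (by module) (by module))
    have hq : killingGram K (b 0) (b 1) = 4 * d' * a3 ^ 2 := by
      rw [hgram, killingGram, l00, l01, l11]
      linear_combination -4 * hd'
    by_cases hd : d' = 0
    · subst hd
      exact Or.inr (Or.inl ⟨a3, a1, Or.inl ha3, ⟨b', hB'.congr rfl rfl rfl (by module) rfl rfl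
        rfl⟩, by rw [hq]; ring⟩)
    · have ha1 : a1 = 0 := (mul_eq_zero.mp hd').resolve_left hd
      subst ha1
      refine Or.inr (Or.inr (Or.inl ⟨d', a3, hd, ha3, ?_, hq⟩))
      obtain ⟨c', c0, c1, c2, c3⟩ := exists_basis_of_det4 b' (x := b' 0) (y := a3⁻¹ • b' 1)
        (z := a3⁻¹ • b' 2) (w := a3⁻¹ • b' 3) (u := ![1, 0, 0, 0]) (v := ![0, a3⁻¹, 0, 0])
        (t := ![0, 0, a3⁻¹, 0]) (s := ![0, 0, 0, a3⁻¹]) (by simp) (by simp) (by simp) (by simp)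
        (by rw [det_four]; simpa using ha3)
      refine ⟨c', ?_, ?_, ?_, ?_, ?_, ?_⟩ <;>
        simp only [c0, c1, c2, c3, lie_smul, smul_lie, hB'.h01, hB'.h02, hB'.h03, hB'.h12, hB'.h13,
          hB'.h23] <;> match_scalars <;> field_simp <;> ring

end NormalFormTheorem

/-! ### Nondegenerate unimodular case: splitting off the center -/

section Reductive

variable {K L : Type*} [Field K] [CharZero K] [LieRing L] [LieAlgebra K L]

/-- The vector `a2 • b 0 - d • b 1 + b 3` is central. The generators are corrected by `p` and `q`
times it; the equations `e1` and `e2` say that `⁅b 0, b 2⁆` and `⁅b 1, b 2⁆` become combinations of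
the corrected generators, so a three-dimensional ideal splits off. -/
theorem exists_split_center {a1 a2 d : K} (hΔ : a2 ^ 2 + a1 * d ≠ 0) (b : Basis (Fin 4) K L)
    (hB : Brackets b (b 2) (b 3) (d • b 2) (a1 • b 0 + a2 • b 1) (a2 • b 2)
      ((-(d * a1)) • b 0 + (-(d * a2)) • b 1 + a2 • b 3)) :
    ∃ c : Basis (Fin 4) K L, Brackets c (c 2) (d • c 1 - a2 • c 0) 0 (a1 • c 0 + a2 • c 1) 0 0 := by
  obtain ⟨p, hp⟩ : ∃ p, p = -a2 / (a2 ^ 2 + a1 * d) := ⟨_, rfl⟩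
  obtain ⟨q, hq⟩ : ∃ q, q = a1 / (a2 ^ 2 + a1 * d) := ⟨_, rfl⟩
  have e1 : d * q - a2 * p = 1 := by
    rw [← div_self hΔ, hp, hq]; ring
  have e2 : a1 * p + a2 * q = 0 := by rw [hp, hq]; field_simp; ring
  obtain ⟨c, c0, c1, c2, c3⟩ := exists_basis_of_det4 b
    (x := (1 + p * a2) • b 0 + (-(p * d)) • b 1 + (0 : K) • b 2 + p • b 3)
    (y := (q * a2) • b 0 + (1 - q * d) • b 1 + (0 : K) • b 2 + q • b 3)
    (z := (0 : K) • b 0 + (0 : K) • b 1 + (1 : K) • b 2 + (0 : K) • b 3)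
    (w := a2 • b 0 + (-d) • b 1 + (0 : K) • b 2 + (1 : K) • b 3)
    (u := ![1 + p * a2, -(p * d), 0, p]) (v := ![q * a2, 1 - q * d, 0, q])
    (t := ![0, 0, 1, 0]) (s := ![a2, -d, 0, 1]) (by simp) (by simp) (by simp) (by simp)
    (by rw [det_four]; simp; ring_nf; simp)
  refine ⟨c, ?_, ?_, ?_, ?_, ?_, ?_⟩ <;>
    simp only [c0, c1, c2, c3, hB.lie_comb]
  · module
  · linear_combination (norm := skip) (-(e1 • (a2 • b 0 - d • b 1 + b 3)))
    match_scalars <;> ring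
  · match_scalars <;> ring
  · linear_combination (norm := skip) (-(e2 • (a2 • b 0 - d • b 1 + b 3)))
    match_scalars <;> ring
  · match_scalars <;> ring
  · match_scalars <;> ring

/-- Gram-Schmidt for the Killing form: `c 0` is not isotropic because `d ≠ 0`, and `c 1 - (a2 / d) •
c 0` is orthogonal to it. -/
theorem isReductive_of_split {a1 a2 d : K} (hd : d ≠ 0) (c : Basis (Fin 4) K L)
    (hB : Brackets c (c 2) (d • c 1 - a2 • c 0) 0 (a1 • c 0 + a2 • c 1) 0 0) :
    IsReductive K L d ((a2 ^ 2 + a1 * d) / d) := by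
  obtain ⟨c', c0, c1, c2, c3⟩ := exists_basis_of_det4 c (x := c 0)
    (y := c 1 - (a2 / d) • c 0) (z := c 2) (w := c 3) (u := ![1, 0, 0, 0])
    (v := ![-(a2 / d), 1, 0, 0]) (t := ![0, 0, 1, 0]) (s := ![0, 0, 0, 1]) (by simp)
    (by simp; module) (by simp) (by simp) (by rw [det_four]; simp)
  refine ⟨c', ?_, ?_, ?_, ?_, ?_, ?_⟩ <;>
    simp only [c0, c1, c2, c3, lie_sub, sub_lie, lie_smul, smul_lie, lie_self, hB.h01, hB.h02,
      hB.h03, hB.h12, hB.h13, hB.h23] <;> match_scalars <;> field_simp <;> ring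

theorem exists_isReductive {a1 a2 d : K} (hΔ : a2 ^ 2 + a1 * d ≠ 0) (c : Basis (Fin 4) K L)
    (hB : Brackets c (c 2) (d • c 1 - a2 • c 0) 0 (a1 • c 0 + a2 • c 1) 0 0) :
    ∃ d f : K, d ≠ 0 ∧ f ≠ 0 ∧ IsReductive K L d f := by
  have key : ∀ (a1 a2 d : K), a2 ^ 2 + a1 * d ≠ 0 → d ≠ 0 → ∀ c : Basis (Fin 4) K L,
      Brackets c (c 2) (d • c 1 - a2 • c 0) 0 (a1 • c 0 + a2 • c 1) 0 0 →
      ∃ d f : K, d ≠ 0 ∧ f ≠ 0 ∧ IsReductive K L d f := fun a1 a2 d h1 h2 c h3 =>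
    ⟨d, _, h2, div_ne_zero h1 h2, isReductive_of_split h2 c h3⟩
  have hc10 : ⁅c 1, c 0⁆ = -c 2 := by rw [← lie_skew, hB.h01]
  by_cases hd : d = 0
  · subst hd
    by_cases ha1 : a1 = 0
    · subst ha1
      have ha2 : a2 ≠ 0 := by rintro rfl; simp at hΔ
      -- Here both generators are isotropic for the Killing form but not orthogonal, so their sum is
      -- not isotropic.
      obtain ⟨c', c0, c1, c2, c3⟩ := exists_basis_of_det4 c (x := c 0 + c 1)
        (y := c 1) (z := c 2) (w := c 3) (u := ![1, 1, 0, 0])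
        (v := ![0, 1, 0, 0]) (t := ![0, 0, 1, 0]) (s := ![0, 0, 0, 1]) (by simp)
        (by simp) (by simp) (by simp) (by rw [det_four]; simp)
      refine key 0 a2 (2 * a2) (by simpa using ha2) (by simpa using ha2) c'
        ⟨?_, ?_, ?_, ?_, ?_, ?_⟩ <;>
      simp only [c0, c1, c2, c3, add_lie, lie_self, hB.h01, hB.h02,
        hB.h03, hB.h12, hB.h13, hB.h23] <;> module
    · obtain ⟨c', c0, c1, c2, c3⟩ := exists_basis_of_det4 c (x := c 1)
        (y := c 0) (z := -c 2) (w := c 3) (u := ![0, 1, 0, 0])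
        (v := ![1, 0, 0, 0]) (t := ![0, 0, -1, 0]) (s := ![0, 0, 0, 1]) (by simp)
        (by simp) (by simp) (by simp) (by rw [det_four]; simp)
      refine key (-0) a2 (-a1) (by simpa using hΔ) (by simpa using ha1) c'
        ⟨?_, ?_, ?_, ?_, ?_, ?_⟩ <;>
      simp only [c0, c1, c2, c3, lie_neg, neg_lie, hB.h02,
        hB.h03, hB.h12, hB.h13, hB.h23, hc10] <;> module
  · exact key a1 a2 d hΔ hd c hB

end Reductive

/-! ### The operator `ad x` modulo `x`: cyclic vectors -/

section CyclicVectors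

variable {K L : Type*} [Field K] [LieRing L] [LieAlgebra K L]

theorem gpair_of_det4 (b : Basis (Fin 4) K L) {x y z w : L} {u v t s : Fin 4 → K}
    (hx : x = u 0 • b 0 + u 1 • b 1 + u 2 • b 2 + u 3 • b 3)
    (hy : y = v 0 • b 0 + v 1 • b 1 + v 2 • b 2 + v 3 • b 3)
    (hz : z = t 0 • b 0 + t 1 • b 1 + t 2 • b 2 + t 3 • b 3)
    (hw : w = s 0 • b 0 + s 1 • b 1 + s 2 • b 2 + s 3 • b 3) (h : (Matrix.of ![u, v, t, s]).det ≠ 0)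
    (h1 : ⁅x, y⁆ = z) (h2 : ⁅x, z⁆ = w) : GPair K x y := by
  obtain ⟨b', h0, h1', h2', h3'⟩ := exists_basis_of_det4 b hx hy hz hw h
  exact ⟨b', h0, h1', by rw [h2', h1], by rw [h3', h1, h2]⟩

theorem exists_basis_zero_eq (hd : finrank K L = 4) {x : L} (hx : x ≠ 0) :
    ∃ b : Basis (Fin 4) K L, b 0 = x := by
  have : Module.Finite K L := Module.finite_of_finrank_pos (by omega)
  let b0 : Basis (Fin 4) K L := finBasisOfFinrankEq K L hd
  obtain ⟨i, hi⟩ : ∃ i, b0.repr x i ≠ 0 := by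
    by_contra! h
    exact hx (b0.ext_elem fun i => by simpa using h i)
  let b1 := b0.reindex (Equiv.swap i 0)
  have h1 : b1.repr x 0 ≠ 0 := by simpa [b1] using hi
  obtain ⟨p, q, r, s, h⟩ := exists_coords b1 x
  have hp : p ≠ 0 := by
    have := congrFun (congrArg b1.equivFun h) 0
    rw [repr_comb] at this
    rw [Basis.equivFun_apply] at this
    rw [this] at h1
    exact h1
  obtain ⟨b, h0, -⟩ := exists_basis_of_det4 b1 (x := x) (y := b1 1) (z := b1 2) (w := b1 3)
    (u := ![p, q, r, s]) (v := ![0, 1, 0, 0]) (t := ![0, 0, 1, 0]) (s := ![0, 0, 0, 1])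
    (by simpa using h) (by simp) (by simp) (by simp) (by rw [det_four]; simpa using hp)
  exact ⟨b, h0⟩

/-- An operator on the quotient by `b 0` for which every vector is an eigenvector is a scalar;
otherwise some `y` is independent of `⁅b 0, y⁆` modulo `b 0`. -/
theorem scalar_or_exists_chain (b : Basis (Fin 4) K L) :
    (∃ κ : K, ∀ y, ∃ s : K, ⁅b 0, y⁆ = κ • y + s • b 0) ∨
    ∃ b' : Basis (Fin 4) K L, b' 0 = b 0 ∧ ⁅b' 0, b' 1⁆ = b' 2 := by
  by_cases h : ∃ b' : Basis (Fin 4) K L, b' 0 = b 0 ∧ ⁅b' 0, b' 1⁆ = b' 2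
  · exact Or.inr h
  left
  have key : ∀ c : Basis (Fin 4) K L, c 0 = b 0 → ∀ p q r s : K,
      ⁅b 0, c 1⁆ = p • c 0 + q • c 1 + r • c 2 + s • c 3 → r = 0 := by
    intro c hc p q r s e
    by_contra hr
    obtain ⟨b', h0, h1, h2, -⟩ := exists_basis_of_det4 c (x := c 0) (y := c 1) (z := ⁅b 0, c 1⁆)
      (w := c 3) (u := ![1, 0, 0, 0]) (v := ![0, 1, 0, 0]) (t := ![p, q, r, s])
      (s := ![0, 0, 0, 1]) (by simp) (by simp) (by simpa using e) (by simp)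
      (by rw [det_four]; simpa using hr)
    exact h ⟨b', by rw [h0, hc], by rw [h0, h1, h2, hc]⟩
  obtain ⟨p1, q1, r1, s1, e1⟩ := exists_coords b ⁅b 0, b 1⁆
  obtain ⟨p2, q2, r2, s2, e2⟩ := exists_coords b ⁅b 0, b 2⁆
  obtain ⟨p3, q3, r3, s3, e3⟩ := exists_coords b ⁅b 0, b 3⁆
  have key' : ∀ (f : Equiv.Perm (Fin 4)), f 0 = 0 → ∀ p q r s : K,
      ⁅b 0, b (f 1)⁆ = p • b 0 + q • b (f 1) + r • b (f 2) + s • b (f 3) → r = 0 := by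
    intro f hf p q r s e
    refine key (b.reindex f.symm) (by simp [hf]) p q r s ?_
    simpa [hf] using e
  have hr1 : r1 = 0 := key' 1 rfl p1 q1 r1 s1 (by simpa using e1)
  have hs1 : s1 = 0 := key' (Equiv.swap 2 3) (by decide) p1 q1 s1 r1 (by
    rw [show (Equiv.swap (2 : Fin 4) 3) 1 = 1 by decide, e1]
    rw [show (Equiv.swap (2 : Fin 4) 3) 2 = 3 by decide,
      show (Equiv.swap (2 : Fin 4) 3) 3 = 2 by decide]; module)
  have hq2 : q2 = 0 := key' (Equiv.swap 1 2) (by decide) p2 r2 q2 s2 (by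
    rw [show (Equiv.swap (1 : Fin 4) 2) 1 = 2 by decide, e2,
      show (Equiv.swap (1 : Fin 4) 2) 2 = 1 by decide,
      show (Equiv.swap (1 : Fin 4) 2) 3 = 3 by decide]; module)
  have hs2 : s2 = 0 := key' (Equiv.swap 1 2 * Equiv.swap 2 3) (by decide) p2 r2 s2 q2 (by
    rw [show (Equiv.swap 1 2 * Equiv.swap 2 3 : Equiv.Perm (Fin 4)) 1 = 2 by decide, e2,
      show (Equiv.swap 1 2 * Equiv.swap 2 3 : Equiv.Perm (Fin 4)) 2 = 3 by decide,
      show (Equiv.swap 1 2 * Equiv.swap 2 3 : Equiv.Perm (Fin 4)) 3 = 1 by decide]; module)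
  have hr3 : r3 = 0 := key' (Equiv.swap 1 3) (by decide) p3 s3 r3 q3 (by
    rw [show (Equiv.swap (1 : Fin 4) 3) 1 = 3 by decide, e3,
      show (Equiv.swap (1 : Fin 4) 3) 2 = 2 by decide,
      show (Equiv.swap (1 : Fin 4) 3) 3 = 1 by decide]; module)
  have hq3 : q3 = 0 := key' (Equiv.swap 1 3 * Equiv.swap 2 3) (by decide) p3 s3 q3 r3 (by
    rw [show (Equiv.swap 1 3 * Equiv.swap 2 3 : Equiv.Perm (Fin 4)) 1 = 3 by decide, e3,
      show (Equiv.swap 1 3 * Equiv.swap 2 3 : Equiv.Perm (Fin 4)) 2 = 1 by decide,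
      show (Equiv.swap 1 3 * Equiv.swap 2 3 : Equiv.Perm (Fin 4)) 3 = 2 by decide]; module)
  subst hr1 hs1 hq2 hs2 hr3 hq3
  -- All three basis vectors are now eigenvectors modulo `b 0`; testing sums of two of them shows
  -- that the eigenvalues agree.
  have h12 : r2 = q1 := by
    obtain ⟨c, c0, c1, c2, c3⟩ := exists_basis_of_det4 b (x := b 0) (y := b 1 + b 2) (z := b 2)
      (w := b 3) (u := ![1, 0, 0, 0]) (v := ![0, 1, 1, 0]) (t := ![0, 0, 1, 0])
      (s := ![0, 0, 0, 1]) (by simp) (by simp) (by simp) (by simp)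
      (by rw [det_four]; simp)
    have := key c c0 (p1 + p2) q1 (r2 - q1) 0 (by
      rw [c1, c0, c2, lie_add, e1, e2]; module)
    exact sub_eq_zero.mp this
  have h13 : s3 = q1 := by
    obtain ⟨c, c0, c1, c2, c3⟩ := exists_basis_of_det4 b (x := b 0) (y := b 1 + b 3) (z := b 3)
      (w := b 2) (u := ![1, 0, 0, 0]) (v := ![0, 1, 0, 1]) (t := ![0, 0, 0, 1])
      (s := ![0, 0, 1, 0]) (by simp) (by simp) (by simp) (by simp)
      (by rw [det_four]; simp)
    have := key c c0 (p1 + p3) q1 (s3 - q1) 0 (by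
      rw [c1, c0, c2, lie_add, e1, e3]; module)
    exact sub_eq_zero.mp this
  subst h12 h13
  refine ⟨s3, fun y => ?_⟩
  obtain ⟨p, q, r, s, rfl⟩ := exists_coords b y
  refine ⟨-s3 * p + q * p1 + r * p2 + s * p3, ?_⟩
  simp only [lie_add, lie_smul, lie_self, e1, e2, e3]
  module

/-- Either `ad x` has a cyclic vector modulo `x`, or it is scalar modulo `x`, or it has a double
eigenvalue `κ` with `ad x - κ` of rank one modulo `x`. -/
theorem cyclic_or (hd : finrank K L = 4) {x : L} (hx : x ≠ 0) :
    (∃ v, GPair K x v) ∨ (∃ κ : K, ∀ y, ∃ s : K, ⁅x, y⁆ = κ • y + s • x) ∨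
    ∃ (b : Basis (Fin 4) K L) (κ ν s s' : K), b 0 = x ∧ ⁅x, b 1⁆ = κ • b 1 + s • x ∧
      ⁅x, b 2⁆ = κ • b 2 + b 3 ∧ ⁅x, b 3⁆ = (κ + ν) • b 3 + s' • x := by
  obtain ⟨b0, hb0⟩ := exists_basis_zero_eq hd hx
  obtain h | ⟨b, hb, h1⟩ := scalar_or_exists_chain b0
  · exact Or.inr (Or.inl (hb0 ▸ h))
  rw [← hb0, ← hb]
  obtain ⟨s, p, q, t, h2⟩ := exists_coords b ⁅b 0, b 2⁆
  by_cases ht : t = 0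
  swap
  · exact Or.inl ⟨b 1, gpair_of_det4 b (z := b 2) (w := ⁅b 0, b 2⁆) (u := ![1, 0, 0, 0])
      (v := ![0, 1, 0, 0]) (t := ![0, 0, 1, 0]) (s := ![s, p, q, t]) (by simp) (by simp) (by simp)
      (by simpa using h2) (by rw [det_four]; simpa using ht) h1 rfl⟩
  subst ht
  obtain ⟨s', p', q', κ, h3⟩ := exists_coords b ⁅b 0, b 3⁆
  -- Modulo `b 0` the operator is a companion block on `b 1`, `b 2` with characteristic polynomial
  -- `X ^ 2 - q * X - p`, bordered by `b 3` with eigenvalue `κ`. The test is whether `κ` is also an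
  -- eigenvalue of the block.
  by_cases hδ : κ ^ 2 - q * κ - p = 0
  · by_cases hσ : p' + κ * q' = 0
    · right; right
      obtain ⟨c, c0, c1, c2, c3⟩ := exists_basis_of_det4 b (x := b 0) (y := b 3 - q' • b 1)
        (z := b 1) (w := b 2 - κ • b 1) (u := ![1, 0, 0, 0]) (v := ![0, -q', 0, 1])
        (t := ![0, 1, 0, 0]) (s := ![0, -κ, 1, 0]) (by simp) (by simp; module) (by simp)
        (by simp; module) (by rw [det_four]; simp)
      refine ⟨c, κ, q - 2 * κ, s', s, c0, ?_, ?_, ?_⟩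
      · rw [c1, lie_sub, lie_smul, h1, h3]
        linear_combination (norm := module) hσ • b 1
      · rw [c2, c3, h1]; module
      · rw [c3, lie_sub, lie_smul, h1, h2]
        linear_combination (norm := module) -hδ • b 1
    · left
      refine ⟨b 3 - q' • b 1, gpair_of_det4 b (z := s' • b 0 + p' • b 1 + κ • b 3)
        (w := (κ * s') • b 0 + (κ * p') • b 1 + (p' + κ * q') • b 2 + κ ^ 2 • b 3)
        (u := ![1, 0, 0, 0]) (v := ![0, -q', 0, 1]) (t := ![s', p', 0, κ])
        (s := ![κ * s', κ * p', p' + κ * q', κ ^ 2]) (by simp) (by simp; module) (by simp)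
        (by simp) ?_ ?_ ?_⟩
      · have : (p' + κ * q') ^ 2 ≠ 0 := pow_ne_zero _ hσ
        rw [det_four]
        simp
        convert this using 1
        ring
      · rw [lie_sub, lie_smul, h1, h3]; module
      · simp only [lie_add, lie_smul, lie_self, h1, h3]; module
  · left
    -- The coefficients `α`, `β` make `α • b 1 + β • b 2 + b 3` an eigenvector modulo `b 0`. Its
    -- eigenvalue `κ` is foreign to the block, so adding the cyclic vector `b 1` of the block gives
    -- a cyclic vector.
    obtain ⟨β, hβ⟩ : ∃ β, β = (p' + κ * q') / (κ ^ 2 - q * κ - p) := ⟨_, rfl⟩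
    have hβ' : β * (κ ^ 2 - q * κ - p) = p' + κ * q' := by
      rw [hβ, div_mul_cancel₀ _ hδ]
    obtain ⟨α, hα⟩ : ∃ α, α = -q' - (q - κ) * β := ⟨_, rfl⟩
    refine ⟨(1 + α) • b 1 + β • b 2 + b 3, gpair_of_det4 b
      (z := (s' + β * s) • b 0 + (κ * α) • b 1 + (1 + κ * β) • b 2 + κ • b 3)
      (w := (s + κ * (s' + β * s)) • b 0 + (p + κ ^ 2 * α) • b 1 + (q + κ ^ 2 * β) • b 2 +
        κ ^ 2 • b 3)
      (u := ![1, 0, 0, 0]) (v := ![0, 1 + α, β, 1]) (t := ![s' + β * s, κ * α, 1 + κ * β, κ])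
      (s := ![s + κ * (s' + β * s), p + κ ^ 2 * α, q + κ ^ 2 * β, κ ^ 2]) (by simp) (by simp)
      (by simp) (by simp) ?_ ?_ ?_⟩
    · rw [det_four]
      simp
      convert hδ using 1
      ring
    · simp only [lie_add, lie_smul, h1, h2, h3]
      linear_combination (norm := skip) hα • b 2 + (-hβ' - κ • hα) • b 1
      match_scalars <;> ring
    · simp only [lie_add, lie_smul, lie_self, h1, h2, h3]
      linear_combination (norm := skip) (κ • hα) • b 2 + (κ • (-hβ' - κ • hα)) • b 1
      match_scalars <;> ring

end CyclicVectors
-- Algebras without a generating pair: brackets from eigenvalues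
section Classification

variable (K L : Type*) [Field K] [LieRing L] [LieAlgebra K L]

/-- An abelian ideal of codimension one on which some element acts as `diag(κ, κ, μ)`. -/
def IsDiagonalExt (κ μ : K) : Prop :=
  ∃ b : Basis (Fin 4) K L, Brackets b (κ • b 1) (κ • b 2) (μ • b 3) 0 0 0

/-- An abelian ideal of codimension one on which some element acts with a single eigenvalue and
Jordan blocks of sizes one and two. -/
def IsJordanExt (κ : K) : Prop :=
  ∃ b : Basis (Fin 4) K L, Brackets b (κ • b 1) (κ • b 2 + b 3) (κ • b 3) 0 0 0

/-- A Heisenberg ideal of codimension one on whose abelianization some element acts as `κ`. -/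
def IsScalarHeisenbergExt (κ : K) : Prop :=
  ∃ b : Basis (Fin 4) K L, Brackets b (κ • b 1) (κ • b 2) ((2 * κ) • b 3) (b 3) 0 0

variable {K L}

theorem eigenvector_coords {b : Basis (Fin 4) K L} {κ ε μ θ p q r s : K}
    (h1 : ⁅b 0, b 1⁆ = κ • b 1) (h2 : ⁅b 0, b 2⁆ = κ • b 2 + ε • b 3) (h3 : ⁅b 0, b 3⁆ = μ • b 3)
    (h : ⁅b 0, p • b 0 + q • b 1 + r • b 2 + s • b 3⁆ =
      θ • (p • b 0 + q • b 1 + r • b 2 + s • b 3)) :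
    θ * p = 0 ∧ (κ - θ) * q = 0 ∧ (κ - θ) * r = 0 ∧ ε * r + (μ - θ) * s = 0 := by
  simp only [lie_add, lie_smul, lie_self, h1, h2, h3] at h
  obtain ⟨e0, e1, e2, e3⟩ := coords_eq_zero b (p := -(θ * p)) (q := (κ - θ) * q)
    (r := (κ - θ) * r) (s := ε * r + (μ - θ) * s) (by linear_combination (norm := module) h)
  exact ⟨neg_eq_zero.mp e0, e1, e2, e3⟩

variable [CharZero K]

/-- The brackets inside the generalized eigenspace of `ad (b 0)` for a nonzero eigenvalue. -/
theorem jordan_brackets {b : Basis (Fin 4) K L} {κ ε : K} (hκ : κ ≠ 0)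
    (h1 : ⁅b 0, b 1⁆ = κ • b 1) (h2 : ⁅b 0, b 2⁆ = κ • b 2 + ε • b 3) (h3 : ⁅b 0, b 3⁆ = κ • b 3) :
    ⁅b 1, b 2⁆ = 0 ∧ ⁅b 1, b 3⁆ = 0 ∧ ⁅b 2, b 3⁆ = 0 := by
  have key : ∀ v : L, ⁅b 0, v⁆ = (2 * κ) • v → v = 0 := by
    intro v hv
    obtain ⟨p, q, r, s, rfl⟩ := exists_coords b v
    obtain ⟨e0, e1, e2, e3⟩ := eigenvector_coords h1 h2 h3 hv
    have hp : p = 0 := by simpa [hκ] using e0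
    have hk : κ - 2 * κ ≠ 0 := by intro h; exact hκ (by linear_combination -h)
    have hq : q = 0 := by simpa [hk] using e1
    have hr : r = 0 := by simpa [hk] using e2
    subst hr
    have hs : s = 0 := by simpa [hk] using e3
    simp [hp, hq, hs]
  have f13 : ⁅b 1, b 3⁆ = 0 := key _ (by rw [leibniz_lie, h1, h3, smul_lie, lie_smul]; module)
  refine ⟨key _ ?_, f13, key _ ?_⟩
  · rw [leibniz_lie, h1, h2, smul_lie, lie_add, lie_smul, lie_smul, f13]; module
  · rw [leibniz_lie, h2, h3, add_lie, smul_lie, lie_smul, smul_lie, lie_self]; module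

/-- Eigenvalues add under brackets: `⁅b 1, b 2⁆` has eigenvalue `2 * κ`, while `⁅b 1, b 3⁆` and `⁅b
2, b 3⁆` have `κ + μ`, which differs from `κ` and `μ`. -/
theorem diagonal_or_heisenberg {b : Basis (Fin 4) K L} {κ μ : K} (hκ : κ ≠ 0) (hμ : μ ≠ 0)
    (h1 : ⁅b 0, b 1⁆ = κ • b 1) (h2 : ⁅b 0, b 2⁆ = κ • b 2) (h3 : ⁅b 0, b 3⁆ = μ • b 3) :
    ∃ t : K, ⁅b 1, b 2⁆ = t • b 3 ∧ (μ - 2 * κ) * t = 0 ∧ ⁅b 1, b 3⁆ = 0 ∧ ⁅b 2, b 3⁆ = 0 := by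
  have h2' : ⁅b 0, b 2⁆ = κ • b 2 + (0 : K) • b 3 := by rw [h2]; module
  have f12 : ⁅b 0, ⁅b 1, b 2⁆⁆ = (2 * κ) • ⁅b 1, b 2⁆ := by
    rw [leibniz_lie, h1, h2, smul_lie, lie_smul]; module
  have f13 : ⁅b 0, ⁅b 1, b 3⁆⁆ = (κ + μ) • ⁅b 1, b 3⁆ := by
    rw [leibniz_lie, h1, h3, smul_lie, lie_smul]; module
  have f23 : ⁅b 0, ⁅b 2, b 3⁆⁆ = (κ + μ) • ⁅b 2, b 3⁆ := by
    rw [leibniz_lie, h2, h3, smul_lie, lie_smul]; module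
  obtain ⟨p1, q1, r1, s1, g12⟩ := exists_coords b ⁅b 1, b 2⁆
  obtain ⟨p2, q2, r2, s2, g13⟩ := exists_coords b ⁅b 1, b 3⁆
  obtain ⟨p3, q3, r3, s3, g23⟩ := exists_coords b ⁅b 2, b 3⁆
  rw [g12] at f12
  rw [g13] at f13
  rw [g23] at f23
  obtain ⟨e0, e1, e2, e3⟩ := eigenvector_coords h1 h2' h3 f12
  have hk : κ - 2 * κ ≠ 0 := by intro h; exact hκ (by linear_combination -h)
  have hk' : κ - (κ + μ) ≠ 0 := by intro h; exact hμ (by linear_combination -h)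
  have hk'' : μ - (κ + μ) ≠ 0 := by intro h; exact hκ (by linear_combination -h)
  have hp1 : p1 = 0 := by simpa [hκ] using e0
  have hq1 : q1 = 0 := by simpa only [mul_eq_zero, hk, false_or] using e1
  have hr1 : r1 = 0 := by simpa only [mul_eq_zero, hk, false_or] using e2
  subst hp1 hq1 hr1
  obtain ⟨d0, d1, d2, d3⟩ := eigenvector_coords h1 h2' h3 f13
  obtain ⟨c0, c1, c2, c3⟩ := eigenvector_coords h1 h2' h3 f23
  have hq2 : q2 = 0 := by simpa only [mul_eq_zero, hk', false_or] using d1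
  have hr2 : r2 = 0 := by simpa only [mul_eq_zero, hk', false_or] using d2
  have hq3 : q3 = 0 := by simpa only [mul_eq_zero, hk', false_or] using c1
  have hr3 : r3 = 0 := by simpa only [mul_eq_zero, hk', false_or] using c2
  have hs2 : s2 = 0 := by
    simpa only [zero_mul, zero_add, mul_eq_zero, hk'', false_or] using d3
  have hs3 : s3 = 0 := by
    simpa only [zero_mul, zero_add, mul_eq_zero, hk'', false_or] using c3
  subst hq2 hr2 hq3 hr3 hs2 hs3
  have e3' : (μ - 2 * κ) * s1 = 0 := by linear_combination e3
  -- A `b 0`-component could remain only if `κ + μ = 0`. If `s1 = 0` the Jacobi identity excludes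
  -- it; otherwise `μ = 2 * κ` and `κ + μ = 3 * κ ≠ 0`.
  have hp : p2 = 0 ∧ p3 = 0 := by
    by_cases hs : s1 = 0
    · have h10 : ⁅b 1, b 0⁆ = -(κ • b 1) := by rw [← lie_skew, h1]
      have h20 : ⁅b 2, b 0⁆ = -(κ • b 2) := by rw [← lie_skew, h2]
      have := leibniz_lie (b 1) (b 2) (b 3)
      rw [g12, g13, g23] at this
      subst hs
      simp only [zero_smul, add_zero, zero_lie, zero_add, lie_smul, h10, h20] at this
      obtain ⟨-, k1, k2, -⟩ := coords_eq_zero b (p := 0) (q := p3 * κ) (r := -(p2 * κ)) (s := 0)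
        (by linear_combination (norm := module) -this)
      exact ⟨by simpa [hκ] using k2, by simpa [hκ] using k1⟩
    · have hμκ : μ = 2 * κ := by
        have := (mul_eq_zero.mp e3').resolve_right hs
        linear_combination this
      have h3κ : κ + μ ≠ 0 := by
        intro h
        have : (3 : K) * κ = 0 := by linear_combination h - hμκ
        simp [hκ] at this
      exact ⟨by simpa only [mul_eq_zero, h3κ, false_or] using d0,
        by simpa only [mul_eq_zero, h3κ, false_or] using c0⟩
  obtain ⟨rfl, rfl⟩ := hp
  exact ⟨s1, by rw [g12]; module, e3', by rw [g13]; module, by rw [g23]; module⟩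

omit [CharZero K] in
theorem isScalarHeisenbergExt_of {b : Basis (Fin 4) K L} {κ t : K} (ht : t ≠ 0)
    (h1 : ⁅b 0, b 1⁆ = κ • b 1) (h2 : ⁅b 0, b 2⁆ = κ • b 2) (h3 : ⁅b 0, b 3⁆ = (2 * κ) • b 3)
    (h12 : ⁅b 1, b 2⁆ = t • b 3) (h13 : ⁅b 1, b 3⁆ = 0) (h23 : ⁅b 2, b 3⁆ = 0) :
    IsScalarHeisenbergExt K L κ := by
  obtain ⟨c, c0, c1, c2, c3⟩ := exists_basis_of_det4 b (x := b 0) (y := b 1)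
    (z := b 2) (w := t • b 3) (u := ![1, 0, 0, 0]) (v := ![0, 1, 0, 0])
    (t := ![0, 0, 1, 0]) (s := ![0, 0, 0, t]) (by simp) (by simp) (by simp)
    (by simp) (by rw [det_four]; simpa using ht)
  refine ⟨c, ?_, ?_, ?_, ?_, ?_, ?_⟩ <;>
    simp only [c0, c1, c2, c3, lie_smul, h1, h2, h3, h12, h13, h23, smul_zero]
  module

/-- On the plane of `b 1`, `b 2`, where `b 0` is a nonzero scalar, `b 3` acts by a matrix `M` for
which `b 1` is cyclic. Adding `(θ / κ) • b 0` to `b 3` replaces `M` by `M + θ`, and an invertible `M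
+ θ` makes its first two images of `b 1` a basis of the plane. -/
theorem gpair_of_commuting {b : Basis (Fin 4) K L} {κ q1 r1 q2 r2 : K} (hκ : κ ≠ 0) (hr : r1 ≠ 0)
    (h1 : ⁅b 0, b 1⁆ = κ • b 1) (h2 : ⁅b 0, b 2⁆ = κ • b 2) (h3 : ⁅b 0, b 3⁆ = 0)
    (h31 : ⁅b 3, b 1⁆ = q1 • b 1 + r1 • b 2) (h32 : ⁅b 3, b 2⁆ = q2 • b 1 + r2 • b 2) :
    ∃ x y : L, GPair K x y := by
  -- A monic quadratic polynomial has second difference 2, so it cannot vanish at 0, 1 and -1.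
  obtain ⟨θ, hθ⟩ : ∃ θ : K, (q1 + θ) * (r2 + θ) - r1 * q2 ≠ 0 := by
    by_contra! h
    have h0 := h 0
    have h1 := h 1
    have h2 := h (-1)
    have : (2 : K) = 0 := by linear_combination h1 + h2 - 2 * h0
    exact two_ne_zero this
  have h30 : ⁅b 3, b 0⁆ = 0 := by rw [← lie_skew, h3, neg_zero]
  refine ⟨(θ / κ) • b 0 + b 3, b 0 + b 1, gpair_of_det4 b
    (z := (q1 + θ) • b 1 + r1 • b 2)
    (w := ((q1 + θ) ^ 2 + r1 * q2) • b 1 + ((q1 + θ) * r1 + r1 * (r2 + θ)) • b 2)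
    (u := ![θ / κ, 0, 0, 1]) (v := ![1, 1, 0, 0]) (t := ![0, q1 + θ, r1, 0])
    (s := ![0, (q1 + θ) ^ 2 + r1 * q2, (q1 + θ) * r1 + r1 * (r2 + θ), 0]) (by simp) (by simp)
    (by simp) (by simp) ?_ ?_ ?_⟩
  · rw [det_four]
    simp
    convert mul_ne_zero (neg_ne_zero.mpr hr) hθ using 1
    ring
  · simp only [add_lie, lie_add, smul_lie, lie_self, h1, h30, h31]
    match_scalars <;> field_simp; ring
  · simp only [add_lie, lie_add, smul_lie, lie_smul, h1, h2, h31, h32]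
    match_scalars <;> field_simp <;> ring

/-- The Jacobi identity forces `s = 0`, so `b 3` commutes with `b 0` and preserves the
`κ`-eigenplane. If it is not a scalar there, `gpair_of_commuting` applies; if it is, subtracting a
multiple of `b 0` makes it central. -/
theorem gpair_or_isDiagonalExt_zero_right {b : Basis (Fin 4) K L} {κ s : K} (hκ : κ ≠ 0)
    (h1 : ⁅b 0, b 1⁆ = κ • b 1) (h2 : ⁅b 0, b 2⁆ = κ • b 2) (h3 : ⁅b 0, b 3⁆ = s • b 0) :
    (∃ x y : L, GPair K x y) ∨ IsDiagonalExt K L κ 0 := by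
  have key : ∀ p q r t s' : K, ⁅b 0, p • b 0 + q • b 1 + r • b 2 + t • b 3⁆ =
      s' • b 1 + κ • (p • b 0 + q • b 1 + r • b 2 + t • b 3) → s' = 0 ∧ t = 0 ∧
      t * s = κ * p := by
    intro p q r t s' h
    simp only [lie_add, lie_smul, lie_self, h1, h2, h3] at h
    obtain ⟨e0, e1, e2, e3⟩ := coords_eq_zero b (p := t * s - κ * p) (q := -s')
      (r := 0) (s := -(κ * t)) (by linear_combination (norm := module) h)
    exact ⟨neg_eq_zero.mp e1, by simpa [hκ] using e3, by linear_combination e0⟩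
  obtain ⟨p1, q1, r1, t1, g1⟩ := exists_coords b ⁅b 3, b 1⁆
  obtain ⟨p2, q2, r2, t2, g2⟩ := exists_coords b ⁅b 3, b 2⁆
  obtain ⟨e1, e2, e3⟩ := key p1 q1 r1 t1 (s * κ) (by
    rw [← g1, leibniz_lie, h1, h3, smul_lie, h1, lie_smul]; module)
  have hs : s = 0 := by simpa [hκ] using e1
  subst hs e2
  have hp1 : p1 = 0 := by simpa [hκ] using e3.symm
  obtain ⟨-, e2, e3⟩ := key p2 q2 r2 t2 0 (by
    rw [← g2, leibniz_lie, h2, h3, smul_lie, lie_smul]; module)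
  subst e2
  have hp2 : p2 = 0 := by simpa [hκ] using e3.symm
  subst hp1 hp2
  have h3' : ⁅b 0, b 3⁆ = 0 := by rw [h3, zero_smul]
  -- A nonscalar matrix on the plane moves one of `b 1`, `b 2`, `b 1 + b 2` off its line; the three
  -- tests treat these in turn.
  by_cases hr1 : r1 = 0
  swap
  · exact Or.inl (gpair_of_commuting hκ hr1 h1 h2 h3' (by rw [g1]; module) (by rw [g2]; module))
  by_cases hq2 : q2 = 0
  swap
  · obtain ⟨c, c0, c1, c2, c3⟩ := exists_basis_of_det4 b (x := b 0) (y := b 2)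
      (z := b 1) (w := b 3) (u := ![1, 0, 0, 0]) (v := ![0, 0, 1, 0])
      (t := ![0, 1, 0, 0]) (s := ![0, 0, 0, 1]) (by simp) (by simp) (by simp)
      (by simp) (by rw [det_four]; simp)
    refine Or.inl (gpair_of_commuting (b := c) (q1 := r2) (r1 := q2) (q2 := r1) (r2 := q1) hκ hq2
      ?_ ?_ ?_ ?_ ?_) <;> simp only [c0, c1, c2, c3, h1, h2, h3', g1, g2] <;> module
  by_cases hqr : r2 - q1 = 0
  swap
  · obtain ⟨c, c0, c1, c2, c3⟩ := exists_basis_of_det4 b (x := b 0) (y := b 1 + b 2)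
      (z := b 2) (w := b 3) (u := ![1, 0, 0, 0]) (v := ![0, 1, 1, 0])
      (t := ![0, 0, 1, 0]) (s := ![0, 0, 0, 1]) (by simp) (by simp) (by simp)
      (by simp) (by rw [det_four]; simp)
    subst hr1 hq2
    refine Or.inl (gpair_of_commuting (b := c) (q1 := q1) (r1 := r2 - q1) (q2 := 0) (r2 := r2) hκ
      hqr ?_ ?_ ?_ ?_ ?_) <;> simp only [c0, c1, c2, c3, lie_add, h1, h2, h3', g1, g2] <;> module
  right
  obtain ⟨f12, -, -⟩ : ⁅b 1, b 2⁆ = 0 ∧ True ∧ True := by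
    refine ⟨?_, trivial, trivial⟩
    have hP : ⁅b 0, ⁅b 1, b 2⁆⁆ = (2 * κ) • ⁅b 1, b 2⁆ := by
      rw [leibniz_lie, h1, h2, smul_lie, lie_smul]; module
    obtain ⟨p, q, r, t, g⟩ := exists_coords b ⁅b 1, b 2⁆
    rw [g] at hP ⊢
    obtain ⟨k0, k1, k2, k3⟩ := eigenvector_coords (ε := 0) (μ := 0) h1 (by rw [h2]; module)
      (by rw [h3']; module) hP
    have hk : κ - 2 * κ ≠ 0 := by intro h; exact hκ (by linear_combination -h)
    have hp : p = 0 := by simpa [hκ] using k0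
    have hq : q = 0 := by simpa only [mul_eq_zero, hk, false_or] using k1
    have hr : r = 0 := by simpa only [mul_eq_zero, hk, false_or] using k2
    have ht : t = 0 := by simpa [hκ] using k3
    simp [hp, hq, hr, ht]
  obtain ⟨c, c0, c1, c2, c3⟩ := exists_basis_of_det4 b (x := b 0) (y := b 1)
    (z := b 2) (w := b 3 - (q1 / κ) • b 0) (u := ![1, 0, 0, 0]) (v := ![0, 1, 0, 0])
    (t := ![0, 0, 1, 0]) (s := ![-(q1 / κ), 0, 0, 1]) (by simp) (by simp) (by simp)
    (by simp; module) (by rw [det_four]; simp)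
  have h10 : ⁅b 1, b 0⁆ = -(κ • b 1) := by rw [← lie_skew, h1]
  have h20 : ⁅b 2, b 0⁆ = -(κ • b 2) := by rw [← lie_skew, h2]
  have h13 : ⁅b 1, b 3⁆ = -(q1 • b 1) := by rw [← lie_skew, g1, hr1]; module
  have h23 : ⁅b 2, b 3⁆ = -(q1 • b 2) := by
    rw [← lie_skew, g2, hq2, sub_eq_zero.mp hqr]; module
  refine ⟨c, ?_, ?_, ?_, ?_, ?_, ?_⟩ <;>
    simp only [c0, c1, c2, c3, lie_sub, lie_smul, lie_self, h1, h2, h3', f12, h13, h23, h10, h20]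
  · module
  · match_scalars; field_simp; ring
  · match_scalars; field_simp; ring

/-- After correction, `c 1` and `c 2` commute with `c 0` and `c 3`, and `⁅c 1, c 2⁆` is `q • c 1 + r
• c 2`. If it is nonzero, a generating pair is written down. -/
theorem gpair_or_isDiagonalExt_zero_left {b : Basis (Fin 4) K L} {μ s1 s2 : K} (hμ : μ ≠ 0)
    (h1 : ⁅b 0, b 1⁆ = s1 • b 0) (h2 : ⁅b 0, b 2⁆ = s2 • b 0) (h3 : ⁅b 0, b 3⁆ = μ • b 3) :
    (∃ x y : L, GPair K x y) ∨ IsDiagonalExt K L 0 μ := by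
  obtain ⟨p1, q1, r1, t1, g1⟩ := exists_coords b ⁅b 1, b 3⁆
  obtain ⟨p2, q2, r2, t2, g2⟩ := exists_coords b ⁅b 2, b 3⁆
  have key : ∀ s p q r t : K, ⁅b 0, p • b 0 + q • b 1 + r • b 2 + t • b 3⁆ =
      (s * μ) • b 3 + μ • (p • b 0 + q • b 1 + r • b 2 + t • b 3) → s = 0 ∧ q = 0 ∧ r = 0 ∧
      q * s1 + r * s2 = μ * p := by
    intro s p q r t h
    simp only [lie_add, lie_smul, lie_self, h1, h2, h3] at h
    obtain ⟨e0, e1, e2, e3⟩ := coords_eq_zero b (p := q * s1 + r * s2 - μ * p) (q := -(μ * q))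
      (r := -(μ * r)) (s := -(s * μ)) (by linear_combination (norm := module) h)
    exact ⟨by simpa [hμ] using e3, by simpa [hμ] using e1, by simpa [hμ] using e2,
      by linear_combination e0⟩
  obtain ⟨hs1, hq1, hr1, hp1⟩ := key s1 p1 q1 r1 t1 (by
    rw [← g1, leibniz_lie, h1, h3, smul_lie, h3, lie_smul]; module)
  obtain ⟨hs2, hq2, hr2, hp2⟩ := key s2 p2 q2 r2 t2 (by
    rw [← g2, leibniz_lie, h2, h3, smul_lie, h3, lie_smul]; module)
  subst hs1 hq1 hr1 hs2 hq2 hr2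
  have hp1' : p1 = 0 := by simpa [hμ] using hp1.symm
  have hp2' : p2 = 0 := by simpa [hμ] using hp2.symm
  subst hp1' hp2'
  obtain ⟨c, c0, c1, c2, c3⟩ := exists_basis_of_det4 b (x := b 0) (y := b 1 - (t1 / μ) • b 0)
    (z := b 2 - (t2 / μ) • b 0) (w := b 3) (u := ![1, 0, 0, 0]) (v := ![-(t1 / μ), 1, 0, 0])
    (t := ![-(t2 / μ), 0, 1, 0]) (s := ![0, 0, 0, 1]) (by simp) (by simp; module)
    (by simp; module) (by simp) (by rw [det_four]; simp)
  have f01 : ⁅c 0, c 1⁆ = 0 := by rw [c0, c1, lie_sub, lie_smul, lie_self, h1]; module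
  have f02 : ⁅c 0, c 2⁆ = 0 := by rw [c0, c2, lie_sub, lie_smul, lie_self, h2]; module
  have f03 : ⁅c 0, c 3⁆ = μ • c 3 := by rw [c0, c3, h3]
  have f13 : ⁅c 1, c 3⁆ = 0 := by
    rw [c1, c3, sub_lie, smul_lie, g1, h3]; match_scalars <;> field_simp <;> ring
  have f23 : ⁅c 2, c 3⁆ = 0 := by
    rw [c2, c3, sub_lie, smul_lie, g2, h3]; match_scalars <;> field_simp <;> ring
  obtain ⟨p, q, r, t, g⟩ := exists_coords c ⁅c 1, c 2⁆
  have k1 : ⁅c 0, ⁅c 1, c 2⁆⁆ = 0 := by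
    rw [leibniz_lie, f01, f02]; simp
  have k2 : ⁅⁅c 1, c 2⁆, c 3⁆ = 0 := by
    have := leibniz_lie (c 1) (c 2) (c 3)
    rw [f13, f23, lie_zero, lie_zero, add_zero] at this
    exact this.symm
  rw [g] at k1 k2
  simp only [lie_add, lie_smul, lie_self, f01, f02, f03, add_lie, smul_lie, f13, f23] at k1 k2
  have ht : t = 0 := by
    obtain ⟨-, -, -, e⟩ := coords_eq_zero c (p := 0) (q := 0) (r := 0) (s := t * μ)
      (by linear_combination (norm := module) k1)
    simpa [hμ] using e
  have hp : p = 0 := by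
    obtain ⟨-, -, -, e⟩ := coords_eq_zero c (p := 0) (q := 0) (r := 0) (s := p * μ)
      (by linear_combination (norm := module) k2)
    simpa [hμ] using e
  subst ht hp
  have f10 : ⁅c 1, c 0⁆ = 0 := by rw [← lie_skew, f01, neg_zero]
  have f20 : ⁅c 2, c 0⁆ = 0 := by rw [← lie_skew, f02, neg_zero]
  have f21 : ⁅c 2, c 1⁆ = -((0 : K) • c 0 + q • c 1 + r • c 2 + (0 : K) • c 3) := by
    rw [← lie_skew, g]
  by_cases hr : r = 0
  · by_cases hq : q = 0
    · subst hr hq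
      refine Or.inr ⟨c, ?_, ?_, f03, ?_, f13, f23⟩
      · rw [f01, zero_smul]
      · rw [f02, zero_smul]
      · rw [g]; module
    · subst hr
      -- The multiple of `c 2` gives `⁅c 1, c 2⁆` the eigenvalue `2 * μ`. The second generator is a
      -- sum of eigenvectors for the distinct eigenvalues 0, `μ`, `2 * μ`, hence cyclic. The case `r
      -- ≠ 0` uses the same device with `c 1`.
      refine Or.inl ⟨c 0 - (2 * μ / q) • c 2, c 3 + q • c 1 - q⁻¹ • c 2, gpair_of_det4 c
        (z := (2 * μ * q) • c 1 + μ • c 3)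
        (w := (4 * μ ^ 2 * q) • c 1 + μ ^ 2 • c 3)
        (u := ![1, 0, -(2 * μ / q), 0]) (v := ![0, q, -q⁻¹, 1]) (t := ![0, 2 * μ * q, 0, μ])
        (s := ![0, 4 * μ ^ 2 * q, 0, μ ^ 2]) (by simp; module) (by simp; module)
        (by simp) (by simp) ?_ ?_ ?_⟩
      · rw [det_four]
        simp
        have : q * (-2 * μ ^ 3) ≠ 0 := mul_ne_zero hq (by simpa using hμ)
        refine ⟨hq, fun h => this ?_⟩
        rw [← h]
        field_simp
        ring
      · simp only [sub_lie, lie_sub, lie_add, smul_lie, lie_smul, lie_self, f01, f02, f03, f21,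
          f23]
        match_scalars <;> field_simp <;> ring
      · simp only [sub_lie, lie_add, smul_lie, lie_smul, f01, f03, f21, f23]
        match_scalars <;> field_simp <;> ring
  · refine Or.inl ⟨c 0 + (2 * μ / r) • c 1, c 3 + q • c 1 + r • c 2 + r⁻¹ • c 1, gpair_of_det4 c
      (z := (2 * μ * q) • c 1 + (2 * μ * r) • c 2 + μ • c 3)
      (w := (4 * μ ^ 2 * q) • c 1 + (4 * μ ^ 2 * r) • c 2 + μ ^ 2 • c 3)
      (u := ![1, 2 * μ / r, 0, 0]) (v := ![0, q + r⁻¹, r, 1]) (t := ![0, 2 * μ * q, 2 * μ * r, μ])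
      (s := ![0, 4 * μ ^ 2 * q, 4 * μ ^ 2 * r, μ ^ 2]) (by simp) (by simp; module)
      (by simp) (by simp) ?_ ?_ ?_⟩
    · rw [det_four]
      simp
      have : -2 * μ ^ 3 ≠ 0 := by simpa using hμ
      convert this using 1
      field_simp
      ring
    · simp only [add_lie, lie_add, smul_lie, lie_smul, lie_self, f01, f02, f03, g, f13]
      match_scalars <;> field_simp <;> ring
    · simp only [add_lie, lie_add, smul_lie, lie_smul, lie_self, f01, f02, f03, g, f13]
      match_scalars <;> field_simp <;> ring

end Classification
-- Rough classification in dimension four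
section Classification

variable {K L : Type*} [Field K] [CharZero K] [LieRing L] [LieAlgebra K L]

theorem exists_diagonal_lift {b : Basis (Fin 4) K L} {κ ν s s' : K} (hκ : κ ≠ 0) (hμ : κ + ν ≠ 0)
    (h1 : ⁅b 0, b 1⁆ = κ • b 1 + s • b 0) (h2 : ⁅b 0, b 2⁆ = κ • b 2 + b 3)
    (h3 : ⁅b 0, b 3⁆ = (κ + ν) • b 3 + s' • b 0) :
    ∃ c : Basis (Fin 4) K L, c 0 = b 0 ∧ ⁅c 0, c 1⁆ = κ • c 1 ∧ ⁅c 0, c 2⁆ = κ • c 2 + c 3 ∧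
      ⁅c 0, c 3⁆ = (κ + ν) • c 3 := by
  obtain ⟨c, c0, c1, c2, c3⟩ := exists_basis_of_det4 b (x := b 0) (y := b 1 + (s / κ) • b 0)
    (z := b 2 - (s' / ((κ + ν) * κ)) • b 0) (w := b 3 + (s' / (κ + ν)) • b 0)
    (u := ![1, 0, 0, 0]) (v := ![s / κ, 1, 0, 0])
    (t := ![-(s' / ((κ + ν) * κ)), 0, 1, 0]) (s := ![s' / (κ + ν), 0, 0, 1]) (by simp)
    (by simp; module) (by simp; module) (by simp; module) (by rw [det_four]; simp)
  refine ⟨c, c0, ?_, ?_, ?_⟩ <;>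
    simp only [c0, c1, c2, c3, lie_add, lie_sub, lie_smul, lie_self, h1, h2, h3]
  · match_scalars <;> field_simp
  · match_scalars <;> field_simp <;> ring
  · match_scalars <;> field_simp

omit [CharZero K] in
theorem exists_diagonal_of_ne {b : Basis (Fin 4) K L} {κ ν s' : K} (hν : ν ≠ 0)
    (h1 : ⁅b 0, b 1⁆ = κ • b 1) (h2 : ⁅b 0, b 2⁆ = κ • b 2 + b 3 + s' • b 0)
    (h3 : ⁅b 0, b 3⁆ = (κ + ν) • b 3) :
    ∃ c : Basis (Fin 4) K L, c 0 = b 0 ∧ ⁅c 0, c 1⁆ = κ • c 1 ∧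
      ⁅c 0, c 2⁆ = κ • c 2 + s' • c 0 ∧ ⁅c 0, c 3⁆ = (κ + ν) • c 3 := by
  obtain ⟨c, c0, c1, c2, c3⟩ := exists_basis_of_det4 b (x := b 0) (y := b 1)
    (z := b 2 - ν⁻¹ • b 3) (w := b 3)
    (u := ![1, 0, 0, 0]) (v := ![0, 1, 0, 0])
    (t := ![0, 0, 1, -ν⁻¹]) (s := ![0, 0, 0, 1]) (by simp)
    (by simp) (by simp; module) (by simp) (by rw [det_four]; simp)
  refine ⟨c, c0, ?_, ?_, ?_⟩ <;>
    simp only [c0, c1, c2, c3, lie_sub, lie_smul, h1, h2, h3]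
  match_scalars <;> field_simp <;> ring

theorem isDiagonalExt_of_scalar (hd : finrank K L = 4) {x : L} (hx : x ≠ 0) {κ : K} (hκ : κ ≠ 0)
    (h : ∀ y, ∃ s : K, ⁅x, y⁆ = κ • y + s • x) :
    ∃ c : Basis (Fin 4) K L, c 0 = x ∧ Brackets c (κ • c 1) (κ • c 2) (κ • c 3) 0 0 0 := by
  obtain ⟨b, rfl⟩ := exists_basis_zero_eq hd hx
  obtain ⟨s1, h1⟩ := h (b 1)
  obtain ⟨s2, h2⟩ := h (b 2)
  obtain ⟨s3, h3⟩ := h (b 3)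
  obtain ⟨c, c0, c1, c2, c3⟩ := exists_basis_of_det4 b (x := b 0) (y := b 1 + (s1 / κ) • b 0)
    (z := b 2 + (s2 / κ) • b 0) (w := b 3 + (s3 / κ) • b 0)
    (u := ![1, 0, 0, 0]) (v := ![s1 / κ, 1, 0, 0])
    (t := ![s2 / κ, 0, 1, 0]) (s := ![s3 / κ, 0, 0, 1]) (by simp)
    (by simp; module) (by simp; module) (by simp; module) (by rw [det_four]; simp)
  have f1 : ⁅c 0, c 1⁆ = κ • c 1 := by
    rw [c0, c1, lie_add, lie_smul, lie_self, h1]; match_scalars <;> field_simp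
  have f2 : ⁅c 0, c 2⁆ = κ • c 2 := by
    rw [c0, c2, lie_add, lie_smul, lie_self, h2]; match_scalars <;> field_simp
  have f3 : ⁅c 0, c 3⁆ = κ • c 3 := by
    rw [c0, c3, lie_add, lie_smul, lie_self, h3]; match_scalars <;> field_simp
  obtain ⟨g12, g13, g23⟩ := jordan_brackets (ε := 0) hκ f1 (by rw [f2]; module) f3
  exact ⟨c, c0, f1, f2, f3, g12, g13, g23⟩

-- Without generating pairs only the derogatory cases of `cyclic_or` survive. Those with both
-- eigenvalues zero are collected in the first alternative, where `ad x` squares to zero modulo `x`.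
omit [CharZero K] in
theorem nilpotent_or (hd : finrank K L = 4) (hG : ¬ ∃ x y : L, GPair K x y) {x : L} (hx : x ≠ 0) :
    (∀ y, ∃ s : K, ⁅x, ⁅x, y⁆⁆ = s • x) ∨
    (∃ κ : K, κ ≠ 0 ∧ ∀ y, ∃ s : K, ⁅x, y⁆ = κ • y + s • x) ∨
    ∃ (b : Basis (Fin 4) K L) (κ ν s s' : K), (κ ≠ 0 ∨ ν ≠ 0) ∧ b 0 = x ∧
      ⁅x, b 1⁆ = κ • b 1 + s • x ∧ ⁅x, b 2⁆ = κ • b 2 + b 3 ∧ ⁅x, b 3⁆ = (κ + ν) • b 3 + s' • x := by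
  obtain ⟨v, hv⟩ | ⟨κ, h⟩ | ⟨b, κ, ν, s, s', h0, h1, h2, h3⟩ := cyclic_or hd hx
  · exact absurd ⟨x, v, hv⟩ hG
  · by_cases hκ : κ = 0
    · subst hκ
      refine Or.inl fun y => ⟨0, ?_⟩
      obtain ⟨s, hs⟩ := h y
      rw [hs]; simp
    · exact Or.inr (Or.inl ⟨κ, hκ, h⟩)
  · by_cases hκ : κ ≠ 0 ∨ ν ≠ 0
    · exact Or.inr (Or.inr ⟨b, κ, ν, s, s', hκ, h0, h1, h2, h3⟩)
    · push Not at hκ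
      obtain ⟨rfl, rfl⟩ := hκ
      refine Or.inl fun y => ?_
      obtain ⟨p, q, r, t, rfl⟩ := exists_coords b y
      refine ⟨r * s', ?_⟩
      simp only [lie_add, lie_smul, h0, h1, h2, h3, lie_self, zero_smul, zero_add, smul_zero,
        add_zero]
      module

/-- Polarizing the hypothesis makes `⁅x, ⁅y, z⁆⁆` alternating in all three arguments, and the Jacobi
identity then reads `3 ⁅x, ⁅y, z⁆⁆ = 0`. -/
theorem lie_lie_eq_zero_of_two_engel (ht : ∀ v : L, v + v + v = 0 → v = 0)
    (h : ∀ x y : L, ⁅x, ⁅x, y⁆⁆ = 0) (x y z : L) :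
    ⁅x, ⁅y, z⁆⁆ = 0 := by
  have h1 : ∀ x y z : L, ⁅x, ⁅y, z⁆⁆ = -⁅y, ⁅x, z⁆⁆ := by
    intro x y z
    have := h (x + y) z
    simp only [add_lie, lie_add, h, zero_add, add_zero] at this
    exact eq_neg_of_add_eq_zero_left (by rw [← this]; abel)
  have h2 := leibniz_lie x y z
  have h3 : ⁅⁅x, y⁆, z⁆ = -⁅z, ⁅x, y⁆⁆ := (lie_skew _ _).symm
  have h4 : ⁅z, ⁅x, y⁆⁆ = -⁅x, ⁅z, y⁆⁆ := h1 z x y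
  have h5 : ⁅x, ⁅z, y⁆⁆ = -⁅x, ⁅y, z⁆⁆ := by
    rw [← lie_skew z y, lie_neg]
  have h6 := h1 y x z
  rw [h3, h4, h5, h6, neg_neg] at h2
  refine ht _ ?_
  nth_rewrite 1 [h2]
  abel

variable (K L) in
/-- Rough classification of the four-dimensional Lie algebras. -/
theorem classification (hd : finrank K L = 4) :
    (∀ x y : L, ⁅x, y⁆ = 0) ∨ ((∀ x y z : L, ⁅x, ⁅y, z⁆⁆ = 0) ∧ ∃ x y : L, ⁅x, y⁆ ≠ 0) ∨
    (∃ x y : L, GPair K x y) ∨ (∃ κ μ : K, (κ ≠ 0 ∨ μ ≠ 0) ∧ IsDiagonalExt K L κ μ) ∨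
    (∃ κ : K, κ ≠ 0 ∧ IsJordanExt K L κ) ∨ ∃ κ : K, κ ≠ 0 ∧ IsScalarHeisenbergExt K L κ := by
  by_cases hG : ∃ x y : L, GPair K x y
  · exact Or.inr (Or.inr (Or.inl hG))
  by_cases hE : ∀ x y : L, ⁅x, ⁅x, y⁆⁆ = 0
  · by_cases hA : ∀ x y : L, ⁅x, y⁆ = 0
    · exact Or.inl hA
    · push Not at hA
      exact Or.inr (Or.inl ⟨lie_lie_eq_zero_of_two_engel (fun v hv => by
        have h3 : (3 : K) • v = 0 := by rw [← hv]; module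
        exact (smul_eq_zero.mp h3).resolve_left three_ne_zero) hE, hA⟩)
  push Not at hE
  obtain ⟨x, y, hxy⟩ := hE
  have hx : x ≠ 0 := by rintro rfl; simp at hxy
  have hmain : ∃ x : L, x ≠ 0 ∧ ((∃ κ : K, κ ≠ 0 ∧ ∀ y, ∃ s : K, ⁅x, y⁆ = κ • y + s • x) ∨
      ∃ (b : Basis (Fin 4) K L) (κ ν s s' : K), (κ ≠ 0 ∨ ν ≠ 0) ∧ b 0 = x ∧
      ⁅x, b 1⁆ = κ • b 1 + s • x ∧ ⁅x, b 2⁆ = κ • b 2 + b 3 ∧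
      ⁅x, b 3⁆ = (κ + ν) • b 3 + s' • x) := by
    by_contra! hno
    obtain ⟨s, hs⟩ := (nilpotent_or hd hG hx).resolve_right (fun h => by
      have := hno x hx
      rcases h with ⟨κ, h1, h2⟩ | ⟨b, κ, ν, s, s', h1, h2, h3, h4, h5⟩
      · obtain ⟨y, hy⟩ := this.1 κ h1
        obtain ⟨s, hs⟩ := h2 y
        exact hy s hs
      · exact this.2 b κ ν s s' h1 h2 h3 h4 h5) y
    have hs0 : s ≠ 0 := by rintro rfl; simp [hs] at hxy
    have hz : ⁅x, y⁆ ≠ 0 := by intro h; simp [h] at hxy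
    -- If no adjoint had a nonzero eigenvalue modulo its own vector, then with `z = ⁅x, y⁆` the
    -- vector `x` would satisfy `⁅z, x⁆ = -s • x` with `s ≠ 0`. But `⁅z, ⁅z, x⁆⁆ = s ^ 2 • x` must
    -- be a multiple of `z`, and applying `ad x` shows that this multiple is zero.
    have hzx : ⁅⁅x, y⁆, x⁆ = -(s • x) := by rw [← lie_skew, hs]
    obtain ⟨s', hs'⟩ := (nilpotent_or hd hG hz).resolve_right (fun h => by
      have := hno _ hz
      rcases h with ⟨κ, h1, h2⟩ | ⟨b, κ, ν, s, s', h1, h2, h3, h4, h5⟩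
      · obtain ⟨y, hy⟩ := this.1 κ h1
        obtain ⟨s, hs⟩ := h2 y
        exact hy s hs
      · exact this.2 b κ ν s s' h1 h2 h3 h4 h5) x
    rw [hzx, lie_neg, lie_smul, hzx] at hs'
    have h3 : ⁅x, (s * s) • x⁆ = ⁅x, s' • ⁅x, y⁆⁆ := by
      rw [← hs', smul_neg, neg_neg, smul_smul]
    rw [lie_smul, lie_self, smul_zero, lie_smul, hs] at h3
    have hs'0 : s' = 0 := by
      have := h3.symm
      simpa [hs0, hx] using this
    rw [hs'0, zero_smul, smul_neg, neg_neg, smul_smul] at hs'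
    simp [hs0, hx] at hs'
  obtain ⟨x, hx, ⟨κ, hκ, h⟩ | ⟨b, κ, ν, s, s', hne, rfl, h1, h2, h3⟩⟩ := hmain
  · obtain ⟨c, -, hc⟩ := isDiagonalExt_of_scalar hd hx hκ h
    exact Or.inr (Or.inr (Or.inr (Or.inl ⟨κ, κ, Or.inl hκ, c, hc⟩)))
  -- A nonzero eigenvalue lets one remove the component along `b 0`, so the cases in which `κ` or `κ
  -- + ν` vanishes need separate lemmas.
  by_cases hκ : κ = 0
  · subst hκ
    have hν : ν ≠ 0 := by simpa using hne
    obtain ⟨c, c0, c1, c2, c3⟩ := exists_basis_of_det4 b (x := b 0) (y := b 1)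
      (z := b 2 - ν⁻¹ • b 3) (w := b 3 + (s' / ν) • b 0)
      (u := ![1, 0, 0, 0]) (v := ![0, 1, 0, 0])
      (t := ![0, 0, 1, -ν⁻¹]) (s := ![s' / ν, 0, 0, 1]) (by simp)
      (by simp) (by simp; module) (by simp; module) (by rw [det_four]; simp)
    obtain h | h := gpair_or_isDiagonalExt_zero_left (b := c) (s1 := s) (s2 := -(s' / ν)) hν
      (by rw [c0, c1, h1]; module)
      (by rw [c0, c2, lie_sub, lie_smul, h2, h3]; match_scalars <;> field_simp <;> ring)
      (by rw [c0, c3, lie_add, lie_smul, lie_self, h3]; match_scalars <;> field_simp; ring)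
    · exact absurd h hG
    · exact Or.inr (Or.inr (Or.inr (Or.inl ⟨0, ν, Or.inr hν, h⟩)))
  by_cases hμ : κ + ν = 0
  · have hν : ν = -κ := by linear_combination hμ
    obtain ⟨c, c0, c1, c2, c3⟩ := exists_basis_of_det4 b (x := b 0) (y := b 1 + (s / κ) • b 0)
      (z := b 2 + κ⁻¹ • b 3 + (s' / κ ^ 2) • b 0) (w := b 3)
      (u := ![1, 0, 0, 0]) (v := ![s / κ, 1, 0, 0])
      (t := ![s' / κ ^ 2, 0, 1, κ⁻¹]) (s := ![0, 0, 0, 1]) (by simp)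
      (by simp; module) (by simp; module) (by simp) (by rw [det_four]; simp)
    rw [hμ] at h3
    obtain h | h := gpair_or_isDiagonalExt_zero_right (b := c) (s := s') hκ
      (by rw [c0, c1, lie_add, lie_smul, lie_self, h1]; match_scalars <;> field_simp)
      (by rw [c0, c2, lie_add, lie_add, lie_smul, lie_smul, lie_self, h2, h3]
          match_scalars <;> field_simp <;> ring)
      (by rw [c0, c3, h3]; module)
    · exact absurd h hG
    · exact Or.inr (Or.inr (Or.inr (Or.inl ⟨κ, 0, Or.inl hκ, h⟩)))
  obtain ⟨c, c0, f1, f2, f3⟩ := exists_diagonal_lift hκ hμ h1 h2 h3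
  by_cases hν : ν = 0
  · subst hν
    rw [add_zero] at f3
    obtain ⟨g12, g13, g23⟩ := jordan_brackets (ε := 1) hκ f1 (by rw [f2]; module) f3
    exact Or.inr (Or.inr (Or.inr (Or.inr (Or.inl ⟨κ, hκ, c, f1, f2, f3, g12, g13, g23⟩))))
  · obtain ⟨e, e0, k1, k2, k3⟩ := exists_diagonal_of_ne (s' := 0) hν f1 (by rw [f2]; module) f3
    have k2' : ⁅e 0, e 2⁆ = κ • e 2 := by rw [k2]; module
    obtain ⟨t, g12, ht, g13, g23⟩ := diagonal_or_heisenberg hκ hμ k1 k2' k3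
    by_cases ht0 : t = 0
    · subst ht0
      exact Or.inr (Or.inr (Or.inr (Or.inl ⟨κ, κ + ν, Or.inl hκ, e, k1, k2', k3,
        by rw [g12, zero_smul], g13, g23⟩)))
    · have : κ + ν = 2 * κ := by
        have := (mul_eq_zero.mp ht).resolve_right ht0
        linear_combination this
      rw [this] at k3
      exact Or.inr (Or.inr (Or.inr (Or.inr (Or.inr ⟨κ, hκ,
        isScalarHeisenbergExt_of ht0 k1 k2' k3 g12 g13 g23⟩))))

end Classification
-- Filtrations, convergence of bases, and traces of powers of `ad`
section Degenerations

variable (𝕜 L L0 : Type*) [RCLike 𝕜] [LieRing L] [LieAlgebra 𝕜 L] [LieRing L0] [LieAlgebra 𝕜 L0]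

variable {𝕜 L L0} in
/-- The structure constants in the basis `b0` are the parts of weight zero of those in the basis
`b`, whose parts of negative weight vanish; here the weight of `c i j k` is `α i + α j - α k`. -/
def IsGradation (α : Fin 4 → ℝ) (b : Basis (Fin 4) 𝕜 L) (b0 : Basis (Fin 4) 𝕜 L0) : Prop :=
  ∀ i j k, (α i + α j < α k → b.repr ⁅b i, b j⁆ k = 0) ∧
    b0.repr ⁅b0 i, b0 j⁆ k = if α i + α j = α k then b.repr ⁅b i, b j⁆ k else 0

/-- `L0` is the graded Lie algebra of `L` with respect to the filtration defined by assigning the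
weights `α` to the vectors of some basis. -/
def Degenerates (α : Fin 4 → ℝ) : Prop :=
  ∃ (b : Basis (Fin 4) 𝕜 L) (b0 : Basis (Fin 4) 𝕜 L0), IsGradation α b b0

variable {𝕜 L L0}

/-- Convergence of vectors with respect to a family of bases. -/
def Conv (B : ℝ → Basis (Fin 4) 𝕜 L) (b0 : Basis (Fin 4) 𝕜 L0) (u : ℝ → L) (u0 : L0) : Prop :=
  ∀ k, Tendsto (fun ε => (B ε).repr (u ε) k) (𝓝[>] 0) (𝓝 (b0.repr u0 k))

variable {B : ℝ → Basis (Fin 4) 𝕜 L} {b0 : Basis (Fin 4) 𝕜 L0}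

theorem Conv.basis (i : Fin 4) : Conv B b0 (fun ε => B ε i) (b0 i) := by
  intro k
  simp only [Basis.repr_self]
  exact tendsto_const_nhds

theorem exists_conv (u0 : L0) : ∃ u, Conv B b0 u u0 := by
  refine ⟨fun ε => ∑ i, b0.repr u0 i • B ε i, fun k => ?_⟩
  simp only [Basis.repr_sum_self]
  exact tendsto_const_nhds

theorem repr_lie_eq_sum (b : Basis (Fin 4) 𝕜 L) (u v : L) (k : Fin 4) :
    b.repr ⁅u, v⁆ k = ∑ i, ∑ j, b.repr u i * b.repr v j * b.repr ⁅b i, b j⁆ k := by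
  conv_lhs => rw [← b.sum_repr u, ← b.sum_repr v]
  simp only [sum_lie_sum, smul_lie, lie_smul, map_sum, map_smul, Finsupp.coe_finsetSum,
    Finset.sum_apply, Finsupp.coe_smul, Pi.smul_apply, smul_eq_mul]
  refine Finset.sum_congr rfl fun i _ => Finset.sum_congr rfl fun j _ => ?_
  ring

theorem Conv.lie (hB : ∀ i j, Conv B b0 (fun ε => ⁅B ε i, B ε j⁆) ⁅b0 i, b0 j⁆) {u v : ℝ → L}
    {u0 v0 : L0} (hu : Conv B b0 u u0) (hv : Conv B b0 v v0) :
    Conv B b0 (fun ε => ⁅u ε, v ε⁆) ⁅u0, v0⁆ := by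
  intro k
  rw [repr_lie_eq_sum b0]
  rw [funext fun ε => repr_lie_eq_sum (B ε) (u ε) (v ε) k]
  exact tendsto_finsetSum _ fun i _ => tendsto_finsetSum _ fun j _ =>
    ((hu i).mul (hv j)).mul (hB i j k)

/-- The determinant of the coordinates is continuous and nonzero in the limit. -/
theorem Conv.eventually_basis {x y z w : ℝ → L} {e : Basis (Fin 4) 𝕜 L0}
    (hx : Conv B b0 x (e 0)) (hy : Conv B b0 y (e 1)) (hz : Conv B b0 z (e 2))
    (hw : Conv B b0 w (e 3)) : ∀ᶠ ε in 𝓝[>] 0, ∃ b : Basis (Fin 4) 𝕜 L,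
      b 0 = x ε ∧ b 1 = y ε ∧ b 2 = z ε ∧ b 3 = w ε := by
  let u : Fin 4 → ℝ → L := ![x, y, z, w]
  have hu : ∀ i, Conv B b0 (u i) (e i) := by
    intro i; fin_cases i <;> assumption
  let A : ℝ → Matrix (Fin 4) (Fin 4) 𝕜 := fun ε => Matrix.of fun i k => (B ε).repr (u i ε) k
  let A0 : Matrix (Fin 4) (Fin 4) 𝕜 := Matrix.of fun i k => b0.repr (e i) k
  have hA0 : A0.det ≠ 0 := by
    have : A0 = (b0.toMatrix e).transpose := by ext i j; rfl
    rw [this, Matrix.det_transpose, ← Basis.det_apply]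
    exact (Basis.isUnit_det b0 e).ne_zero
  have hA : Tendsto A (𝓝[>] 0) (𝓝 A0) := by
    refine tendsto_pi_nhds.mpr fun i => tendsto_pi_nhds.mpr fun k => hu i k
  have hdet : Tendsto (fun ε => (A ε).det) (𝓝[>] 0) (𝓝 A0.det) :=
    ((continuous_id.matrix_det).tendsto A0).comp hA
  filter_upwards [hdet.eventually_ne hA0] with ε hε
  obtain ⟨b, hb⟩ := exists_basis_of_det (B ε) (fun i => u i ε) (A ε) (fun i => by
    conv_lhs => rw [← (B ε).sum_repr (u i ε), Fin.sum_univ_four]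
    rfl) hε
  exact ⟨b, hb 0, hb 1, hb 2, hb 3⟩

variable (𝕜) in
/-- The trace of the `m`-th power of `ad x`. -/
noncomputable def adTrace (m : ℕ) (x : L) : 𝕜 := LinearMap.trace 𝕜 L (LieAlgebra.ad 𝕜 L x ^ m)

theorem adTrace_eq (b : Basis (Fin 4) 𝕜 L) (m : ℕ) (x : L) :
    adTrace 𝕜 m x = ∑ i, b.repr ((LieAlgebra.ad 𝕜 L x ^ m) (b i)) i := trace_eq_sum b _

theorem Conv.ad_pow (hB : ∀ i j, Conv B b0 (fun ε => ⁅B ε i, B ε j⁆) ⁅b0 i, b0 j⁆) {u v : ℝ → L}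
    {u0 v0 : L0} (hu : Conv B b0 u u0) (hv : Conv B b0 v v0) (m : ℕ) :
    Conv B b0 (fun ε => (LieAlgebra.ad 𝕜 L (u ε) ^ m) (v ε)) ((LieAlgebra.ad 𝕜 L0 u0 ^ m) v0) := by
  induction m with
  | zero => simpa using hv
  | succ m ih =>
    simp only [pow_succ', Module.End.mul_apply, LieAlgebra.ad_apply]
    exact Conv.lie hB hu ih

theorem Conv.adTrace (hB : ∀ i j, Conv B b0 (fun ε => ⁅B ε i, B ε j⁆) ⁅b0 i, b0 j⁆) {u : ℝ → L}
    {u0 : L0} (hu : Conv B b0 u u0) (m : ℕ) :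
    Tendsto (fun ε => adTrace 𝕜 m (u ε)) (𝓝[>] 0) (𝓝 (adTrace 𝕜 m u0)) := by
  rw [adTrace_eq b0]
  have : (fun ε => LieDegeneration.adTrace 𝕜 m (u ε)) =
      fun ε => ∑ i, (B ε).repr ((LieAlgebra.ad 𝕜 L (u ε) ^ m) (B ε i)) i :=
    funext fun ε => adTrace_eq (B ε) m _
  rw [this]
  exact tendsto_finsetSum _ fun i _ => Conv.ad_pow hB hu (Conv.basis i) m i

theorem Conv.killingForm (hB : ∀ i j, Conv B b0 (fun ε => ⁅B ε i, B ε j⁆) ⁅b0 i, b0 j⁆)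
    {u v : ℝ → L} {u0 v0 : L0} (hu : Conv B b0 u u0) (hv : Conv B b0 v v0) :
    Tendsto (fun ε => killingForm 𝕜 L (u ε) (v ε)) (𝓝[>] 0) (𝓝 (killingForm 𝕜 L0 u0 v0)) := by
  rw [killing_eq_sum b0]
  have : (fun ε => _root_.killingForm 𝕜 L (u ε) (v ε)) = _ :=
    funext fun ε => killing_eq_sum (B ε) (u ε) (v ε)
  rw [this]
  have key := fun i => Conv.lie hB hu (Conv.lie hB hv (Conv.basis i)) i
  exact (((key 0).add (key 1)).add (key 2)).add (key 3)

theorem Conv.killingGram (hB : ∀ i j, Conv B b0 (fun ε => ⁅B ε i, B ε j⁆) ⁅b0 i, b0 j⁆)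
    {u v : ℝ → L} {u0 v0 : L0} (hu : Conv B b0 u u0) (hv : Conv B b0 v v0) :
    Tendsto (fun ε => killingGram 𝕜 (u ε) (v ε)) (𝓝[>] 0) (𝓝 (killingGram 𝕜 u0 v0)) :=
  ((Conv.killingForm hB hu hu).mul (Conv.killingForm hB hv hv)).sub
    ((Conv.killingForm hB hu hv).pow 2)

theorem Degenerates.exists_family {α : Fin 4 → ℝ} (h : Degenerates 𝕜 L L0 α) :
    ∃ (B : ℝ → Basis (Fin 4) 𝕜 L) (b0 : Basis (Fin 4) 𝕜 L0),
      (∀ i j, Conv B b0 (fun ε => ⁅B ε i, B ε j⁆) ⁅b0 i, b0 j⁆) ∧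
      ∀ i, (∀ m, m ≠ 0 → adTrace 𝕜 m (b0 i) = 0) ∨ ∃ x : L, x ≠ 0 ∧ Conv B b0 (fun _ => x) (b0 i) := by
  obtain ⟨b, b0, hb⟩ := h
  have hu : ∀ (ε : ℝ), 0 < ε → ∀ i, IsUnit ((ε ^ α i : ℝ) : 𝕜) := fun ε hε i =>
    isUnit_iff_ne_zero.mpr (by exact_mod_cast (Real.rpow_pos_of_pos hε _).ne')
  -- The approximating basis is `ε ^ α i • b i`; the value for `ε ≤ 0` is irrelevant. A vector of
  -- weight zero is constant in this family.
  let B : ℝ → Basis (Fin 4) 𝕜 L := fun ε => if hε : 0 < ε then b.isUnitSMul (hu ε hε) else b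
  have hBi : ∀ ε, 0 < ε → ∀ i, B ε i = ((ε ^ α i : ℝ) : 𝕜) • b i := by
    intro ε hε i
    simp [B, hε, Basis.isUnitSMul_apply]
  have hBr : ∀ ε, 0 < ε → ∀ v k, (B ε).repr v k = ((ε ^ (-α k) : ℝ) : 𝕜) * b.repr v k := by
    intro ε hε v k
    have h1 : v = ∑ i, (((ε ^ (-α i) : ℝ) : 𝕜) * b.repr v i) • B ε i := by
      conv_lhs => rw [← b.sum_repr v]
      refine Finset.sum_congr rfl fun i _ => ?_
      have h2 : ((ε ^ (-α i) : ℝ) : 𝕜) * ((ε ^ α i : ℝ) : 𝕜) = 1 := by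
        rw [← RCLike.ofReal_mul, ← Real.rpow_add hε]; simp
      rw [hBi ε hε, smul_smul]
      congr 1
      linear_combination -(b.repr v i) * h2
    conv_lhs => rw [h1]
    rw [Basis.repr_sum_self]
  refine ⟨B, b0, ?_, ?_⟩
  · intro i j k
    have h1 : ∀ᶠ ε in 𝓝[>] (0 : ℝ), ((ε ^ (α i + α j - α k) : ℝ) : 𝕜) * b.repr ⁅b i, b j⁆ k =
        (B ε).repr ⁅B ε i, B ε j⁆ k := by
      filter_upwards [self_mem_nhdsWithin] with ε hε
      have hε : 0 < ε := hε
      rw [hBr ε hε, hBi ε hε, hBi ε hε, lie_smul, smul_lie]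
      simp only [map_smul, Finsupp.coe_smul, Pi.smul_apply, smul_eq_mul]
      rw [show α i + α j - α k = -α k + α j + α i by ring, Real.rpow_add hε, Real.rpow_add hε]
      push_cast
      ring
    refine Tendsto.congr' h1 ?_
    obtain ⟨h2, h3⟩ := hb i j k
    rw [h3]
    rcases lt_trichotomy (α i + α j) (α k) with hlt | heq | hgt
    · rw [h2 hlt]; simp
    · rw [if_pos heq, heq, sub_self]
      simp
    · rw [if_neg hgt.ne']
      have h4 : Tendsto (fun ε : ℝ => ε ^ (α i + α j - α k)) (𝓝[>] 0) (𝓝 0) := by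
        have h5 := (Real.continuousAt_rpow_const 0 (α i + α j - α k)
          (Or.inr (by linarith : (0:ℝ) ≤ _))).tendsto
        rw [Real.zero_rpow (by linarith : α i + α j - α k ≠ 0)] at h5
        exact h5.mono_left nhdsWithin_le_nhds
      have h6 := ((RCLike.continuous_ofReal (K := 𝕜)).tendsto 0).comp h4
      simpa using h6.mul_const (b.repr ⁅b i, b j⁆ k)
  · intro i
    by_cases hi : α i = 0
    · refine Or.inr ⟨b i, b.ne_zero i, fun k => ?_⟩
      refine Tendsto.congr' ?_ (Conv.basis (B := B) (b0 := b0) i k)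
      filter_upwards [self_mem_nhdsWithin] with ε hε
      rw [hBi ε hε, hi]
      simp
    · refine Or.inl fun m hm => ?_
      -- In the graded algebra `ad (b0 i)` raises weights by `α i ≠ 0`, so its positive powers have
      -- zero diagonal.
      have key : ∀ (m : ℕ) (j k : Fin 4), α k ≠ m * α i + α j →
          b0.repr ((LieAlgebra.ad 𝕜 L0 (b0 i) ^ m) (b0 j)) k = 0 := by
        intro m
        induction m with
        | zero =>
          intro j k hk
          have : j ≠ k := by rintro rfl; simp at hk
          simp [this]
        | succ m ih =>
          intro j k hk
          rw [pow_succ', Module.End.mul_apply, LieAlgebra.ad_apply, repr_lie_eq_sum]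
          refine Finset.sum_eq_zero fun p _ => Finset.sum_eq_zero fun q _ => ?_
          by_cases hp : p = i
          · subst hp
            rw [(hb p q k).2]
            by_cases hq : α q = m * α p + α j
            · rw [if_neg, mul_zero]
              rw [hq]
              push_cast at hk
              intro h
              exact hk (by rw [← h]; ring)
            · rw [ih j q hq]; ring
          · simp [Ne.symm hp]
      rw [adTrace_eq b0]
      refine Finset.sum_eq_zero fun j _ => key m j j ?_
      intro h
      have : (m : ℝ) * α i = 0 := by linarith
      simp [hm, hi] at this

end Degenerations
-- Isomorphisms from equal structure constants
section Equivalences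

variable {K L L0 : Type*} [Field K] [LieRing L] [LieAlgebra K L] [LieRing L0] [LieAlgebra K L0]

theorem lieEquiv_of_repr (b : Basis (Fin 4) K L) (b0 : Basis (Fin 4) K L0)
    (h : ∀ i j k, b0.repr ⁅b0 i, b0 j⁆ k = b.repr ⁅b i, b j⁆ k) : Nonempty (L ≃ₗ⁅K⁆ L0) := by
  let e : L ≃ₗ[K] L0 := b.equiv b0 (Equiv.refl _)
  have he : ∀ i, e (b i) = b0 i := fun i => by simp [e]
  have hrepr : ∀ v k, b0.repr (e v) k = b.repr v k := by
    intro v k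
    conv_lhs => rw [← b.sum_repr v]
    simp only [map_sum, map_smul, he, Basis.repr_self, Finsupp.coe_finsetSum, Finset.sum_apply,
      Finsupp.coe_smul, Pi.smul_apply, smul_eq_mul]
    simp [Finsupp.single_apply]
  have hlie : ∀ u v, e ⁅u, v⁆ = ⁅e u, e v⁆ := by
    intro u v
    have h1 : ∀ i j, e ⁅b i, b j⁆ = ⁅b0 i, b0 j⁆ := fun i j =>
      b0.ext_elem fun k => by rw [hrepr, h]
    rw [← b.sum_repr u, ← b.sum_repr v]
    simp only [sum_lie_sum, smul_lie, lie_smul, map_sum, map_smul, he, h1]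
  exact ⟨{ e with map_lie' := fun {u v} => hlie u v }⟩

theorem lieEquiv_of_brackets (b : Basis (Fin 4) K L) (b0 : Basis (Fin 4) K L0)
    {v01 v02 v03 v12 v13 v23 : L} {w01 w02 w03 w12 w13 w23 : L0}
    (hb : Brackets b v01 v02 v03 v12 v13 v23) (hb0 : Brackets b0 w01 w02 w03 w12 w13 w23)
    (h01 : b.equivFun v01 = b0.equivFun w01) (h02 : b.equivFun v02 = b0.equivFun w02)
    (h03 : b.equivFun v03 = b0.equivFun w03) (h12 : b.equivFun v12 = b0.equivFun w12)
    (h13 : b.equivFun v13 = b0.equivFun w13) (h23 : b.equivFun v23 = b0.equivFun w23) :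
    Nonempty (L ≃ₗ⁅K⁆ L0) := by
  have key : ∀ i j, i < j → b0.equivFun ⁅b0 i, b0 j⁆ = b.equivFun ⁅b i, b j⁆ := by
    obtain ⟨e1, e2, e3, e4, e5, e6⟩ := hb
    obtain ⟨f1, f2, f3, f4, f5, f6⟩ := hb0
    intro i j hij
    fin_cases i <;> fin_cases j <;> simp at hij <;>
      simp only [Fin.zero_eta, Fin.mk_one, Fin.reduceFinMk, e1, e2, e3, e4, e5, e6, f1, f2, f3, f4,
        f5, f6, h01, h02, h03, h12, h13, h23]
  refine lieEquiv_of_repr b b0 fun i j k => ?_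
  rcases lt_trichotomy i j with h | rfl | h
  · exact congrFun (key i j h) k
  · simp
  · have := congrFun (key j i h) k
    rw [← lie_skew, ← lie_skew (b i), map_neg, map_neg]
    simp only [Finsupp.coe_neg, Pi.neg_apply, neg_inj]
    exact this

end Equivalences

/-! ### Filtrations with integer weights, and rescaling of parameters -/

section Constructors

variable {𝕜 L L0 L' L0' : Type*} [RCLike 𝕜] [LieRing L] [LieAlgebra 𝕜 L] [LieRing L0]
  [LieAlgebra 𝕜 L0] [LieRing L'] [LieAlgebra 𝕜 L'] [LieRing L0'] [LieAlgebra 𝕜 L0']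

theorem isGradation_of_repr (β : Fin 4 → ℕ) (b : Basis (Fin 4) 𝕜 L) (b0 : Basis (Fin 4) 𝕜 L0)
    (h : ∀ i j, i < j → ∀ k, (β i + β j < β k → b.repr ⁅b i, b j⁆ k = 0) ∧
      (β i + β j = β k → b0.repr ⁅b0 i, b0 j⁆ k = b.repr ⁅b i, b j⁆ k) ∧
      (β k ≠ β i + β j → b0.repr ⁅b0 i, b0 j⁆ k = 0)) :
    IsGradation (fun i => (β i : ℝ)) b b0 := by
  have key : ∀ i j k, (β i + β j < β k → b.repr ⁅b i, b j⁆ k = 0) ∧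
      (β i + β j = β k → b0.repr ⁅b0 i, b0 j⁆ k = b.repr ⁅b i, b j⁆ k) ∧
      (β k ≠ β i + β j → b0.repr ⁅b0 i, b0 j⁆ k = 0) := by
    intro i j k
    rcases lt_trichotomy i j with hij | rfl | hij
    · exact h i j hij k
    · simp
    · have := h j i hij k
      rw [← lie_skew, ← lie_skew (b0 i), map_neg, map_neg]
      simp only [Finsupp.coe_neg, Pi.neg_apply, neg_inj, neg_eq_zero]
      rw [add_comm (β i)]
      exact this
  intro i j k
  obtain ⟨h1, h2, h3⟩ := key i j k
  refine ⟨fun hlt => h1 (by simp only at hlt; exact_mod_cast hlt), ?_⟩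
  simp only
  rcases lt_trichotomy (β i + β j) (β k) with hlt | heq | hgt
  · have h4 : ¬ ((β i : ℝ) + β j = β k) := by
      intro h; have : β i + β j = β k := by exact_mod_cast h
      omega
    rw [if_neg h4]
    exact h3 hlt.ne'
  · rw [if_pos (by exact_mod_cast heq), h2 heq]
  · have h4 : ¬ ((β i : ℝ) + β j = β k) := by
      intro h; have : β i + β j = β k := by exact_mod_cast h
      omega
    rw [if_neg h4, h3 hgt.ne]

theorem Degenerates.congr {α : Fin 4 → ℝ} (h : Degenerates 𝕜 L L0 α) (e : L ≃ₗ⁅𝕜⁆ L')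
    (e0 : L0 ≃ₗ⁅𝕜⁆ L0') : Degenerates 𝕜 L' L0' α := by
  obtain ⟨b, b0, hb⟩ := h
  refine ⟨b.map e.toLinearEquiv, b0.map e0.toLinearEquiv, fun i j k => ?_⟩
  have h1 : ⁅e (b i), e (b j)⁆ = e ⁅b i, b j⁆ := (e.map_lie _ _).symm
  have h2 : ⁅e0 (b0 i), e0 (b0 j)⁆ = e0 ⁅b0 i, b0 j⁆ := (e0.map_lie _ _).symm
  have h3 : ∀ v, e.toLinearEquiv.symm (e v) = v := fun v => e.toLinearEquiv.symm_apply_apply v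
  have h4 : ∀ v, e0.toLinearEquiv.symm (e0 v) = v := fun v => e0.toLinearEquiv.symm_apply_apply v
  have h5 := hb i j k
  simp only [Basis.map_apply, Basis.map_repr, LinearEquiv.trans_apply, LieEquiv.coe_toLinearEquiv]
  rw [h1, h2, h3, h4]
  exact h5

theorem degenerates_zero_of_lieEquiv (hd : finrank 𝕜 L = 4) (h : Nonempty (L ≃ₗ⁅𝕜⁆ L0)) :
    Degenerates 𝕜 L L0 (fun i => ((0 : Fin 4 → ℕ) i : ℝ)) := by
  obtain ⟨e⟩ := h
  have : Module.Finite 𝕜 L := Module.finite_of_finrank_pos (by omega)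
  let b : Basis (Fin 4) 𝕜 L := finBasisOfFinrankEq 𝕜 L hd
  have h0 : Degenerates 𝕜 L L (fun i => ((0 : Fin 4 → ℕ) i : ℝ)) :=
    ⟨b, b, fun i j k => by simp⟩
  exact h0.congr LieEquiv.refl e

theorem IsQuadraticAffine.mul_sq {K L : Type*} [Field K] [LieRing L] [LieAlgebra K L] {d t : K}
    (ht : t ≠ 0) (h : IsQuadraticAffine K L d) : IsQuadraticAffine K L (d * t ^ 2) := by
  obtain ⟨b, hB⟩ := h
  obtain ⟨c, c0, c1, c2, c3⟩ := exists_basis_of_det4 b (x := t • b 0) (y := b 1)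
    (z := t • b 2) (w := t ^ 2 • b 3) (u := ![t, 0, 0, 0]) (v := ![0, 1, 0, 0])
    (t := ![0, 0, t, 0]) (s := ![0, 0, 0, t ^ 2]) (by simp) (by simp) (by simp)
    (by simp) (by rw [det_four]; simpa using ht)
  refine ⟨c, ?_, ?_, ?_, ?_, ?_, ?_⟩ <;>
    simp only [c0, c1, c2, c3, lie_smul, smul_lie, hB.h01, hB.h02, hB.h03, hB.h12, hB.h13,
      hB.h23] <;> module

theorem IsReductive.mul_sq {K L : Type*} [Field K] [LieRing L] [LieAlgebra K L] {d f p q : K}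
    (hp : p ≠ 0) (hq : q ≠ 0) (h : IsReductive K L d f) :
    IsReductive K L (d * p ^ 2) (f * q ^ 2) := by
  obtain ⟨b, hB⟩ := h
  obtain ⟨c, c0, c1, c2, c3⟩ := exists_basis_of_det4 b (x := p • b 0) (y := q • b 1)
    (z := (p * q) • b 2) (w := b 3) (u := ![p, 0, 0, 0]) (v := ![0, q, 0, 0])
    (t := ![0, 0, p * q, 0]) (s := ![0, 0, 0, 1]) (by simp) (by simp) (by simp)
    (by simp) (by rw [det_four]; simp [hp, hq])
  refine ⟨c, ?_, ?_, ?_, ?_, ?_, ?_⟩ <;>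
    simp only [c0, c1, c2, c3, lie_smul, smul_lie, hB.h01, hB.h02, hB.h03, hB.h12, hB.h13,
      hB.h23] <;> module

end Constructors

/-! ### Properties of the target inherited by the source -/

section Transfer

variable {𝕜 L L0 : Type*} [RCLike 𝕜] [LieRing L] [LieAlgebra 𝕜 L] [LieRing L0] [LieAlgebra 𝕜 L0]
  {α : Fin 4 → ℝ}

theorem Degenerates.exists_lie_basis (h : Degenerates 𝕜 L L0 α) (e : Basis (Fin 4) 𝕜 L0)
    (he : ⁅e 0, e 1⁆ = e 2) : ∃ b : Basis (Fin 4) 𝕜 L, ⁅b 0, b 1⁆ = b 2 := by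
  obtain ⟨B, b0, hB, -⟩ := h.exists_family
  obtain ⟨x, hx⟩ := exists_conv (B := B) (b0 := b0) (e 0)
  obtain ⟨y, hy⟩ := exists_conv (B := B) (b0 := b0) (e 1)
  obtain ⟨w, hw⟩ := exists_conv (B := B) (b0 := b0) (e 3)
  obtain ⟨ε, b, h0, h1, h2, -⟩ :=
    (Conv.eventually_basis hx hy (he ▸ Conv.lie hB hx hy) hw).exists
  exact ⟨b, by rw [h0, h1, h2]⟩

/-- Being a generating pair is an open condition and the Killing invariants are continuous. A ratio
at distance less than 1 from 1 is a square even over the reals, which later identifies parameters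
defined up to squares. -/
theorem Degenerates.exists_gpair_near (h : Degenerates 𝕜 L L0 α) {x0 y0 : L0}
    (h0 : GPair 𝕜 x0 y0) : ∃ x y : L, GPair 𝕜 x y ∧
      (killingGram 𝕜 x0 y0 ≠ 0 → ‖killingGram 𝕜 x y / killingGram 𝕜 x0 y0 - 1‖ < 1) ∧
      (killingForm 𝕜 L0 x0 x0 ≠ 0 →
        ‖killingForm 𝕜 L x x / killingForm 𝕜 L0 x0 x0 - 1‖ < 1) := by
  obtain ⟨B, b0, hB, -⟩ := h.exists_family
  obtain ⟨x, hx⟩ := exists_conv (B := B) (b0 := b0) x0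
  obtain ⟨y, hy⟩ := exists_conv (B := B) (b0 := b0) y0
  obtain ⟨e, rfl, rfl, e2, e3⟩ := h0
  have hz := Conv.lie hB hx hy
  have hw := Conv.lie hB hx hz
  have h1 := Conv.eventually_basis hx hy (e2 ▸ hz) (e3 ▸ hw)
  have hnear : ∀ (f : ℝ → 𝕜) (f0 : 𝕜), Tendsto f (𝓝[>] 0) (𝓝 f0) →
      ∀ᶠ ε in 𝓝[>] 0, (f0 ≠ 0 → ‖f ε / f0 - 1‖ < 1) := by
    intro f f0 hf
    by_cases h : f0 = 0
    · exact Eventually.of_forall fun ε h' => absurd h h'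
    · have h2 : Tendsto (fun ε => ‖f ε / f0 - 1‖) (𝓝[>] 0) (𝓝 0) := by
        have := ((hf.div_const f0).sub_const 1).norm
        simpa [div_self h] using this
      filter_upwards [h2.eventually_lt_const one_pos] with ε hε _ using hε
  obtain ⟨ε, ⟨b, c0, c1, c2, c3⟩, h3, h4⟩ := (h1.and ((hnear _ _ (Conv.killingGram hB hx hy)).and
    (hnear _ _ (Conv.killingForm hB hx hx)))).exists
  exact ⟨x ε, y ε, ⟨b, c0, c1, c2, c3⟩, h3, h4⟩

theorem Conv.eventually_ne {B : ℝ → Basis (Fin 4) 𝕜 L} {b0 : Basis (Fin 4) 𝕜 L0} {u : ℝ → L}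
    {u0 : L0} (hu : Conv B b0 u u0) (h : u0 ≠ 0) : ∀ᶠ ε in 𝓝[>] 0, u ε ≠ 0 := by
  obtain ⟨k, hk⟩ : ∃ k, b0.repr u0 k ≠ 0 := by
    by_contra! h'
    exact h (b0.ext_elem fun k => by simpa using h' k)
  filter_upwards [(hu k).eventually_ne hk] with ε hε h0
  simp [h0] at hε

theorem Degenerates.not_metabelian (h : Degenerates 𝕜 L L0 α) {p q r s : L0}
    (h0 : ⁅⁅p, q⁆, ⁅r, s⁆⁆ ≠ 0) : ∃ p q r s : L, ⁅⁅p, q⁆, ⁅r, s⁆⁆ ≠ 0 := by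
  obtain ⟨B, b0, hB, -⟩ := h.exists_family
  obtain ⟨x, hx⟩ := exists_conv (B := B) (b0 := b0) p
  obtain ⟨y, hy⟩ := exists_conv (B := B) (b0 := b0) q
  obtain ⟨z, hz⟩ := exists_conv (B := B) (b0 := b0) r
  obtain ⟨w, hw⟩ := exists_conv (B := B) (b0 := b0) s
  obtain ⟨ε, hε⟩ := (Conv.eventually_ne (Conv.lie hB (Conv.lie hB hx hy) (Conv.lie hB hz hw))
    h0).exists
  exact ⟨_, _, _, _, hε⟩

theorem Degenerates.not_unimodular (h : Degenerates 𝕜 L L0 α) {x0 : L0}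
    (h0 : adTrace 𝕜 1 x0 ≠ 0) : ∃ x : L, adTrace 𝕜 1 x ≠ 0 := by
  obtain ⟨B, b0, hB, -⟩ := h.exists_family
  obtain ⟨x, hx⟩ := exists_conv (B := B) (b0 := b0) x0
  obtain ⟨ε, hε⟩ := ((Conv.adTrace hB hx 1).eventually_ne h0).exists
  exact ⟨_, hε⟩

/-- The action on the derived algebra is not by multiples of a single operator. -/
theorem Degenerates.not_proportional (h : Degenerates 𝕜 L L0 α) {u v p q : L0}
    {e : Basis (Fin 4) 𝕜 L0} (e0 : ⁅u, ⁅p, q⁆⁆ = e 0) (e1 : ⁅v, ⁅p, q⁆⁆ = e 1) :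
    ∃ (u v p q : L) (b : Basis (Fin 4) 𝕜 L), ⁅u, ⁅p, q⁆⁆ = b 0 ∧ ⁅v, ⁅p, q⁆⁆ = b 1 := by
  obtain ⟨B, b0, hB, -⟩ := h.exists_family
  obtain ⟨x, hx⟩ := exists_conv (B := B) (b0 := b0) p
  obtain ⟨y, hy⟩ := exists_conv (B := B) (b0 := b0) q
  obtain ⟨z, hz⟩ := exists_conv (B := B) (b0 := b0) u
  obtain ⟨w, hw⟩ := exists_conv (B := B) (b0 := b0) v
  obtain ⟨r, hr⟩ := exists_conv (B := B) (b0 := b0) (e 2)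
  obtain ⟨s, hs⟩ := exists_conv (B := B) (b0 := b0) (e 3)
  have hd := Conv.lie hB hx hy
  obtain ⟨ε, b, c0, c1, -⟩ := (Conv.eventually_basis (e0 ▸ Conv.lie hB hz hd)
    (e1 ▸ Conv.lie hB hw hd) hr hs).exists
  exact ⟨_, _, _, _, b, c0.symm, c1.symm⟩

/-- The properties of a vector of weight zero in the source of a degeneration that it inherits from
its image in the target. -/
structure Shadow (𝕜 : Type*) {L L0 : Type*} [RCLike 𝕜] [LieRing L] [LieAlgebra 𝕜 L] [LieRing L0]
    [LieAlgebra 𝕜 L0] (x : L) (x0 : L0) : Prop where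
  ne_zero : x ≠ 0
  adTrace_eq : ∀ m, adTrace 𝕜 m x = adTrace 𝕜 m x0
  exists_gpair : ∀ y0, GPair 𝕜 x0 y0 → ∃ y, GPair 𝕜 x y
  exists_chain : ∀ e : Basis (Fin 4) 𝕜 L0, e 0 = x0 → ⁅e 0, e 1⁆ = e 2 →
    ∃ b : Basis (Fin 4) 𝕜 L, b 0 = x ∧ ⁅b 0, b 1⁆ = b 2

/-- A nonzero linear functional does not vanish on a whole basis, so some homogeneous vector has a
nonzero coordinate along `c 0`. It may then replace `c 0` as the vector acting on a chosen ideal of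
codimension one. -/
theorem Degenerates.exists_shadow (h : Degenerates 𝕜 L L0 α) (c : Basis (Fin 4) 𝕜 L0) :
    ∃ x0 : L0, c.repr x0 0 ≠ 0 ∧ ((∀ m, m ≠ 0 → adTrace 𝕜 m x0 = 0) ∨
      ∃ x : L, Shadow 𝕜 x x0) := by
  obtain ⟨B, b0, hB, hw⟩ := h.exists_family
  obtain ⟨i, hi⟩ : ∃ i, c.repr (b0 i) 0 ≠ 0 := by
    by_contra! h'
    have h1 : c.coord 0 = 0 := b0.ext fun i => by simpa using h' i
    have h2 : c.coord 0 (c 0) = 1 := by simp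
    rw [h1] at h2
    simp at h2
  refine ⟨b0 i, hi, ?_⟩
  obtain h1 | ⟨x, hx0, hx⟩ := hw i
  · exact Or.inl h1
  refine Or.inr ⟨x, hx0, fun m => ?_, ?_, ?_⟩
  · exact tendsto_nhds_unique tendsto_const_nhds (Conv.adTrace hB hx m)
  · rintro y0 ⟨e, e0, rfl, e2, e3⟩
    obtain ⟨y, hy⟩ := exists_conv (B := B) (b0 := b0) (e 1)
    have hz := Conv.lie hB hx hy
    have hw := Conv.lie hB hx hz
    obtain ⟨ε, b, c0, c1, c2, c3⟩ :=
      (Conv.eventually_basis (e0 ▸ hx) hy (e2 ▸ hz) (e3 ▸ hw)).exists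
    exact ⟨y ε, b, c0, c1, c2, c3⟩
  · intro e e0 e2
    obtain ⟨y, hy⟩ := exists_conv (B := B) (b0 := b0) (e 1)
    obtain ⟨w, hw⟩ := exists_conv (B := B) (b0 := b0) (e 3)
    have hz := Conv.lie hB hx hy
    rw [← e0, e2] at hz
    obtain ⟨ε, b, c0, c1, c2, -⟩ := (Conv.eventually_basis (e0 ▸ hx) hy hz hw).exists
    exact ⟨b, c0, by rw [c0, c1, c2]⟩

end Transfer
-- Abelian, two-step, cyclic and maximal-class targets
section Weights

variable {𝕜 L L0 : Type*} [RCLike 𝕜] [LieRing L] [LieAlgebra 𝕜 L] [LieRing L0] [LieAlgebra 𝕜 L0]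

/-- `w` is the part of weight `s` of `v`, which has no part of higher weight. -/
def IsLeadingPart (β : Fin 4 → ℕ) (s : ℕ) (v w : Fin 4 → 𝕜) : Prop :=
  ∀ k, (s < β k → v k = 0) ∧ (s = β k → w k = v k) ∧ (β k ≠ s → w k = 0)

theorem isGradation_of_brackets (β : Fin 4 → ℕ) {b : Basis (Fin 4) 𝕜 L} {b0 : Basis (Fin 4) 𝕜 L0}
    {v01 v02 v03 v12 v13 v23 : L} {w01 w02 w03 w12 w13 w23 : L0}
    (hb : Brackets b v01 v02 v03 v12 v13 v23) (hb0 : Brackets b0 w01 w02 w03 w12 w13 w23)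
    (h01 : IsLeadingPart β (β 0 + β 1) (b.equivFun v01) (b0.equivFun w01))
    (h02 : IsLeadingPart β (β 0 + β 2) (b.equivFun v02) (b0.equivFun w02))
    (h03 : IsLeadingPart β (β 0 + β 3) (b.equivFun v03) (b0.equivFun w03))
    (h12 : IsLeadingPart β (β 1 + β 2) (b.equivFun v12) (b0.equivFun w12))
    (h13 : IsLeadingPart β (β 1 + β 3) (b.equivFun v13) (b0.equivFun w13))
    (h23 : IsLeadingPart β (β 2 + β 3) (b.equivFun v23) (b0.equivFun w23)) :
    IsGradation (fun i => (β i : ℝ)) b b0 := by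
  obtain ⟨rfl, rfl, rfl, rfl, rfl, rfl⟩ := hb
  obtain ⟨rfl, rfl, rfl, rfl, rfl, rfl⟩ := hb0
  refine isGradation_of_repr β b b0 fun i j hij => ?_
  fin_cases i <;> fin_cases j <;> simp at hij
  exacts [h01, h02, h03, h12, h13, h23]

theorem degenerates_of_brackets (β : Fin 4 → ℕ) {b : Basis (Fin 4) 𝕜 L} {b0 : Basis (Fin 4) 𝕜 L0}
    {v01 v02 v03 v12 v13 v23 : L} {w01 w02 w03 w12 w13 w23 : L0}
    (hb : Brackets b v01 v02 v03 v12 v13 v23) (hb0 : Brackets b0 w01 w02 w03 w12 w13 w23)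
    (h01 : IsLeadingPart β (β 0 + β 1) (b.equivFun v01) (b0.equivFun w01))
    (h02 : IsLeadingPart β (β 0 + β 2) (b.equivFun v02) (b0.equivFun w02))
    (h03 : IsLeadingPart β (β 0 + β 3) (b.equivFun v03) (b0.equivFun w03))
    (h12 : IsLeadingPart β (β 1 + β 2) (b.equivFun v12) (b0.equivFun w12))
    (h13 : IsLeadingPart β (β 1 + β 3) (b.equivFun v13) (b0.equivFun w13))
    (h23 : IsLeadingPart β (β 2 + β 3) (b.equivFun v23) (b0.equivFun w23)) :
    Degenerates 𝕜 L L0 (fun i => (β i : ℝ)) :=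
  ⟨b, b0, isGradation_of_brackets β hb hb0 h01 h02 h03 h12 h13 h23⟩

theorem degenerates_of_abelian (hd : finrank 𝕜 L = 4) (hd0 : finrank 𝕜 L0 = 4)
    (h : ∀ x y : L0, ⁅x, y⁆ = 0) :
    Degenerates 𝕜 L L0 (fun i => ((![1, 1, 1, 1] : Fin 4 → ℕ) i : ℝ)) := by
  have : Module.Finite 𝕜 L := Module.finite_of_finrank_pos (by omega)
  have : Module.Finite 𝕜 L0 := Module.finite_of_finrank_pos (by omega)
  refine ⟨finBasisOfFinrankEq 𝕜 L hd, finBasisOfFinrankEq 𝕜 L0 hd0, isGradation_of_repr _ _ _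
    fun i j _ k => ?_⟩
  rw [h]
  fin_cases i <;> fin_cases j <;> fin_cases k <;> simp

/-- The algebra is a Heisenberg algebra plus a line: every bracket is central, hence `⁅b 0, b 3⁆`
and `⁅b 1, b 3⁆` are multiples of `b 2`, and correcting `b 3` by `b 0` and `b 1` makes it central.
-/
theorem exists_brackets_of_two_step (hd : finrank 𝕜 L0 = 4) (h : ∀ x y z : L0, ⁅x, ⁅y, z⁆⁆ = 0)
    {x y : L0} (hxy : ⁅x, y⁆ ≠ 0) : ∃ b : Basis (Fin 4) 𝕜 L0, Brackets b (b 2) 0 0 0 0 0 := by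
  have hx : x ≠ 0 := by rintro rfl; simp at hxy
  obtain ⟨c, rfl⟩ := exists_basis_zero_eq hd hx
  obtain ⟨κ, hκ⟩ | ⟨b, -, hb⟩ := scalar_or_exists_chain c
  · exfalso
    obtain ⟨s, hs⟩ := hκ y
    have h1 : ⁅c 0, ⁅c 0, y⁆⁆ = 0 := h _ _ _
    have h2 : ⁅y, ⁅c 0, y⁆⁆ = 0 := h _ _ _
    have h3 : κ = 0 := by
      rw [hs, lie_add, lie_smul, lie_smul, lie_self] at h1
      simpa [hxy] using h1
    rw [hs] at h2
    rw [← lie_skew] at hxy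
    have h4 : s = 0 := by
      simp only [lie_add, lie_smul, lie_self, smul_zero, zero_add] at h2
      simpa [neg_ne_zero.mp hxy] using h2
    rw [← lie_skew, neg_neg, hs, h3, h4] at hxy
    simp at hxy
  · have key : ∀ v, (∃ u, v = ⁅b 0, u⁆ ∨ v = ⁅b 1, u⁆) → ⁅b 0, b 3⁆ = v ∨ ⁅b 1, b 3⁆ = v →
        ∃ r : 𝕜, v = r • b 2 := by
      rintro v ⟨u, hu⟩ hv
      have h0 : ⁅b 0, v⁆ = 0 := by rcases hu with rfl | rfl <;> exact h _ _ _
      have h1 : ⁅b 1, v⁆ = 0 := by rcases hu with rfl | rfl <;> exact h _ _ _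
      have e0 : ⁅b 0, b 2⁆ = 0 := by rw [← hb]; exact h _ _ _
      have e1 : ⁅b 1, b 2⁆ = 0 := by rw [← hb]; exact h _ _ _
      have e2 : ⁅b 1, b 0⁆ = -b 2 := by rw [← lie_skew, hb]
      obtain ⟨p, q, r, s, hc⟩ := exists_coords b v
      have h0' := h0
      have h1' := h1
      rw [hc] at h0' h1'
      simp only [lie_add, lie_smul, lie_self, hb, e0, e1, e2] at h0' h1'
      have hs : s = 0 := by
        rcases hv with hv | hv
        · rw [hv, hc] at h0'
          have := (coords_eq_zero b (p := s * p) (q := s * q) (r := q + s * r) (s := s * s)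
            (by linear_combination (norm := module) h0')).2.2.2
          simpa using this
        · rw [hv, hc] at h1'
          have := (coords_eq_zero b (p := s * p) (q := s * q) (r := -p + s * r) (s := s * s)
            (by linear_combination (norm := module) h1')).2.2.2
          simpa using this
      subst hs
      have hq := (coords_eq_zero b (p := 0) (q := 0) (r := q) (s := 0)
        (by linear_combination (norm := module) h0')).2.2.1
      have hp := (coords_eq_zero b (p := 0) (q := 0) (r := p) (s := 0)
        (by linear_combination (norm := module) -h1')).2.2.1
      exact ⟨r, by rw [hc, hq, hp]; module⟩
    obtain ⟨r, hr⟩ := key _ ⟨_, Or.inl rfl⟩ (Or.inl rfl)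
    obtain ⟨r', hr'⟩ := key _ ⟨_, Or.inr rfl⟩ (Or.inr rfl)
    obtain ⟨e, e0, e1, e2, e3⟩ := exists_basis_of_det4 b (x := b 0) (y := b 1) (z := b 2)
      (w := b 3 - r • b 1 + r' • b 0) (u := ![1, 0, 0, 0]) (v := ![0, 1, 0, 0])
      (t := ![0, 0, 1, 0]) (s := ![r', -r, 0, 1]) (by simp) (by simp) (by simp)
      (by simp; module) (by rw [det_four]; simp)
    have h10 : ⁅b 1, b 0⁆ = -b 2 := by rw [← lie_skew, hb]
    have h2 : ∀ v : L0, ⁅b 2, v⁆ = 0 := fun v => by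
      rw [← lie_skew, ← hb, h, neg_zero]
    refine ⟨e, ?_, ?_, ?_, ?_, ?_, ?_⟩ <;> simp only [e0, e1, e2, e3]
    · exact hb
    · rw [← hb]; exact h _ _ _
    · simp only [lie_add, lie_sub, lie_smul, hr, hb, lie_self]; module
    · rw [← hb]; exact h _ _ _
    · simp only [lie_add, lie_sub, lie_smul, hr', h10, lie_self]; module
    · exact h2 _

/-- For the weights 1, 1, 2, 1 only the `b 2`-components of `⁅b 0, b 3⁆` and `⁅b 1, b 3⁆` could
survive wrongly; they are absorbed into `b 3`. -/
theorem degenerates_of_two_step {b : Basis (Fin 4) 𝕜 L} (hb : ⁅b 0, b 1⁆ = b 2)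
    {b0 : Basis (Fin 4) 𝕜 L0} (hb0 : Brackets b0 (b0 2) 0 0 0 0 0) :
    Degenerates 𝕜 L L0 (fun i => ((![1, 1, 2, 1] : Fin 4 → ℕ) i : ℝ)) := by
  obtain ⟨p, q, r, s, h03⟩ := exists_coords b ⁅b 0, b 3⁆
  obtain ⟨p', q', r', s', h13⟩ := exists_coords b ⁅b 1, b 3⁆
  have h10 : ⁅b 1, b 0⁆ = -b 2 := by rw [← lie_skew, hb]
  obtain ⟨e, e0, e1, e2, e3⟩ := exists_basis_of_det4 b (x := b 0) (y := b 1) (z := b 2)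
    (w := b 3 - r • b 1 + r' • b 0) (u := ![1, 0, 0, 0]) (v := ![0, 1, 0, 0])
    (t := ![0, 0, 1, 0]) (s := ![r', -r, 0, 1]) (by simp) (by simp) (by simp)
    (by simp; module) (by rw [det_four]; simp)
  have e03 : ⁅e 0, e 3⁆ = (p - s * r') • e 0 + (q + s * r) • e 1 + s • e 3 := by
    rw [e0, e1, e3]
    simp only [lie_add, lie_sub, lie_smul, h03, hb, lie_self]; module
  have e13 : ⁅e 1, e 3⁆ = (p' - s' * r') • e 0 + (q' + s' * r) • e 1 + s' • e 3 := by
    rw [e0, e1, e3]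
    simp only [lie_add, lie_sub, lie_smul, h13, h10, lie_self]; module
  refine degenerates_of_brackets _ ⟨by rw [e0, e1, hb, ← e2], rfl, e03, rfl, e13, rfl⟩ hb0
    ?_ ?_ ?_ ?_ ?_ ?_ <;> intro k <;> fin_cases k <;> simp

/-- Modulo `b 0` the operator `ad (b 0)` is a companion matrix, so by Newton's identities these
three traces determine `c`, `d` and `e`. -/
theorem adTrace_of_gpair (b : Basis (Fin 4) 𝕜 L) {p c d e : 𝕜} (h01 : ⁅b 0, b 1⁆ = b 2)
    (h02 : ⁅b 0, b 2⁆ = b 3) (h03 : ⁅b 0, b 3⁆ = p • b 0 + c • b 1 + d • b 2 + e • b 3) :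
    adTrace 𝕜 1 (b 0) = e ∧ adTrace 𝕜 2 (b 0) = e ^ 2 + 2 * d ∧
      adTrace 𝕜 3 (b 0) = e ^ 3 + 3 * d * e + 3 * c := by
  refine ⟨?_, ?_, ?_⟩ <;> rw [adTrace_eq b] <;>
    simp [Fin.sum_univ_four, pow_succ, h01, h02, h03] <;> ring

theorem IsCyclicExt.rebase {b : Basis (Fin 4) 𝕜 L} {c d e : 𝕜}
    (h : Brackets b (b 2) (b 3) (c • b 1 + d • b 2 + e • b 3) 0 0 0) {x : L}
    (hx : b.repr x 0 ≠ 0) : ∃ (b' : Basis (Fin 4) 𝕜 L) (p : 𝕜), p ≠ 0 ∧ b' 0 = x ∧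
      Brackets b' (b' 2) (b' 3) ((p ^ 3 * c) • b' 1 + (p ^ 2 * d) • b' 2 + (p * e) • b' 3) 0 0 0 := by
  obtain ⟨p, q, r, s, rfl⟩ := exists_coords b x
  have hp : p ≠ 0 := by simpa using hx
  obtain ⟨b', e0, e1, e2, e3⟩ := exists_basis_of_det4 b
    (x := p • b 0 + q • b 1 + r • b 2 + s • b 3) (y := b 1) (z := p • b 2)
    (w := p ^ 2 • b 3) (u := ![p, q, r, s]) (v := ![0, 1, 0, 0])
    (t := ![0, 0, p, 0]) (s := ![0, 0, 0, p ^ 2]) (by simp) (by simp) (by simp)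
    (by simp) (by rw [det_four]; simp [hp])
  have h21 : ⁅b 2, b 1⁆ = 0 := by rw [← lie_skew, h.h12, neg_zero]
  have h31 : ⁅b 3, b 1⁆ = 0 := by rw [← lie_skew, h.h13, neg_zero]
  have h32 : ⁅b 3, b 2⁆ = 0 := by rw [← lie_skew, h.h23, neg_zero]
  refine ⟨b', p, hp, e0, ?_, ?_, ?_, ?_, ?_, ?_⟩ <;>
    simp only [e0, e1, e2, e3, add_lie, lie_smul, smul_lie, lie_self, h.h01, h.h02, h.h03, h.h12,
      h.h13, h.h23, h21, h31, h32] <;> module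

/-- Unless all traces vanish, which would give the excluded nilpotent case, a vector of weight zero
lifts to some `x` with a cyclic vector and the same traces, hence the same companion matrix. The
weights 0, 1, 1, 1 discard everything else. -/
theorem Degenerates.of_cyclicExt {α : Fin 4 → ℝ} (h : Degenerates 𝕜 L L0 α) {c d e : 𝕜}
    (h0 : IsCyclicExt 𝕜 L0 c d e) (hne : ¬ IsCyclicExt 𝕜 L0 0 0 0) :
    Degenerates 𝕜 L L0 (fun i => ((![0, 1, 1, 1] : Fin 4 → ℕ) i : ℝ)) := by
  obtain ⟨a, ha⟩ := h0
  obtain ⟨x0, hx0, hx⟩ := h.exists_shadow a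
  obtain ⟨a, p, hp, rfl, ha⟩ := IsCyclicExt.rebase ha hx0
  generalize hc : p ^ 3 * c = c at ha
  generalize hd : p ^ 2 * d = d at ha
  generalize he : p * e = e at ha
  obtain ⟨t1, t2, t3⟩ := adTrace_of_gpair (p := 0) a ha.h01 ha.h02 (by rw [ha.h03]; module)
  obtain hx | ⟨x, hx⟩ := hx
  · rw [hx _ one_ne_zero] at t1
    rw [hx _ two_ne_zero, ← t1] at t2
    rw [hx _ three_ne_zero, ← t1] at t3
    have hd : d = 0 := by simpa using t2
    have hc : c = 0 := by simpa using t3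
    rw [hc, hd, ← t1] at ha
    exact absurd ⟨a, by simpa using ha⟩ hne
  · obtain ⟨y, b, rfl, rfl, b2, b3⟩ := hx.exists_gpair (a 1)
      ⟨a, rfl, rfl, by rw [ha.h01], by rw [ha.h01, ha.h02]⟩
    rw [← b2] at b3
    obtain ⟨p', c', d', e', h03⟩ := exists_coords b ⁅b 0, b 3⁆
    obtain ⟨s1, s2, s3⟩ := adTrace_of_gpair b b2.symm b3.symm h03
    rw [hx.adTrace_eq] at s1 s2 s3
    have he : e' = e := by rw [← s1, t1]
    subst he
    have hd : d' = d := by linear_combination (t2 - s2) / 2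
    subst hd
    have hc : c' = c := by linear_combination (t3 - s3) / 3
    subst hc
    refine degenerates_of_brackets _ ⟨b2.symm, b3.symm, h03, rfl, rfl, rfl⟩ ha
      ?_ ?_ ?_ ?_ ?_ ?_ <;> intro k <;> fin_cases k <;> simp

/-- The filtration generated by a generating pair. -/
theorem GPair.degenerates {x y : L} (h : GPair 𝕜 x y) (h0 : IsCyclicExt 𝕜 L0 0 0 0) :
    Degenerates 𝕜 L L0 (fun i => ((![1, 1, 2, 3] : Fin 4 → ℕ) i : ℝ)) := by
  obtain ⟨a, ha⟩ := h0
  obtain ⟨b, rfl, rfl, b2, b3⟩ := h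
  rw [← b2] at b3
  obtain ⟨p, q, r, s, h12⟩ := exists_coords b ⁅b 1, b 2⁆
  -- A `b 3`-component of `⁅b 1, b 2⁆` would have weight zero and survive; the shear removes it.
  obtain ⟨e, e0, e1, e2, e3⟩ := exists_basis_of_det4 b (x := b 0) (y := b 1 - s • b 0) (z := b 2)
    (w := b 3) (u := ![1, 0, 0, 0]) (v := ![-s, 1, 0, 0])
    (t := ![0, 0, 1, 0]) (s := ![0, 0, 0, 1]) (by simp) (by simp; module) (by simp)
    (by simp) (by rw [det_four]; simp)
  have e12 : ⁅e 1, e 2⁆ = (p + q * s) • e 0 + q • e 1 + r • e 2 := by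
    rw [e0, e1, e2, sub_lie, smul_lie, h12, ← b3]
    module
  have e01 : ⁅e 0, e 1⁆ = e 2 := by rw [e0, e1, e2, b2]; simp
  have e02 : ⁅e 0, e 2⁆ = e 3 := by rw [e0, e2, e3, b3]
  refine degenerates_of_brackets _ ⟨e01, e02, rfl, e12, rfl, rfl⟩ ha
    ?_ ?_ ?_ ?_ ?_ ?_ <;> intro k <;> fin_cases k <;> simp

theorem Degenerates.reindex {α : Fin 4 → ℝ} (h : Degenerates 𝕜 L L0 α) (σ : Equiv.Perm (Fin 4)) :
    Degenerates 𝕜 L L0 (fun i => α (σ i)) := by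
  obtain ⟨b, b0, hb⟩ := h
  refine ⟨b.reindex σ.symm, b0.reindex σ.symm, fun i j k => ?_⟩
  simpa using hb (σ i) (σ j) (σ k)

end Weights

/-! ### Jordan forms with prescribed eigenvalues -/

section Spectrum

variable {𝕜 L L0 : Type*} [RCLike 𝕜] [LieRing L] [LieAlgebra 𝕜 L] [LieRing L0] [LieAlgebra 𝕜 L0]

/-- The first two power sums leave `κ' = κ` or `κ' - κ = 2 * (μ - κ) / 3`; in the second case the
third one forces `μ = κ`. -/
theorem eq_of_power_sums {κ μ κ' μ' : 𝕜} (h1 : 2 * κ' + μ' = 2 * κ + μ)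
    (h2 : 2 * κ' ^ 2 + μ' ^ 2 = 2 * κ ^ 2 + μ ^ 2)
    (h3 : 2 * κ' ^ 3 + μ' ^ 3 = 2 * κ ^ 3 + μ ^ 3) : κ' = κ ∧ μ' = μ := by
  obtain rfl : μ' = 2 * κ + μ - 2 * κ' := by linear_combination h1
  have h4 : (κ' - κ) * (3 * (κ' - κ) - 2 * (μ - κ)) = 0 := by linear_combination h2 / 2
  have h5 : κ' = κ := by
    rcases mul_eq_zero.mp h4 with h | h
    · linear_combination h
    · have h6 : κ' = κ + 2 * (μ - κ) / 3 := by linear_combination h / 3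
      have h7 : (μ - κ) ^ 3 = 0 := by
        rw [h6] at h3
        linear_combination -27/12 * h3
      have h8 : μ - κ = 0 := by simpa using h7
      rw [h6, h8]; ring
  exact ⟨h5, by rw [h5]; ring⟩

theorem adTrace_of_triangular (b : Basis (Fin 4) 𝕜 L) {κ ε μ s1 s2 s3 : 𝕜}
    (h1 : ⁅b 0, b 1⁆ = κ • b 1 + s1 • b 0) (h2 : ⁅b 0, b 2⁆ = κ • b 2 + ε • b 3 + s2 • b 0)
    (h3 : ⁅b 0, b 3⁆ = μ • b 3 + s3 • b 0) :
    adTrace 𝕜 1 (b 0) = 2 * κ + μ ∧ adTrace 𝕜 2 (b 0) = 2 * κ ^ 2 + μ ^ 2 ∧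
      adTrace 𝕜 3 (b 0) = 2 * κ ^ 3 + μ ^ 3 := by
  refine ⟨?_, ?_, ?_⟩ <;> rw [adTrace_eq b] <;>
    simp [Fin.sum_univ_four, pow_succ, h1, h2, h3] <;> ring

/-- The possible Jordan forms of `ad x` modulo `x`, given its eigenvalues `κ`, `κ`, `μ`. -/
theorem exists_jordan_basis (hd : finrank 𝕜 L = 4) {x : L} (hx : x ≠ 0) {κ μ : 𝕜}
    (t1 : adTrace 𝕜 1 x = 2 * κ + μ) (t2 : adTrace 𝕜 2 x = 2 * κ ^ 2 + μ ^ 2)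
    (t3 : adTrace 𝕜 3 x = 2 * κ ^ 3 + μ ^ 3) :
    (κ ≠ μ ∧ ∃ (b : Basis (Fin 4) 𝕜 L) (s : 𝕜), b 0 = x ∧ ⁅b 0, b 1⁆ = κ • b 1 + s • b 0 ∧
      ⁅b 0, b 2⁆ = κ • b 2 + b 1 ∧ ⁅b 0, b 3⁆ = μ • b 3 + s • b 0) ∨
    (κ = μ ∧ ∃ (b : Basis (Fin 4) 𝕜 L) (s : 𝕜), b 0 = x ∧ ⁅b 0, b 1⁆ = κ • b 1 + s • b 0 ∧
      ⁅b 0, b 2⁆ = κ • b 2 + b 1 ∧ ⁅b 0, b 3⁆ = κ • b 3 + b 2) ∨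
    (κ ≠ μ ∧ ∃ (b : Basis (Fin 4) 𝕜 L) (s1 s2 s3 : 𝕜), b 0 = x ∧
      ⁅b 0, b 1⁆ = κ • b 1 + s1 • b 0 ∧ ⁅b 0, b 2⁆ = κ • b 2 + s2 • b 0 ∧
      ⁅b 0, b 3⁆ = μ • b 3 + s3 • b 0) ∨
    (κ = μ ∧ ∃ (b : Basis (Fin 4) 𝕜 L) (s1 s3 : 𝕜), b 0 = x ∧
      ⁅b 0, b 1⁆ = κ • b 1 + s1 • b 0 ∧ ⁅b 0, b 2⁆ = κ • b 2 + b 3 ∧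
      ⁅b 0, b 3⁆ = κ • b 3 + s3 • b 0) ∨
    (κ = μ ∧ ∀ y, ∃ s : 𝕜, ⁅x, y⁆ = κ • y + s • x) := by
  obtain ⟨v, b, rfl, rfl, b2, b3⟩ | ⟨κ', hκ⟩ | ⟨b, κ', ν, s, s', rfl, h1, h2, h3⟩ := cyclic_or hd hx
  · rw [← b2] at b3
    obtain ⟨p, c, d, e, h03⟩ := exists_coords b ⁅b 0, b 3⁆
    obtain ⟨u1, u2, u3⟩ := adTrace_of_gpair b b2.symm b3.symm h03
    rw [t1] at u1
    subst u1
    obtain rfl : d = -(κ ^ 2 + 2 * κ * μ) := by linear_combination (t2 - u2) / 2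
    obtain rfl : c = κ ^ 2 * μ := by linear_combination (t3 - u3) / 3
    by_cases hμ : κ = μ
    · subst hμ
      -- With `X = ad (b 0)`, the vectors are `(X - κ) ^ 2`, `X - κ` and `1` applied to `b 1`.
      obtain ⟨a, a0, a1, a2, a3⟩ := exists_basis_of_det4 b (x := b 0)
        (y := κ ^ 2 • b 1 - (2 * κ) • b 2 + b 3) (z := b 2 - κ • b 1) (w := b 1)
        (u := ![1, 0, 0, 0]) (v := ![0, κ ^ 2, -(2 * κ), 1]) (t := ![0, -κ, 1, 0])
        (s := ![0, 1, 0, 0]) (by simp) (by simp; module) (by simp; module) (by simp)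
        (by rw [det_four]; simp)
      refine Or.inr (Or.inl ⟨rfl, a, p, a0, ?_, ?_, ?_⟩) <;>
        simp only [a0, a1, a2, a3, lie_add, lie_sub, lie_smul, ← b2, ← b3, h03] <;> module
    -- With `X = ad (b 0)`, the vectors are `(X - κ) * (X - μ)`, `X - μ` and `(X - κ) ^ 2` applied
    -- to `b 1`.
    · obtain ⟨a, a0, a1, a2, a3⟩ := exists_basis_of_det4 b (x := b 0)
        (y := (κ * μ) • b 1 - (κ + μ) • b 2 + b 3) (z := b 2 - μ • b 1)
        (w := κ ^ 2 • b 1 - (2 * κ) • b 2 + b 3)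
        (u := ![1, 0, 0, 0]) (v := ![0, κ * μ, -(κ + μ), 1]) (t := ![0, -μ, 1, 0])
        (s := ![0, κ ^ 2, -(2 * κ), 1]) (by simp) (by simp; module) (by simp; module)
        (by simp; module) (by
          rw [det_four]
          have := sub_ne_zero.mpr hμ
          intro h
          simp at h
          have h' : (κ - μ) ^ 2 = 0 := by linear_combination -h
          exact this (by simpa using h'))
      refine Or.inl ⟨hμ, a, p, a0, ?_, ?_, ?_⟩ <;>
        simp only [a0, a1, a2, a3, lie_add, lie_sub, lie_smul, ← b2, ← b3, h03] <;> module
  · obtain ⟨b, rfl⟩ := exists_basis_zero_eq hd hx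
    obtain ⟨s1, h1⟩ := hκ (b 1)
    obtain ⟨s2, h2⟩ := hκ (b 2)
    obtain ⟨s3, h3⟩ := hκ (b 3)
    obtain ⟨u1, u2, u3⟩ := adTrace_of_triangular (ε := 0) b h1 (by rw [h2]; module) h3
    obtain ⟨rfl, rfl⟩ := eq_of_power_sums (u1.symm.trans t1) (u2.symm.trans t2) (u3.symm.trans t3)
    exact Or.inr (Or.inr (Or.inr (Or.inr ⟨rfl, hκ⟩)))
  · obtain ⟨u1, u2, u3⟩ := adTrace_of_triangular (ε := 1) (s2 := 0) b h1 (by rw [h2]; module) h3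
    obtain ⟨rfl, rfl⟩ := eq_of_power_sums (u1.symm.trans t1) (u2.symm.trans t2) (u3.symm.trans t3)
    by_cases hν : ν = 0
    · subst hν
      exact Or.inr (Or.inr (Or.inr (Or.inl ⟨by simp, b, s, s', rfl, h1, h2, by simpa using h3⟩)))
    · obtain ⟨a, a0, a1, a2, a3⟩ := exists_basis_of_det4 b (x := b 0) (y := b 1)
        (z := b 2 - ν⁻¹ • b 3) (w := b 3) (u := ![1, 0, 0, 0]) (v := ![0, 1, 0, 0])
        (t := ![0, 0, 1, -ν⁻¹]) (s := ![0, 0, 0, 1]) (by simp) (by simp) (by simp; module)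
        (by simp) (by rw [det_four]; simp)
      refine Or.inr (Or.inr (Or.inl ⟨by simpa using hν, a, s, -(ν⁻¹ * s'), s', a0, ?_, ?_,
        ?_⟩)) <;> simp only [a0, a1, a2, a3, lie_sub, lie_smul, h1, h2, h3]
      have h4 : b 3 = (ν⁻¹ * ν) • b 3 := by rw [inv_mul_cancel₀ hν, one_smul]
      rw [smul_sub, smul_smul]
      linear_combination (norm := module) h4

end Spectrum

/-! ### Targets without a generating pair -/

section Targets

variable {𝕜 L L0 : Type*} [RCLike 𝕜] [LieRing L] [LieAlgebra 𝕜 L] [LieRing L0] [LieAlgebra 𝕜 L0]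
  {α : Fin 4 → ℝ}

/-- As in `jordan_brackets`: `2 * κ` is not an eigenvalue of `ad (b 0)`. -/
theorem regular_jordan_brackets {b : Basis (Fin 4) 𝕜 L} {κ : 𝕜} (hκ : κ ≠ 0)
    (h1 : ⁅b 0, b 1⁆ = κ • b 1) (h2 : ⁅b 0, b 2⁆ = κ • b 2 + b 1)
    (h3 : ⁅b 0, b 3⁆ = κ • b 3 + b 2) : ⁅b 1, b 2⁆ = 0 ∧ ⁅b 1, b 3⁆ = 0 ∧ ⁅b 2, b 3⁆ = 0 := by
  have key : ∀ v : L, ⁅b 0, v⁆ = (2 * κ) • v → v = 0 := by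
    intro v hv
    obtain ⟨p, q, r, s, rfl⟩ := exists_coords b v
    simp only [lie_add, lie_smul, lie_self, h1, h2, h3] at hv
    obtain ⟨e1, e2, e3, e4⟩ := coords_eq_zero b (p := 2 * κ * p) (q := κ * q - r) (r := κ * r - s)
      (s := κ * s) (by linear_combination (norm := module) -hv)
    have hs : s = 0 := by simpa [hκ] using e4
    subst hs
    have hr : r = 0 := by simpa [hκ] using e3
    subst hr
    have hq : q = 0 := by simpa [hκ] using e2
    have hp : p = 0 := by simpa [hκ] using e1
    rw [hp, hq]; simp
  have h12 : ⁅b 1, b 2⁆ = 0 := key _ (by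
    rw [leibniz_lie, h1, h2, lie_add, lie_smul, smul_lie, lie_self]; module)
  have h13 : ⁅b 1, b 3⁆ = 0 := key _ (by
    rw [leibniz_lie, h1, h3, lie_add, lie_smul, smul_lie, h12]; module)
  exact ⟨h12, h13, key _ (by
    rw [leibniz_lie, h2, h3, lie_add, lie_smul, add_lie, smul_lie, h13, lie_self]; module)⟩

theorem IsDiagonalExt.rebase {b : Basis (Fin 4) 𝕜 L} {κ μ : 𝕜}
    (h : Brackets b (κ • b 1) (κ • b 2) (μ • b 3) 0 0 0) {x : L}
    (hx : b.repr x 0 ≠ 0) : ∃ (b' : Basis (Fin 4) 𝕜 L) (p : 𝕜), p ≠ 0 ∧ b' 0 = x ∧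
      Brackets b' ((p * κ) • b' 1) ((p * κ) • b' 2) ((p * μ) • b' 3) 0 0 0 := by
  obtain ⟨p, q, r, s, rfl⟩ := exists_coords b x
  have hp : p ≠ 0 := by simpa using hx
  obtain ⟨b', e0, e1, e2, e3⟩ := exists_basis_of_det4 b
    (x := p • b 0 + q • b 1 + r • b 2 + s • b 3) (y := b 1) (z := b 2)
    (w := b 3) (u := ![p, q, r, s]) (v := ![0, 1, 0, 0])
    (t := ![0, 0, 1, 0]) (s := ![0, 0, 0, 1]) (by simp) (by simp) (by simp)
    (by simp) (by rw [det_four]; simp [hp])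
  have h21 : ⁅b 2, b 1⁆ = 0 := by rw [← lie_skew, h.h12, neg_zero]
  have h31 : ⁅b 3, b 1⁆ = 0 := by rw [← lie_skew, h.h13, neg_zero]
  have h32 : ⁅b 3, b 2⁆ = 0 := by rw [← lie_skew, h.h23, neg_zero]
  refine ⟨b', p, hp, e0, ?_, ?_, ?_, ?_, ?_, ?_⟩ <;>
    simp only [e0, e1, e2, e3, add_lie, smul_lie, lie_self, h.h01, h.h02, h.h03, h.h12,
      h.h13, h.h23, h21, h31, h32] <;> module

theorem IsJordanExt.rebase {b : Basis (Fin 4) 𝕜 L} {κ : 𝕜}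
    (h : Brackets b (κ • b 1) (κ • b 2 + b 3) (κ • b 3) 0 0 0) {x : L}
    (hx : b.repr x 0 ≠ 0) : ∃ (b' : Basis (Fin 4) 𝕜 L) (p : 𝕜), p ≠ 0 ∧ b' 0 = x ∧
      Brackets b' ((p * κ) • b' 1) ((p * κ) • b' 2 + b' 3) ((p * κ) • b' 3) 0 0 0 := by
  obtain ⟨p, q, r, s, rfl⟩ := exists_coords b x
  have hp : p ≠ 0 := by simpa using hx
  obtain ⟨b', e0, e1, e2, e3⟩ := exists_basis_of_det4 b
    (x := p • b 0 + q • b 1 + r • b 2 + s • b 3) (y := b 1) (z := b 2)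
    (w := p • b 3) (u := ![p, q, r, s]) (v := ![0, 1, 0, 0])
    (t := ![0, 0, 1, 0]) (s := ![0, 0, 0, p]) (by simp) (by simp) (by simp)
    (by simp) (by rw [det_four]; simp [hp])
  have h21 : ⁅b 2, b 1⁆ = 0 := by rw [← lie_skew, h.h12, neg_zero]
  have h31 : ⁅b 3, b 1⁆ = 0 := by rw [← lie_skew, h.h13, neg_zero]
  have h32 : ⁅b 3, b 2⁆ = 0 := by rw [← lie_skew, h.h23, neg_zero]
  refine ⟨b', p, hp, e0, ?_, ?_, ?_, ?_, ?_, ?_⟩ <;>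
    simp only [e0, e1, e2, e3, add_lie, smul_lie, lie_smul, lie_self, h.h01, h.h02, h.h03, h.h12,
      h.h13, h.h23, h21, h31, h32] <;> module

theorem IsScalarHeisenbergExt.rebase {b : Basis (Fin 4) 𝕜 L} {κ : 𝕜} (hκ : κ ≠ 0)
    (h : Brackets b (κ • b 1) (κ • b 2) ((2 * κ) • b 3) (b 3) 0 0) {x : L}
    (hx : b.repr x 0 ≠ 0) : ∃ (b' : Basis (Fin 4) 𝕜 L) (p : 𝕜), p ≠ 0 ∧ b' 0 = x ∧
      Brackets b' ((p * κ) • b' 1) ((p * κ) • b' 2) ((2 * (p * κ)) • b' 3) (b' 3) 0 0 := by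
  obtain ⟨p, q, r, s, rfl⟩ := exists_coords b x
  have hp : p ≠ 0 := by simpa using hx
  -- The components `q`, `r` of the new vector move `b 1` and `b 2` by multiples of `b 3`; `θ` and
  -- `η` compensate for this.
  obtain ⟨θ, hθ⟩ : ∃ θ, r = p * κ * θ := ⟨r / (p * κ), by field_simp⟩
  obtain ⟨η, hη⟩ : ∃ η, q = p * κ * η := ⟨q / (p * κ), by field_simp⟩
  obtain ⟨b', e0, e1, e2, e3⟩ := exists_basis_of_det4 b
    (x := p • b 0 + q • b 1 + r • b 2 + s • b 3) (y := b 1 + θ • b 3) (z := b 2 - η • b 3)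
    (w := b 3) (u := ![p, q, r, s]) (v := ![0, 1, 0, θ])
    (t := ![0, 0, 1, -η]) (s := ![0, 0, 0, 1]) (by simp) (by simp) (by simp; module)
    (by simp) (by rw [det_four]; simp [hp])
  have h21 : ⁅b 2, b 1⁆ = -b 3 := by rw [← lie_skew, h.h12]
  have h31 : ⁅b 3, b 1⁆ = 0 := by rw [← lie_skew, h.h13, neg_zero]
  have h32 : ⁅b 3, b 2⁆ = 0 := by rw [← lie_skew, h.h23, neg_zero]
  refine ⟨b', p, hp, e0, ?_, ?_, ?_, ?_, ?_, ?_⟩ <;>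
    simp only [e0, e1, e2, e3, add_lie, sub_lie, lie_add, lie_sub, smul_lie, lie_smul, lie_self,
      h.h01, h.h02, h.h03, h.h12, h.h13, h.h23, h21, h31, h32, hθ, hη] <;> module

/-- Some `x` in the source has `ad x` with eigenvalues `κ`, `κ`, `μ` modulo `x`. Each possible
Jordan form becomes diagonal once the image of a vector under the nilpotent part has smaller weight
than the vector. -/
theorem Degenerates.of_diagonalExt {α : Fin 4 → ℝ} (h : Degenerates 𝕜 L L0 α)
    (hd : finrank 𝕜 L = 4) {κ μ : 𝕜} (hκμ : κ ≠ 0 ∨ μ ≠ 0) (h0 : IsDiagonalExt 𝕜 L0 κ μ) :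
    ∃ β : Fin 4 → ℕ, (∀ i, β i ≤ 2) ∧ Degenerates 𝕜 L L0 (fun i => (β i : ℝ)) := by
  obtain ⟨a, ha⟩ := h0
  obtain ⟨x0, hx0, hx⟩ := h.exists_shadow a
  obtain ⟨a, p, hp, rfl, ha⟩ := IsDiagonalExt.rebase ha hx0
  have hκμ : p * κ ≠ 0 ∨ p * μ ≠ 0 := by simpa [hp] using hκμ
  generalize p * κ = κ at *
  generalize p * μ = μ at *
  obtain ⟨t1, t2, t3⟩ := adTrace_of_triangular (s1 := 0) (s2 := 0) (s3 := 0) (ε := 0) a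
    (by rw [ha.h01]; module) (by rw [ha.h02]; module) (by rw [ha.h03]; module)
  obtain hx | ⟨x, hx⟩ := hx
  · rw [hx _ one_ne_zero] at t1
    rw [hx _ two_ne_zero] at t2
    rw [hx _ three_ne_zero] at t3
    obtain ⟨rfl, rfl⟩ := eq_of_power_sums (κ := 0) (μ := 0) (κ' := κ) (μ' := μ) (by rw [← t1]; ring)
      (by rw [← t2]; ring) (by rw [← t3]; ring)
    simp at hκμ
  rw [← hx.adTrace_eq] at t1 t2 t3
  obtain ⟨hne, b, s, rfl, h1, h2, h3⟩ | ⟨rfl, b, s, rfl, h1, h2, h3⟩ |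
    ⟨hne, b, s1, s2, s3, rfl, h1, h2, h3⟩ | ⟨rfl, b, s1, s3, rfl, h1, h2, h3⟩ | ⟨rfl, hs⟩ :=
    exists_jordan_basis hd hx.ne_zero t1 t2 t3
  · refine ⟨![0, 1, 2, 2], by decide, degenerates_of_brackets _ ⟨h1, h2, h3, rfl, rfl, rfl⟩ ha
      ?_ ?_ ?_ ?_ ?_ ?_⟩ <;> intro k <;> fin_cases k <;> simp
  · have hκ : κ ≠ 0 := by simpa using hκμ
    obtain ⟨θ, hθ⟩ : ∃ θ, s = κ * θ := ⟨s / κ, by field_simp⟩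
    obtain ⟨η, hη⟩ : ∃ η, θ = κ * η := ⟨θ / κ, by field_simp⟩
    obtain ⟨ζ, hζ⟩ : ∃ ζ, η = κ * ζ := ⟨η / κ, by field_simp⟩
    obtain ⟨c, e0, e1, e2, e3⟩ := exists_basis_of_det4 b
      (x := b 0) (y := b 1 + θ • b 0) (z := b 2 - η • b 0) (w := b 3 + ζ • b 0)
      (u := ![1, 0, 0, 0]) (v := ![θ, 1, 0, 0])
      (t := ![-η, 0, 1, 0]) (s := ![ζ, 0, 0, 1]) (by simp) (by simp; module) (by simp; module)
      (by simp; module) (by rw [det_four]; simp)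
    have c1 : ⁅c 0, c 1⁆ = κ • c 1 := by
      simp only [e0, e1, lie_add, lie_smul, lie_self, h1, hθ]; module
    have c2 : ⁅c 0, c 2⁆ = κ • c 2 + c 1 := by
      simp only [e0, e1, e2, lie_sub, lie_smul, lie_self, h2, hη]; module
    have c3 : ⁅c 0, c 3⁆ = κ • c 3 + c 2 := by
      simp only [e0, e3, e2, lie_add, lie_smul, lie_self, h3, hζ]; module
    obtain ⟨c12, c13, c23⟩ := regular_jordan_brackets hκ c1 c2 c3
    -- A Jordan chain of length three needs three increasing weights. Starting them at 0 keeps the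
    -- maximum at 2, but requires the components along `c 0` and the brackets inside the ideal to
    -- vanish, which `κ ≠ 0` ensures.
    refine ⟨![0, 0, 1, 2], by decide, degenerates_of_brackets _ ⟨c1, c2, c3, c12, c13, c23⟩ ha
      ?_ ?_ ?_ ?_ ?_ ?_⟩ <;> intro k <;> fin_cases k <;> simp
  · refine ⟨![0, 1, 1, 1], by decide, degenerates_of_brackets _ ⟨h1, h2, h3, rfl, rfl, rfl⟩ ha
      ?_ ?_ ?_ ?_ ?_ ?_⟩ <;> intro k <;> fin_cases k <;> simp
  · refine ⟨![0, 2, 2, 1], by decide, degenerates_of_brackets _ ⟨h1, h2, h3, rfl, rfl, rfl⟩ ha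
      ?_ ?_ ?_ ?_ ?_ ?_⟩ <;> intro k <;> fin_cases k <;> simp
  · obtain ⟨b, rfl⟩ := exists_basis_zero_eq hd hx.ne_zero
    obtain ⟨s1, h1⟩ := hs (b 1)
    obtain ⟨s2, h2⟩ := hs (b 2)
    obtain ⟨s3, h3⟩ := hs (b 3)
    refine ⟨![0, 1, 1, 1], by decide, degenerates_of_brackets _ ⟨h1, h2, h3, rfl, rfl, rfl⟩ ha
      ?_ ?_ ?_ ?_ ?_ ?_⟩ <;> intro k <;> fin_cases k <;> simp

/-- The lifted operator has the single eigenvalue `κ`. A long Jordan block is weakened by the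
weights, and a scalar operator is impossible because having a chain is an open condition. -/
theorem Degenerates.of_jordanExt {α : Fin 4 → ℝ} (h : Degenerates 𝕜 L L0 α)
    (hd : finrank 𝕜 L = 4) {κ : 𝕜} (hκ : κ ≠ 0) (h0 : IsJordanExt 𝕜 L0 κ) :
    ∃ β : Fin 4 → ℕ, (∀ i, β i ≤ 2) ∧ Degenerates 𝕜 L L0 (fun i => (β i : ℝ)) := by
  obtain ⟨a, ha⟩ := h0
  obtain ⟨x0, hx0, hx⟩ := h.exists_shadow a
  obtain ⟨a, p, hp, rfl, ha⟩ := IsJordanExt.rebase ha hx0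
  replace hκ : p * κ ≠ 0 := mul_ne_zero hp hκ
  generalize p * κ = κ at *
  obtain ⟨t1, t2, t3⟩ := adTrace_of_triangular (s1 := 0) (s2 := 0) (s3 := 0) (ε := 1) a
    (by rw [ha.h01]; module) (by rw [ha.h02]; module) (by rw [ha.h03]; module)
  obtain hx | ⟨x, hx⟩ := hx
  · rw [hx _ one_ne_zero] at t1
    exact absurd (by linear_combination -t1 / 3) hκ
  rw [← hx.adTrace_eq] at t1 t2 t3
  obtain ⟨hne, -⟩ | ⟨-, b, s, rfl, h1, h2, h3⟩ |
    ⟨hne, -⟩ | ⟨-, b, s1, s3, rfl, h1, h2, h3⟩ | ⟨-, hs⟩ :=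
    exists_jordan_basis hd hx.ne_zero t1 t2 t3
  · exact absurd rfl hne
  · obtain ⟨c, e0, e1, e2, e3⟩ := exists_basis_of_det4 b
      (x := b 0) (y := b 1) (z := b 3) (w := b 2) (u := ![1, 0, 0, 0]) (v := ![0, 1, 0, 0])
      (t := ![0, 0, 0, 1]) (s := ![0, 0, 1, 0]) (by simp) (by simp) (by simp)
      (by simp) (by rw [det_four]; simp)
    have c1 : ⁅c 0, c 1⁆ = κ • c 1 + s • c 0 := by rw [e0, e1, h1]
    have c2 : ⁅c 0, c 2⁆ = κ • c 2 + c 3 := by rw [e0, e2, e3, h3]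
    have c3 : ⁅c 0, c 3⁆ = κ • c 3 + c 1 := by rw [e0, e1, e3, h2]
    refine ⟨![0, 1, 2, 2], by decide, degenerates_of_brackets _ ⟨c1, c2, c3, rfl, rfl, rfl⟩ ha
      ?_ ?_ ?_ ?_ ?_ ?_⟩ <;> intro k <;> fin_cases k <;> simp
  · exact absurd rfl hne
  · refine ⟨![0, 1, 1, 1], by decide, degenerates_of_brackets _ ⟨h1, h2, h3, rfl, rfl, rfl⟩ ha
      ?_ ?_ ?_ ?_ ?_ ?_⟩ <;> intro k <;> fin_cases k <;> simp
  · obtain ⟨e, e0, e1, e2, e3⟩ := exists_basis_of_det4 a (x := a 0) (y := a 2)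
      (z := κ • a 2 + a 3) (w := a 1) (u := ![1, 0, 0, 0]) (v := ![0, 0, 1, 0])
      (t := ![0, 0, κ, 1]) (s := ![0, 1, 0, 0]) (by simp) (by simp) (by simp)
      (by simp) (by rw [det_four]; simp)
    obtain ⟨b, rfl, hb⟩ := hx.exists_chain e e0 (by rw [e0, e1, e2, ha.h02])
    obtain ⟨s, hs⟩ := hs (b 1)
    rw [hb] at hs
    have := (coords_eq b (p := 0) (q := 0) (r := 1) (s := 0) (p' := s) (q' := κ) (r' := 0)
      (s' := 0) (by linear_combination (norm := module) hs)).2.2.1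
    exact absurd this one_ne_zero

/-- The lifted operator has eigenvalues `κ`, `κ`, `2 * κ`. The source is not metabelian because the
target is not, so the bracket of the two `κ`-vectors is a nonzero multiple of the third; only a
possible Jordan block for `κ` has to be removed. -/
theorem Degenerates.of_scalarHeisenbergExt {α : Fin 4 → ℝ} (h : Degenerates 𝕜 L L0 α)
    (hd : finrank 𝕜 L = 4) {κ : 𝕜} (hκ : κ ≠ 0) (h0 : IsScalarHeisenbergExt 𝕜 L0 κ) :
    ∃ β : Fin 4 → ℕ, (∀ i, β i ≤ 2) ∧ Degenerates 𝕜 L L0 (fun i => (β i : ℝ)) := by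
  obtain ⟨a, ha⟩ := h0
  obtain ⟨x0, hx0, hx⟩ := h.exists_shadow a
  obtain ⟨a, p, hp, rfl, ha⟩ := IsScalarHeisenbergExt.rebase hκ ha hx0
  replace hκ : p * κ ≠ 0 := mul_ne_zero hp hκ
  generalize p * κ = κ at *
  obtain ⟨t1, t2, t3⟩ := adTrace_of_triangular (μ := 2 * κ) (s1 := 0) (s2 := 0) (s3 := 0) (ε := 0) a
    (by rw [ha.h01]; module) (by rw [ha.h02]; module) (by rw [ha.h03]; module)
  obtain hx | ⟨x, hx⟩ := hx
  · rw [hx _ one_ne_zero] at t1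
    exact absurd (by linear_combination -t1 / 4) hκ
  rw [← hx.adTrace_eq] at t1 t2 t3
  have hne : κ ≠ 2 * κ := fun h => hκ (by linear_combination -h)
  have hmet : ∃ p q r s : L, ⁅⁅p, q⁆, ⁅r, s⁆⁆ ≠ 0 := by
    refine h.not_metabelian (p := a 0) (q := a 1) (r := a 0) (s := a 2) ?_
    rw [ha.h01, ha.h02, smul_lie, lie_smul, ha.h12]
    simp [hκ, a.ne_zero]
  -- An abelian ideal of codimension one spanned by `c 1`, `c 2`, `c 3` would contain all brackets
  -- and make the source metabelian.
  have hmet' : ∀ {c : Basis (Fin 4) 𝕜 L}, ⁅c 1, c 2⁆ = 0 → ⁅c 1, c 3⁆ = 0 → ⁅c 2, c 3⁆ = 0 →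
      (∀ i, ∃ q r s : 𝕜, ⁅c 0, c i⁆ = q • c 1 + r • c 2 + s • c 3) → False := by
    intro c c12 c13 c23 hc
    obtain ⟨q1, r1, s1, e1⟩ := hc 1
    obtain ⟨q2, r2, s2, e2⟩ := hc 2
    obtain ⟨q3, r3, s3, e3⟩ := hc 3
    have c21 : ⁅c 2, c 1⁆ = 0 := by rw [← lie_skew, c12, neg_zero]
    have c31 : ⁅c 3, c 1⁆ = 0 := by rw [← lie_skew, c13, neg_zero]
    have c32 : ⁅c 3, c 2⁆ = 0 := by rw [← lie_skew, c23, neg_zero]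
    have hB : Brackets c _ _ _ _ _ _ := ⟨e1, e2, e3, c12, c13, c23⟩
    have key : ∀ u v : L, ∃ q r s : 𝕜, ⁅u, v⁆ = q • c 1 + r • c 2 + s • c 3 := by
      intro u v
      obtain ⟨p, q, r, s, rfl⟩ := exists_coords c u
      obtain ⟨p', q', r', s', rfl⟩ := exists_coords c v
      refine ⟨(p * q' - q * p') * q1 + (p * r' - r * p') * q2 + (p * s' - s * p') * q3,
        (p * q' - q * p') * r1 + (p * r' - r * p') * r2 + (p * s' - s * p') * r3,
        (p * q' - q * p') * s1 + (p * r' - r * p') * s2 + (p * s' - s * p') * s3, ?_⟩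
      rw [hB.lie_comb]; module
    obtain ⟨p, q, r, s, hpqrs⟩ := hmet
    obtain ⟨q1, r1, s1, e1⟩ := key p q
    obtain ⟨q2, r2, s2, e2⟩ := key r s
    rw [e1, e2] at hpqrs
    simp [c12, c13, c23, c21, c31, c32] at hpqrs
  obtain ⟨-, b, s, rfl, h1, h2, h3⟩ | ⟨h', -⟩ |
    ⟨-, b, s1, s2, s3, rfl, h1, h2, h3⟩ | ⟨h', -⟩ | ⟨h', -⟩ :=
    exists_jordan_basis hd hx.ne_zero t1 t2 t3
  · obtain ⟨θ, hθ⟩ : ∃ θ, s = κ * θ := ⟨s / κ, by field_simp⟩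
    obtain ⟨η, hη⟩ : ∃ η, θ = κ * η := ⟨θ / κ, by field_simp⟩
    obtain ⟨c, e0, e1, e2, e3⟩ := exists_basis_of_det4 b
      (x := b 0) (y := b 1 + θ • b 0) (z := b 2 - η • b 0) (w := b 3 + (θ / 2) • b 0)
      (u := ![1, 0, 0, 0]) (v := ![θ, 1, 0, 0])
      (t := ![-η, 0, 1, 0]) (s := ![θ / 2, 0, 0, 1]) (by simp) (by simp; module)
      (by simp; module) (by simp; module) (by rw [det_four]; simp)
    have c1 : ⁅c 0, c 1⁆ = κ • c 1 := by
      simp only [e0, e1, lie_add, lie_smul, lie_self, h1, hθ]; module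
    have c2 : ⁅c 0, c 2⁆ = κ • c 2 + c 1 := by
      simp only [e0, e1, e2, lie_sub, lie_smul, lie_self, h2, hη]; module
    have c3 : ⁅c 0, c 3⁆ = (2 * κ) • c 3 := by
      simp only [e0, e3, lie_add, lie_smul, lie_self, h3, hθ]; module
    have key : ∀ v : L, ⁅c 0, v⁆ = (2 * κ) • v → ∃ t : 𝕜, v = t • c 3 := by
      intro v hv
      obtain ⟨p, q, r, s, rfl⟩ := exists_coords c v
      simp only [lie_add, lie_smul, lie_self, c1, c2, c3] at hv
      obtain ⟨e1, e2, e3, -⟩ := coords_eq_zero c (p := 2 * κ * p) (q := κ * q - r) (r := κ * r)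
        (s := 0) (by linear_combination (norm := module) -hv)
      have hr : r = 0 := by simpa [hκ] using e3
      subst hr
      have hq : q = 0 := by simpa [hκ] using e2
      have hp : p = 0 := by simpa [hκ] using e1
      exact ⟨s, by rw [hp, hq]; module⟩
    have key' : ∀ v : L, ⁅c 0, v⁆ = (3 * κ) • v → v = 0 := by
      intro v hv
      obtain ⟨p, q, r, s, rfl⟩ := exists_coords c v
      simp only [lie_add, lie_smul, lie_self, c1, c2, c3] at hv
      obtain ⟨e1, e2, e3, e4⟩ := coords_eq_zero c (p := 3 * κ * p) (q := 2 * κ * q - r)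
        (r := 2 * κ * r) (s := κ * s) (by linear_combination (norm := module) -hv)
      have hr : r = 0 := by simpa [hκ] using e3
      subst hr
      have hq : q = 0 := by simpa [hκ] using e2
      have hp : p = 0 := by simpa [hκ] using e1
      have hs : s = 0 := by simpa [hκ] using e4
      rw [hp, hq, hs]; simp
    obtain ⟨t, ht⟩ := key ⁅c 1, c 2⁆ (by
      rw [leibniz_lie, c1, c2, lie_add, lie_smul, smul_lie, lie_self]; module)
    have c13 : ⁅c 1, c 3⁆ = 0 := key' _ (by
      rw [leibniz_lie, c1, c3, lie_smul, smul_lie]; module)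
    have c23 : ⁅c 2, c 3⁆ = 0 := key' _ (by
      rw [leibniz_lie, c2, c3, lie_smul, add_lie, smul_lie, c13]; module)
    have ht0 : t ≠ 0 := by
      rintro rfl
      refine hmet' (c := c) (by rw [ht, zero_smul]) c13 c23 fun i => ?_
      fin_cases i
      · exact ⟨0, 0, 0, by simp⟩
      · exact ⟨κ, 0, 0, by simp [c1]⟩
      · exact ⟨1, κ, 0, by simp [c2, add_comm]⟩
      · exact ⟨0, 0, 2 * κ, by simp [c3]⟩
    obtain ⟨f, f0, f1, f2, f3⟩ := exists_basis_of_det4 c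
      (x := c 0) (y := c 1) (z := c 2) (w := t • c 3) (u := ![1, 0, 0, 0]) (v := ![0, 1, 0, 0])
      (t := ![0, 0, 1, 0]) (s := ![0, 0, 0, t]) (by simp) (by simp)
      (by simp) (by simp) (by rw [det_four]; simpa using ht0)
    have g1 : ⁅f 0, f 1⁆ = κ • f 1 := by rw [f0, f1, c1]
    have g2 : ⁅f 0, f 2⁆ = κ • f 2 + f 1 := by rw [f0, f1, f2, c2]
    have g3 : ⁅f 0, f 3⁆ = (2 * κ) • f 3 := by rw [f0, f3, lie_smul, c3]; module
    have g12 : ⁅f 1, f 2⁆ = f 3 := by rw [f1, f2, f3, ht]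
    have g13 : ⁅f 1, f 3⁆ = 0 := by rw [f1, f3, lie_smul, c13, smul_zero]
    have g23 : ⁅f 2, f 3⁆ = 0 := by rw [f2, f3, lie_smul, c23, smul_zero]
    refine ⟨![0, 0, 1, 1], by decide, degenerates_of_brackets _ ⟨g1, g2, g3, g12, g13, g23⟩ ha
      ?_ ?_ ?_ ?_ ?_ ?_⟩ <;> intro k <;> fin_cases k <;> simp
  · exact absurd h' hne
  · obtain ⟨c, e0, e1, e2, e3⟩ := exists_basis_of_det4 b
      (x := b 0) (y := b 1 + (s1 / κ) • b 0) (z := b 2 + (s2 / κ) • b 0)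
      (w := b 3 + (s3 / (2 * κ)) • b 0)
      (u := ![1, 0, 0, 0]) (v := ![s1 / κ, 1, 0, 0])
      (t := ![s2 / κ, 0, 1, 0]) (s := ![s3 / (2 * κ), 0, 0, 1]) (by simp) (by simp; module)
      (by simp; module) (by simp; module) (by rw [det_four]; simp)
    have c1 : ⁅c 0, c 1⁆ = κ • c 1 := by
      rw [e0, e1, lie_add, lie_smul, lie_self, h1, smul_add, smul_smul, mul_div_cancel₀ _ hκ]
      simp
    have c2 : ⁅c 0, c 2⁆ = κ • c 2 := by
      rw [e0, e2, lie_add, lie_smul, lie_self, h2, smul_add, smul_smul, mul_div_cancel₀ _ hκ]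
      simp
    have c3 : ⁅c 0, c 3⁆ = (2 * κ) • c 3 := by
      rw [e0, e3, lie_add, lie_smul, lie_self, h3, smul_add, smul_smul,
        mul_div_cancel₀ _ (mul_ne_zero two_ne_zero hκ)]
      simp
    obtain ⟨t, ht, -, c13, c23⟩ := diagonal_or_heisenberg hκ (mul_ne_zero two_ne_zero hκ) c1 c2 c3
    have ht0 : t ≠ 0 := by
      rintro rfl
      refine hmet' (c := c) (by rw [ht, zero_smul]) c13 c23 fun i => ?_
      fin_cases i
      · exact ⟨0, 0, 0, by simp⟩
      · exact ⟨κ, 0, 0, by simp [c1]⟩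
      · exact ⟨0, κ, 0, by simp [c2]⟩
      · exact ⟨0, 0, 2 * κ, by simp [c3]⟩
    obtain ⟨f, hf⟩ := isScalarHeisenbergExt_of ht0 c1 c2 c3 ht c13 c23
    exact ⟨0, by simp, degenerates_zero_of_lieEquiv hd (lieEquiv_of_brackets f a hf ha
      (by ext k; simp) (by ext k; simp) (by ext k; simp) (by ext k; simp) (by ext k; simp)
      (by ext k; simp))⟩
  · exact absurd h' hne
  · exact absurd h' hne

end Targets

/-! ### Invariants of the four families with a generating pair -/

section Structure

variable {𝕜 L L0 : Type*} [RCLike 𝕜] [LieRing L] [LieAlgebra 𝕜 L] [LieRing L0] [LieAlgebra 𝕜 L0]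

theorem IsHeisenbergExt.lieEquiv {τ a : 𝕜} (h : IsHeisenbergExt 𝕜 L τ a)
    (h0 : IsHeisenbergExt 𝕜 L0 τ a) : Nonempty (L ≃ₗ⁅𝕜⁆ L0) := by
  obtain ⟨b, hb⟩ := h
  obtain ⟨b0, hb0⟩ := h0
  exact lieEquiv_of_brackets b b0 hb hb0 (by ext k; simp) (by ext k; simp) (by ext k; simp)
    (by ext k; simp) (by ext k; simp) (by ext k; simp)

theorem IsQuadraticAffine.lieEquiv {d : 𝕜} (h : IsQuadraticAffine 𝕜 L d)
    (h0 : IsQuadraticAffine 𝕜 L0 d) : Nonempty (L ≃ₗ⁅𝕜⁆ L0) := by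
  obtain ⟨b, hb⟩ := h
  obtain ⟨b0, hb0⟩ := h0
  exact lieEquiv_of_brackets b b0 hb hb0 (by ext k; simp) (by ext k; simp) (by ext k; simp)
    (by ext k; simp) (by ext k; simp) (by ext k; simp)

theorem IsReductive.lieEquiv {d f : 𝕜} (h : IsReductive 𝕜 L d f)
    (h0 : IsReductive 𝕜 L0 d f) : Nonempty (L ≃ₗ⁅𝕜⁆ L0) := by
  obtain ⟨b, hb⟩ := h
  obtain ⟨b0, hb0⟩ := h0
  exact lieEquiv_of_brackets b b0 hb hb0 (by ext k; simp) (by ext k; simp) (by ext k; simp)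
    (by ext k; simp) (by ext k; simp) (by ext k; simp)

theorem IsHeisenbergExt.smul {τ a s : 𝕜} (hs : s ≠ 0) (h : IsHeisenbergExt 𝕜 L τ a) :
    IsHeisenbergExt 𝕜 L (s * τ) (s ^ 2 * a) := by
  obtain ⟨b, hB⟩ := h
  obtain ⟨c, c0, c1, c2, c3⟩ := exists_basis_of_det4 b (x := b 0) (y := s • b 1)
    (z := s • b 2) (w := s • b 3) (u := ![1, 0, 0, 0]) (v := ![0, s, 0, 0])
    (t := ![0, 0, s, 0]) (s := ![0, 0, 0, s]) (by simp) (by simp) (by simp)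
    (by simp) (by rw [det_four]; simpa using hs)
  refine ⟨c, ?_, ?_, ?_, ?_, ?_, ?_⟩ <;>
    simp only [c0, c1, c2, c3, lie_smul, smul_lie, hB.h01, hB.h02, hB.h03, hB.h12, hB.h13,
      hB.h23] <;> module

/-- Only the coordinate along `b 1` matters, the other three vectors spanning the nilpotent
Heisenberg ideal. -/
theorem Brackets.adTrace_heisenbergExt {b : Basis (Fin 4) 𝕜 L} {τ a : 𝕜}
    (h : Brackets b (b 2) (b 3) 0 (a • b 0 + τ • b 2) (τ • b 3) 0) (x : L) :
    adTrace 𝕜 1 x = 2 * (b.repr x 1 * τ) ∧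
      adTrace 𝕜 2 x = 2 * (b.repr x 1 * τ) ^ 2 - 2 * (b.repr x 1 ^ 2 * a) := by
  obtain ⟨p, q, r, s, rfl⟩ := exists_coords b x
  have h10 : ⁅b 1, b 0⁆ = -b 2 := by rw [← lie_skew, h.h01]
  have h20 : ⁅b 2, b 0⁆ = -b 3 := by rw [← lie_skew, h.h02]
  have h30 : ⁅b 3, b 0⁆ = 0 := by rw [← lie_skew, h.h03, neg_zero]
  have h21 : ⁅b 2, b 1⁆ = -(a • b 0 + τ • b 2) := by rw [← lie_skew, h.h12]
  have h31 : ⁅b 3, b 1⁆ = -(τ • b 3) := by rw [← lie_skew, h.h13]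
  have h32 : ⁅b 3, b 2⁆ = 0 := by rw [← lie_skew, h.h23, neg_zero]
  have hq : b.repr (p • b 0 + q • b 1 + r • b 2 + s • b 3) 1 = q := by simp
  rw [hq]
  set x := p • b 0 + q • b 1 + r • b 2 + s • b 3 with hx
  have e0 : ⁅x, b 0⁆ = (-q) • b 2 + (-r) • b 3 := by
    simp only [hx, add_lie, smul_lie, lie_self, h10, h20, h30]; module
  have e1 : ⁅x, b 1⁆ = (-(r * a)) • b 0 + (p - r * τ) • b 2 + (-(s * τ)) • b 3 := by
    simp only [hx, add_lie, smul_lie, lie_self, h.h01, h21, h31]; module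
  have e2 : ⁅x, b 2⁆ = (q * a) • b 0 + (q * τ) • b 2 + p • b 3 := by
    simp only [hx, add_lie, smul_lie, lie_self, h.h02, h.h12, h32]; module
  have e3 : ⁅x, b 3⁆ = (q * τ) • b 3 := by
    simp only [hx, add_lie, smul_lie, lie_self, h.h03, h.h13, h.h23]; module
  clear_value x
  constructor <;> rw [adTrace_eq b] <;> simp [Fin.sum_univ_four, pow_succ, e0, e1, e2, e3] <;> ring

theorem Brackets.adTrace_reductive {b : Basis (Fin 4) 𝕜 L} {d f : 𝕜}
    (h : Brackets b (b 2) (d • b 1) 0 (f • b 0) 0 0) (p q r s : 𝕜) :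
    adTrace 𝕜 1 (p • b 0 + q • b 1 + r • b 2 + s • b 3) = 0 ∧
      adTrace 𝕜 2 (p • b 0 + q • b 1 + r • b 2 + s • b 3) =
        2 * (d * p ^ 2 - f * q ^ 2 + d * f * r ^ 2) := by
  have h10 : ⁅b 1, b 0⁆ = -b 2 := by rw [← lie_skew, h.h01]
  have h20 : ⁅b 2, b 0⁆ = -(d • b 1) := by rw [← lie_skew, h.h02]
  have h30 : ⁅b 3, b 0⁆ = 0 := by rw [← lie_skew, h.h03, neg_zero]
  have h21 : ⁅b 2, b 1⁆ = -(f • b 0) := by rw [← lie_skew, h.h12]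
  have h31 : ⁅b 3, b 1⁆ = 0 := by rw [← lie_skew, h.h13, neg_zero]
  have h32 : ⁅b 3, b 2⁆ = 0 := by rw [← lie_skew, h.h23, neg_zero]
  set x := p • b 0 + q • b 1 + r • b 2 + s • b 3 with hx
  have e0 : ⁅x, b 0⁆ = (-(r * d)) • b 1 + (-q) • b 2 := by
    simp only [hx, add_lie, smul_lie, lie_self, h10, h20, h30]; module
  have e1 : ⁅x, b 1⁆ = (-(r * f)) • b 0 + p • b 2 := by
    simp only [hx, add_lie, smul_lie, lie_self, h.h01, h21, h31]; module
  have e2 : ⁅x, b 2⁆ = (q * f) • b 0 + (p * d) • b 1 := by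
    simp only [hx, add_lie, smul_lie, lie_self, h.h02, h.h12, h32]; module
  have e3 : ⁅x, b 3⁆ = 0 := by
    simp only [hx, add_lie, smul_lie, lie_self, h.h03, h.h13, h.h23]; module
  clear_value x
  constructor <;> rw [adTrace_eq b] <;> simp [Fin.sum_univ_four, pow_succ, e0, e1, e2, e3] <;> ring

theorem IsReductive.adTrace_one {d f : 𝕜} (h : IsReductive 𝕜 L d f) (x : L) :
    adTrace 𝕜 1 x = 0 := by
  obtain ⟨b, hB⟩ := h
  obtain ⟨p, q, r, s, rfl⟩ := exists_coords b x
  exact (hB.adTrace_reductive p q r s).1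

theorem IsQuadraticAffine.metabelian {d : 𝕜} (h : IsQuadraticAffine 𝕜 L d) (x y z w : L) :
    ⁅⁅x, y⁆, ⁅z, w⁆⁆ = 0 := by
  obtain ⟨b, hB⟩ := h
  have key : ∀ u v : L, ∃ r s : 𝕜, ⁅u, v⁆ = r • b 2 + s • b 3 := by
    intro u v
    obtain ⟨p, q, r, s, rfl⟩ := exists_coords b u
    obtain ⟨p', q', r', s', rfl⟩ := exists_coords b v
    exact ⟨(p * q' - q * p') + (p * s' - s * p') * d + (q * r' - r * q'),
      (p * r' - r * p') + (q * s' - s * q'), by rw [hB.lie_comb]; module⟩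
  obtain ⟨r, s, e1⟩ := key x y
  obtain ⟨r', s', e2⟩ := key z w
  have h32 : ⁅b 3, b 2⁆ = 0 := by rw [← lie_skew, hB.h23, neg_zero]
  rw [e1, e2]
  simp [hB.h23, h32]

theorem IsCyclicExt.proportional {c d e : 𝕜} (h : IsCyclicExt 𝕜 L c d e) (u v p q : L) :
    ∃ s t : 𝕜, (s ≠ 0 ∨ t ≠ 0) ∧ s • ⁅u, ⁅p, q⁆⁆ = t • ⁅v, ⁅p, q⁆⁆ := by
  obtain ⟨b, hB⟩ := h
  obtain ⟨r1, r2, r3, hD⟩ : ∃ r1 r2 r3 : 𝕜, ⁅p, q⁆ = r1 • b 1 + r2 • b 2 + r3 • b 3 := by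
    obtain ⟨p, p1, p2, p3, rfl⟩ := exists_coords b p
    obtain ⟨q, q1, q2, q3, rfl⟩ := exists_coords b q
    exact ⟨(p * q3 - p3 * q) * c, (p * q1 - p1 * q) + (p * q3 - p3 * q) * d,
      (p * q2 - p2 * q) + (p * q3 - p3 * q) * e, by rw [hB.lie_comb]; module⟩
  have key : ∀ u : L, ∃ s : 𝕜, ⁅u, ⁅p, q⁆⁆ = s • ⁅b 0, ⁅p, q⁆⁆ := by
    intro u
    obtain ⟨s, s1, s2, s3, rfl⟩ := exists_coords b u
    have h21 : ⁅b 2, b 1⁆ = 0 := by rw [← lie_skew, hB.h12, neg_zero]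
    have h31 : ⁅b 3, b 1⁆ = 0 := by rw [← lie_skew, hB.h13, neg_zero]
    have h32 : ⁅b 3, b 2⁆ = 0 := by rw [← lie_skew, hB.h23, neg_zero]
    refine ⟨s, ?_⟩
    rw [hD]
    simp only [add_lie, lie_add, lie_smul, smul_lie, lie_self, hB.h12, hB.h13, hB.h23, h21, h31,
      h32]
    module
  obtain ⟨s, hs⟩ := key u
  obtain ⟨t, ht⟩ := key v
  by_cases h : s = 0
  · exact ⟨1, 0, Or.inl one_ne_zero, by rw [hs, h]; simp⟩
  · exact ⟨t, s, Or.inr h, by rw [hs, ht, smul_smul, smul_smul, mul_comm]⟩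

/-- The quadratic form is half the Killing form. For `u` orthogonal to `x` the double bracket `⁅x,
⁅x, u⁆⁆` is the value of the form at `x` times `u`, as for cross products. The central vector is
added to `x` so that `⁅c 1, c 2⁆` acquires a component along `c 3`, which survives when `c 3` has
weight 2. -/
theorem Brackets.reductive_of_orthogonal {b : Basis (Fin 4) 𝕜 L} {d f : 𝕜}
    (h : Brackets b (b 2) (d • b 1) 0 (f • b 0) 0 0) {p q r u0 u1 u2 : 𝕜}
    (hδ : d * p ^ 2 - f * q ^ 2 + d * f * r ^ 2 ≠ 0)
    (hk : d * u0 ^ 2 - f * u1 ^ 2 + d * f * u2 ^ 2 ≠ 0)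
    (ho : d * p * u0 - f * q * u1 + d * f * r * u2 = 0) :
    ∃ (c : Basis (Fin 4) 𝕜 L) (k : 𝕜), k ≠ 0 ∧ Brackets c (c 2)
      ((d * p ^ 2 - f * q ^ 2 + d * f * r ^ 2) • c 1) 0 (k • c 0 - k • c 3) 0 0 := by
  obtain ⟨c, c0, c1, c2, c3⟩ := exists_basis_of_det4 b
    (x := p • b 0 + q • b 1 + r • b 2 + (1 : 𝕜) • b 3)
    (y := u0 • b 0 + u1 • b 1 + u2 • b 2 + (0 : 𝕜) • b 3)
    (z := ((q * u2 - r * u1) * f) • b 0 + ((p * u2 - r * u0) * d) • b 1 +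
      (p * u1 - q * u0) • b 2 + (0 : 𝕜) • b 3) (w := b 3)
    (u := ![p, q, r, 1]) (v := ![u0, u1, u2, 0])
    (t := ![(q * u2 - r * u1) * f, (p * u2 - r * u0) * d, p * u1 - q * u0, 0])
    (s := ![0, 0, 0, 1]) (by simp) (by simp) (by simp) (by simp) (by
      rw [det_four]
      intro h0
      simp at h0
      refine mul_ne_zero hδ hk ?_
      linear_combination (d * p * u0 - f * q * u1 + d * f * r * u2) * ho - d * f * h0)
  refine ⟨c, -(d * u0 ^ 2 - f * u1 ^ 2 + d * f * u2 ^ 2), neg_ne_zero.mpr hk, ?_⟩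
  have h3 : ∀ v : L, ⁅v, b 3⁆ = 0 := by
    intro v
    obtain ⟨p, q, r, s, rfl⟩ := exists_coords b v
    simp only [add_lie, smul_lie, lie_self, h.h03, h.h13, h.h23]; simp
  refine ⟨?_, ?_, by rw [c3, h3], ?_, by rw [c3, h3], by rw [c3, h3]⟩
  · rw [c0, c1, c2, h.lie_comb]; module
  · rw [c0, c1, c2, h.lie_comb]
    linear_combination (norm := module) (-ho) • (p • b 0 + q • b 1 + r • b 2)
  · rw [c1, c2, c0, c3, h.lie_comb]
    linear_combination (norm := module) (ho) • (u0 • b 0 + u1 • b 1 + u2 • b 2)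

/-- The three vectors tried are orthogonal to `(p, q, r)`, each with one coordinate zero. If the
first two are isotropic, the value of the form at `(p, q, r)` is `-(d * f * r ^ 2)`, and the third
vector is not isotropic. -/
theorem Brackets.exists_rotation_basis {b : Basis (Fin 4) 𝕜 L} {d f : 𝕜}
    (h : Brackets b (b 2) (d • b 1) 0 (f • b 0) 0 0) {p q r : 𝕜} (hdf : d * f ≠ 0)
    (hδ : d * p ^ 2 - f * q ^ 2 + d * f * r ^ 2 ≠ 0) :
    ∃ (c : Basis (Fin 4) 𝕜 L) (k : 𝕜), k ≠ 0 ∧ Brackets c (c 2)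
      ((d * p ^ 2 - f * q ^ 2 + d * f * r ^ 2) • c 1) 0 (k • c 0 - k • c 3) 0 0 := by
  by_cases h1 : q ^ 2 - d * r ^ 2 = 0
  · by_cases h2 : p ^ 2 + f * r ^ 2 = 0
    · have h3 : d * p ^ 2 - f * q ^ 2 + d * f * r ^ 2 = -(d * f * r ^ 2) := by
        linear_combination d * h2 - f * h1
      rw [h3] at hδ
      refine h.reductive_of_orthogonal (u0 := f * q) (u1 := d * p) (u2 := 0)
        (by rw [h3]; exact hδ) ?_ (by ring)
      intro h0
      have h4 : 2 * (d * f) * (d * f * r ^ 2) = 0 := by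
        linear_combination h0 - d * f ^ 2 * h1 + f * d ^ 2 * h2
      exact mul_ne_zero (mul_ne_zero two_ne_zero hdf) (neg_ne_zero.mp hδ) h4
    · refine h.reductive_of_orthogonal (u0 := -(r * f)) (u1 := 0) (u2 := p) hδ ?_ (by ring)
      intro h0
      exact mul_ne_zero hdf h2 (by linear_combination h0)
  · refine h.reductive_of_orthogonal (u0 := 0) (u1 := r * d) (u2 := q) hδ ?_ (by ring)
    intro h0
    exact mul_ne_zero hdf h1 (by linear_combination h0)

end Structure

/-! ### Targets with a generating pair -/

section Targets

variable {𝕜 L L0 : Type*} [RCLike 𝕜] [LieRing L] [LieAlgebra 𝕜 L] [LieRing L0] [LieAlgebra 𝕜 L0]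
  {α : Fin 4 → ℝ}

/-- The source has a generating pair, so its normal form is known. A vector of weight zero exists
because some trace is nonzero, and comparison of traces matches the parameters in each possible
family. -/
theorem Degenerates.of_heisenbergExt (h : Degenerates 𝕜 L L0 α)
    (hd : finrank 𝕜 L = 4) {τ a : 𝕜} (hτa : τ ≠ 0 ∨ a ≠ 0) (h0 : IsHeisenbergExt 𝕜 L0 τ a) :
    ∃ β : Fin 4 → ℕ, (∀ i, β i ≤ 2) ∧ Degenerates 𝕜 L L0 (fun i => (β i : ℝ)) := by
  have h0' := h0
  obtain ⟨e, he⟩ := h0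
  have hgp : GPair 𝕜 (e 0) (e 1) := ⟨e, rfl, rfl, by rw [he.h01], by rw [he.h01, he.h02]⟩
  obtain ⟨x, y, hxy, -⟩ := h.exists_gpair_near hgp
  obtain ⟨x0, hx0, hsh⟩ := h.exists_shadow (e.reindex (Equiv.swap 0 1))
  have hs : e.repr x0 1 ≠ 0 := by simpa using hx0
  obtain ⟨t1, t2⟩ := he.adTrace_heisenbergExt x0
  generalize e.repr x0 1 = s at *
  have htr : adTrace 𝕜 1 x0 ≠ 0 ∨ adTrace 𝕜 2 x0 ≠ 0 := by
    by_cases hτ : τ = 0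
    · right
      have ha : a ≠ 0 := hτa.resolve_left (not_not.mpr hτ)
      rw [t2, hτ]
      simp [hs, ha]
    · left
      rw [t1]
      simp [hs, hτ]
  have hsh : ∃ x : L, Shadow 𝕜 x x0 := by
    refine hsh.resolve_left fun h0 => ?_
    rw [h0 _ one_ne_zero, h0 _ two_ne_zero] at htr
    simp at htr
  obtain ⟨x1, hx1⟩ := hsh
  obtain ⟨c, d, e', hL, -⟩ | ⟨τ', a', hτa', ⟨b, hb⟩, -⟩ | ⟨d, σ, hd0, hσ, ⟨b, hb⟩, -⟩ |
    ⟨a1, a2, d, hΔ, -, -, b, hb⟩ := hxy.normal_form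
  · exfalso
    -- In the target two vectors send one commutator to independent vectors. This open condition
    -- fails in a cyclic extension, whose derived algebra is acted on by multiples of a single
    -- operator.
    obtain ⟨e', e0, e1⟩ : ∃ e' : Basis (Fin 4) 𝕜 L0, ⁅e 0, ⁅e 0, e 1⁆⁆ = e' 0 ∧
        ⁅e 1, ⁅e 0, e 1⁆⁆ = e' 1 := by
      rw [he.h01, he.h02, he.h12]
      by_cases ha : a = 0
      · have hτ : τ ≠ 0 := hτa.resolve_right (not_not.mpr ha)
        obtain ⟨c, c0, c1, -⟩ := exists_basis_of_det4 e (x := e 3) (y := a • e 0 + τ • e 2)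
          (z := e 0) (w := e 1) (u := ![0, 0, 0, 1]) (v := ![a, 0, τ, 0])
          (t := ![1, 0, 0, 0]) (s := ![0, 1, 0, 0]) (by simp) (by simp) (by simp)
          (by simp) (by rw [det_four]; simpa using hτ)
        exact ⟨c, c0.symm, c1.symm⟩
      · obtain ⟨c, c0, c1, -⟩ := exists_basis_of_det4 e (x := e 3) (y := a • e 0 + τ • e 2)
          (z := e 1) (w := e 2) (u := ![0, 0, 0, 1]) (v := ![a, 0, τ, 0])
          (t := ![0, 1, 0, 0]) (s := ![0, 0, 1, 0]) (by simp) (by simp) (by simp)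
          (by simp) (by rw [det_four]; simpa using ha)
        exact ⟨c, c0.symm, c1.symm⟩
    obtain ⟨u, v, p, q, b, b0, b1⟩ := h.not_proportional e0 e1
    obtain ⟨s, t, hst, heq⟩ := hL.proportional u v p q
    rw [b0, b1] at heq
    obtain ⟨hs, ht, -⟩ := coords_eq_zero b (p := s) (q := -t) (r := 0) (s := 0)
      (by linear_combination (norm := module) heq)
    simp [hs, neg_eq_zero.mp ht] at hst
  · obtain ⟨u1, u2⟩ := hb.adTrace_heisenbergExt x1
    rw [hx1.adTrace_eq] at u1 u2
    generalize b.repr x1 1 = s' at *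
    have hs' : s' ≠ 0 := by
      rintro rfl
      rw [u1, u2] at htr
      simp at htr
    have hτ : s' * τ' = s * τ := by linear_combination (t1 - u1) / 2
    have ha : s' ^ 2 * a' = s ^ 2 * a := by
      rw [t2, hτ] at u2
      linear_combination u2 / 2
    have h1 := IsHeisenbergExt.smul hs' ⟨b, hb⟩
    rw [hτ, ha] at h1
    exact ⟨0, by simp, degenerates_zero_of_lieEquiv hd (h1.lieEquiv (h0'.smul hs))⟩
  · have ha : a = 0 := by
      by_contra ha
      obtain ⟨p, q, r, s, hpq⟩ := h.not_metabelian (p := e 1) (q := e 2) (r := e 0) (s := e 1) (by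
        rw [he.h12, he.h01, add_lie, smul_lie, smul_lie, lie_self, he.h02]
        simp [ha, e.ne_zero])
      exact hpq (IsQuadraticAffine.metabelian ⟨b, hb⟩ _ _ _ _)
    subst ha
    have hτ : τ ≠ 0 := by simpa using hτa
    have h20 : ⁅e 2, e 1⁆ = -(τ • e 2) := by rw [← lie_skew, he.h12]; simp
    -- Adding `b 2` to `b 0` makes it commute with `b 1`; target and source then differ only in `⁅c
    -- 1, c 3⁆`.
    obtain ⟨c, c0, c1, c2, c3⟩ := exists_basis_of_det4 b
      (x := b 1) (y := b 0 + b 2) (z := b 2) (w := b 3)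
      (u := ![0, 1, 0, 0]) (v := ![1, 0, 1, 0])
      (t := ![0, 0, 1, 0]) (s := ![0, 0, 0, 1]) (by simp) (by simp) (by simp)
      (by simp) (by rw [det_four]; simp)
    obtain ⟨f, f0, f1, f2, f3⟩ := exists_basis_of_det4 e
      (x := τ⁻¹ • e 1) (y := e 0 + τ⁻¹ • e 2) (z := τ⁻¹ • e 2) (w := τ⁻¹ • e 3)
      (u := ![0, τ⁻¹, 0, 0]) (v := ![1, 0, τ⁻¹, 0])
      (t := ![0, 0, τ⁻¹, 0]) (s := ![0, 0, 0, τ⁻¹]) (by simp) (by simp) (by simp)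
      (by simp) (by rw [det_four]; simpa using hτ)
    have b10 : ⁅b 1, b 0⁆ = -b 2 := by rw [← lie_skew, hb.h01]
    have e10 : ⁅e 1, e 0⁆ = -e 2 := by rw [← lie_skew, he.h01]
    have g01 : ⁅c 0, c 1⁆ = 0 := by rw [c0, c1, lie_add, b10, hb.h12]; simp
    have g02 : ⁅c 0, c 2⁆ = c 2 := by rw [c0, c2, hb.h12]
    have g03 : ⁅c 0, c 3⁆ = c 3 := by rw [c0, c3, hb.h13]
    have g12 : ⁅c 1, c 2⁆ = c 3 := by rw [c1, c2, c3, add_lie, hb.h02, lie_self, add_zero]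
    have g13 : ⁅c 1, c 3⁆ = d • c 2 := by rw [c1, c2, c3, add_lie, hb.h03, hb.h23, add_zero]
    have g23 : ⁅c 2, c 3⁆ = 0 := by rw [c2, c3, hb.h23]
    have k01 : ⁅f 0, f 1⁆ = 0 := by
      rw [f0, f1, smul_lie, lie_add, lie_smul, e10, he.h12, zero_smul, zero_add, smul_smul,
        inv_mul_cancel₀ hτ]; simp
    have k02 : ⁅f 0, f 2⁆ = f 2 := by
      rw [f0, f2, smul_lie, lie_smul, he.h12, zero_smul, zero_add, smul_smul τ⁻¹ τ,
        inv_mul_cancel₀ hτ, one_smul]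
    have k03 : ⁅f 0, f 3⁆ = f 3 := by
      rw [f0, f3, smul_lie, lie_smul, he.h13, smul_smul τ⁻¹ τ,
        inv_mul_cancel₀ hτ, one_smul]
    have k12 : ⁅f 1, f 2⁆ = f 3 := by
      rw [f1, f2, f3, add_lie, lie_smul, he.h02, smul_lie, lie_smul, lie_self]; simp
    have k13 : ⁅f 1, f 3⁆ = 0 := by
      rw [f1, f3, add_lie, lie_smul, he.h03, smul_lie, lie_smul, he.h23]; simp
    have k23 : ⁅f 2, f 3⁆ = 0 := by
      rw [f2, f3, lie_smul, smul_lie, he.h23]; simp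
    refine ⟨![0, 1, 0, 1], by decide, degenerates_of_brackets _ ⟨g01, g02, g03, g12, g13, g23⟩
      ⟨k01, k02, k03, k12, k13, k23⟩ ?_ ?_ ?_ ?_ ?_ ?_⟩ <;> intro k <;> fin_cases k <;> simp
  · obtain ⟨c, hc⟩ := exists_split_center hΔ b hb
    obtain ⟨d, f, hd0, hf0, hred⟩ := exists_isReductive hΔ c hc
    have hτ : τ = 0 := by
      have := hred.adTrace_one x1
      rw [hx1.adTrace_eq, t1] at this
      simpa [hs] using this
    subst hτ
    obtain ⟨b, hb⟩ := hred
    obtain ⟨p, q, r, σ, rfl⟩ := exists_coords b x1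
    have u2 := (hb.adTrace_reductive p q r σ).2
    rw [hx1.adTrace_eq, t2] at u2
    have ha : a ≠ 0 := by simpa using hτa
    have hδ : d * p ^ 2 - f * q ^ 2 + d * f * r ^ 2 = -(s ^ 2 * a) := by
      linear_combination -u2 / 2
    have hδ0 : -(s ^ 2 * a) ≠ 0 := by simp [hs, ha]
    obtain ⟨c, k, hk, hc⟩ := hb.exists_rotation_basis (mul_ne_zero hd0 hf0) (hδ ▸ hδ0)
    rw [hδ] at hc
    obtain ⟨g, g0, g1, g2, g3⟩ := exists_basis_of_det4 e
      (x := s • e 1) (y := e 0) (z := (-s) • e 2) (w := (s / k) • e 3)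
      (u := ![0, s, 0, 0]) (v := ![1, 0, 0, 0])
      (t := ![0, 0, -s, 0]) (s := ![0, 0, 0, s / k]) (by simp) (by simp) (by simp)
      (by simp) (by rw [det_four]; simp [hs, hk])
    have e10 : ⁅e 1, e 0⁆ = -e 2 := by rw [← lie_skew, he.h01]
    have g01 : ⁅g 0, g 1⁆ = g 2 := by rw [g0, g1, g2, smul_lie, e10]; module
    have g02 : ⁅g 0, g 2⁆ = (-(s ^ 2 * a)) • g 1 := by
      rw [g0, g1, g2, smul_lie, lie_smul, he.h12]; module
    have g03 : ⁅g 0, g 3⁆ = 0 := by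
      rw [g0, g3, smul_lie, lie_smul, he.h13]; simp
    have g12 : ⁅g 1, g 2⁆ = (-k) • g 3 := by
      rw [g1, g2, g3, lie_smul, he.h02, smul_smul]
      congr 1
      field_simp
    have g13 : ⁅g 1, g 3⁆ = 0 := by
      rw [g1, g3, lie_smul, he.h03]; simp
    have g23 : ⁅g 2, g 3⁆ = 0 := by
      rw [g2, g3, lie_smul, smul_lie, he.h23]; simp
    refine ⟨![0, 1, 1, 2], by decide, degenerates_of_brackets _ hc
      ⟨g01, g02, g03, g12, g13, g23⟩ ?_ ?_ ?_ ?_ ?_ ?_⟩ <;> intro k <;> fin_cases k <;> simp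

/-- These targets are rigid. The nonzero Gram determinant excludes the two degenerate families, the
trace excludes the reductive one, and in the remaining family the parameters agree up to a square
close to 1. -/
theorem Degenerates.of_quadraticAffine (h : Degenerates 𝕜 L L0 α)
    (hsq : ∀ r : 𝕜, ‖r - 1‖ < 1 → ∃ s, s ^ 2 = r)
    (hd : finrank 𝕜 L = 4) {d : 𝕜} (hd0 : d ≠ 0) (h0 : IsQuadraticAffine 𝕜 L0 d) :
    ∃ β : Fin 4 → ℕ, (∀ i, β i ≤ 2) ∧ Degenerates 𝕜 L L0 (fun i => (β i : ℝ)) := by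
  have h0' := h0
  obtain ⟨e, he⟩ := h0
  have hgp : GPair 𝕜 (e 0) (e 1) := ⟨e, rfl, rfl, by rw [he.h01], by rw [he.h01, he.h02]⟩
  obtain ⟨k1, k2, k3⟩ := killing_of_brackets e (p := 0) (c := 0) (d := d) (e := 0) (a1 := 0)
    (a2 := 0) (a3 := 1) (q1 := 0) (q2 := 0) (q3 := 0) (q4 := 0) ⟨he.h01, he.h02,
      by rw [he.h03]; module, by rw [he.h12]; module, by rw [he.h13]; module,
      by rw [he.h23]; module⟩
  have hgram : killingGram 𝕜 (e 0) (e 1) = 4 * d := by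
    rw [killingGram, k1, k2, k3]; ring
  have hne : killingGram 𝕜 (e 0) (e 1) ≠ 0 := by
    rw [hgram]; exact mul_ne_zero (by norm_num) hd0
  obtain ⟨x, y, hxy, hr, -⟩ := h.exists_gpair_near hgp
  replace hr := hr hne
  have hr0 : killingGram 𝕜 x y ≠ 0 := by
    intro h
    simp [h] at hr
  obtain ⟨c, d', e', -, hg⟩ | ⟨τ', a', -, -, hg⟩ | ⟨d', σ, hd0', hσ, hL, hg⟩ |
    ⟨a1, a2, d', hΔ, -, -, b, hb⟩ := hxy.normal_form
  · exact absurd hg hr0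
  · exact absurd hg hr0
  · rw [hg, hgram] at hr
    obtain ⟨s, hs⟩ := hsq _ hr
    have hs0 : s ≠ 0 := by
      rintro rfl
      rw [← hs] at hr
      simp at hr
    have h1 := h0'.mul_sq (div_ne_zero hs0 hσ)
    have h2 : d * (s / σ) ^ 2 = d' := by
      rw [div_pow, hs]; field_simp
    rw [h2] at h1
    exact ⟨0, by simp, degenerates_zero_of_lieEquiv hd (hL.lieEquiv h1)⟩
  · exfalso
    obtain ⟨c, hc⟩ := exists_split_center hΔ b hb
    obtain ⟨d, f, -, -, hred⟩ := exists_isReductive hΔ c hc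
    have h10 : ⁅e 1, e 0⁆ = -e 2 := by rw [← lie_skew, he.h01]
    obtain ⟨x, hx⟩ := h.not_unimodular (x0 := e 1) (by
      rw [adTrace_eq e]
      simp [Fin.sum_univ_four, h10, he.h12, he.h13])
    exact hx (hred.adTrace_one x)

/-- Rigid again: the Gram determinant and the failure of metabelianity leave only reductive sources,
and two Killing values close to those of the target fix both parameters up to squares. -/
theorem Degenerates.of_reductive (h : Degenerates 𝕜 L L0 α)
    (hsq : ∀ r : 𝕜, ‖r - 1‖ < 1 → ∃ s, s ^ 2 = r)
    (hd : finrank 𝕜 L = 4) {d f : 𝕜} (hd0 : d ≠ 0) (hf0 : f ≠ 0) (h0 : IsReductive 𝕜 L0 d f) :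
    ∃ β : Fin 4 → ℕ, (∀ i, β i ≤ 2) ∧ Degenerates 𝕜 L L0 (fun i => (β i : ℝ)) := by
  have h0' := h0
  obtain ⟨e, he⟩ := h0
  have hgp : GPair 𝕜 (e 0) (e 1 + e 3) := gpair_of_det4 e (z := e 2) (w := d • e 1)
    (u := ![1, 0, 0, 0]) (v := ![0, 1, 0, 1]) (t := ![0, 0, 1, 0]) (s := ![0, d, 0, 0])
    (by simp) (by simp) (by simp) (by simp) (by rw [det_four]; simpa using hd0)
    (by rw [lie_add, he.h01, he.h03, add_zero]) he.h02
  have h10 : ⁅e 1, e 0⁆ = -e 2 := by rw [← lie_skew, he.h01]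
  have h30 : ⁅e 3, e 0⁆ = 0 := by rw [← lie_skew, he.h03, neg_zero]
  have h31 : ⁅e 3, e 1⁆ = 0 := by rw [← lie_skew, he.h13, neg_zero]
  have h32 : ⁅e 3, e 2⁆ = 0 := by rw [← lie_skew, he.h23, neg_zero]
  have h21 : ⁅e 2, e 1⁆ = -(f • e 0) := by rw [← lie_skew, he.h12]
  have k1 : killingForm 𝕜 L0 (e 0) (e 0) = 2 * d := by
    rw [killing_eq_sum e]
    simp [he.h01, he.h02, he.h03]
    ring
  have hgram : killingGram 𝕜 (e 0) (e 1 + e 3) = -4 * (d * f) := by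
    have k2 : killingForm 𝕜 L0 (e 0) (e 1 + e 3) = 0 := by
      rw [killing_eq_sum e]
      simp [he.h02, h10, h30, he.h12, he.h13, h31, h32]
    have k3 : killingForm 𝕜 L0 (e 1 + e 3) (e 1 + e 3) = -2 * f := by
      rw [killing_eq_sum e]
      simp [h10, h30, he.h12, he.h13, h31, h32]
      ring
    rw [killingGram, k1, k2, k3]; ring
  have hne : killingGram 𝕜 (e 0) (e 1 + e 3) ≠ 0 := by
    rw [hgram]; exact mul_ne_zero (by norm_num) (mul_ne_zero hd0 hf0)
  obtain ⟨x, y, hxy, hr, hr'⟩ := h.exists_gpair_near hgp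
  replace hr := hr hne
  replace hr' := hr' (by rw [k1]; exact mul_ne_zero two_ne_zero hd0)
  have hr0 : killingGram 𝕜 x y ≠ 0 := by
    intro h
    simp [h] at hr
  obtain ⟨c, d', e', -, hg⟩ | ⟨τ', a', -, -, hg⟩ | ⟨d', σ, hd0', hσ, hL, hg⟩ |
    ⟨a1, a2, d', hΔ, hg, hk, b, hb⟩ := hxy.normal_form
  · exact absurd hg hr0
  · exact absurd hg hr0
  · exfalso
    obtain ⟨p, q, r, s, hpq⟩ := h.not_metabelian (p := e 0) (q := e 1) (r := e 0) (s := e 2) (by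
      rw [he.h01, he.h02, lie_smul, h21]
      simp [hd0, hf0, e.ne_zero])
    exact hpq (hL.metabelian _ _ _ _)
  · obtain ⟨c, hc⟩ := exists_split_center hΔ b hb
    rw [hg, hgram] at hr
    rw [hk, k1] at hr'
    obtain ⟨s, hs⟩ := hsq _ hr
    obtain ⟨t, ht⟩ := hsq _ hr'
    have hs0 : s ≠ 0 := by
      rintro rfl
      rw [← hs] at hr
      simp at hr
    have ht0 : t ≠ 0 := by
      rintro rfl
      rw [← ht] at hr'
      simp at hr'
    have e1 : d' = d * t ^ 2 := by rw [ht]; field_simp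
    have hd0' : d' ≠ 0 := by rw [e1]; simp [hd0, ht0]
    have e2 : (a2 ^ 2 + a1 * d') / d' = f * (s / t) ^ 2 := by
      have e3 : a2 ^ 2 + a1 * d' = d * f * s ^ 2 := by rw [hs]; field_simp
      rw [e3, e1]; field_simp
    have h1 := isReductive_of_split hd0' c hc
    rw [e2, e1] at h1
    exact ⟨0, by simp, degenerates_zero_of_lieEquiv hd
      (h1.lieEquiv (h0'.mul_sq ht0 (div_ne_zero hs0 ht0)))⟩

theorem Degenerates.exists_weights_le_two (h : Degenerates 𝕜 L L0 α)
    (hsq : ∀ r : 𝕜, ‖r - 1‖ < 1 → ∃ s, s ^ 2 = r) (hd : finrank 𝕜 L = 4)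
    (hd0 : finrank 𝕜 L0 = 4) (hne : ¬ IsCyclicExt 𝕜 L0 0 0 0) :
    ∃ β : Fin 4 → ℕ, (∀ i, β i ≤ 2) ∧ Degenerates 𝕜 L L0 (fun i => (β i : ℝ)) := by
  obtain h0 | ⟨h0, x, y, hxy⟩ | ⟨x, y, hxy⟩ | ⟨κ, μ, hκμ, h0⟩ | ⟨κ, hκ, h0⟩ | ⟨κ, hκ, h0⟩ :=
    classification (K := 𝕜) (L := L0) hd0
  · exact ⟨_, by decide, degenerates_of_abelian hd hd0 h0⟩
  · obtain ⟨b0, hb0⟩ := exists_brackets_of_two_step hd0 h0 hxy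
    obtain ⟨b, hb⟩ := h.exists_lie_basis b0 hb0.h01
    exact ⟨_, by decide, degenerates_of_two_step hb hb0⟩
  · obtain ⟨c, d, e, h0, -⟩ | ⟨τ, a, hτa, h0, -⟩ | ⟨d, σ, hd', hσ, h0, -⟩ |
      ⟨a1, a2, d, hΔ, -, -, b, hb⟩ := hxy.normal_form
    · exact ⟨_, by decide, h.of_cyclicExt h0 hne⟩
    · exact h.of_heisenbergExt hd hτa h0
    · exact h.of_quadraticAffine hsq hd hd' h0
    · obtain ⟨c, hc⟩ := exists_split_center hΔ b hb
      obtain ⟨d, f, hd', hf, hred⟩ := exists_isReductive hΔ c hc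
      exact h.of_reductive hsq hd hd' hf hred
  · exact h.of_diagonalExt hd hκμ h0
  · exact h.of_jordanExt hd hκ h0
  · exact h.of_scalarHeisenbergExt hd hκ h0

end Targets

/-! ### Special generators that allow small weights -/

section Filtrations

variable (K L : Type*) [Field K] [LieRing L] [LieAlgebra K L]

/-- Some generating pair `x`, `y` has `[x, [x, [x, y]]]` proportional to `x`. -/
def HasNilpotentGenerator : Prop :=
  ∃ (b : Basis (Fin 4) K L) (s : K), ⁅b 0, b 1⁆ = b 2 ∧ ⁅b 0, b 2⁆ = b 3 ∧ ⁅b 0, b 3⁆ = s • b 0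

/-- Some generating pair `x`, `y` has `[y, [x, y]]` proportional to `y`. -/
def HasEngelGenerator : Prop :=
  ∃ (b : Basis (Fin 4) K L) (s : K), ⁅b 0, b 1⁆ = b 2 ∧ ⁅b 0, b 2⁆ = b 3 ∧ ⁅b 1, b 2⁆ = s • b 1

variable {K L}

theorem IsCyclicExt.hasEngelGenerator {c d e : K} (h : IsCyclicExt K L c d e) :
    HasEngelGenerator K L := by
  obtain ⟨b, hb⟩ := h
  exact ⟨b, 0, hb.h01, hb.h02, by rw [hb.h12, zero_smul]⟩

theorem IsHeisenbergExt.hasNilpotentGenerator {τ a : K} (h : IsHeisenbergExt K L τ a) :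
    HasNilpotentGenerator K L := by
  obtain ⟨b, hb⟩ := h
  exact ⟨b, 0, hb.h01, hb.h02, by rw [hb.h03, zero_smul]⟩

theorem IsReductive.swap {d f : K} (h : IsReductive K L d f) : IsReductive K L (-f) (-d) := by
  obtain ⟨b, hB⟩ := h
  obtain ⟨c, c0, c1, c2, c3⟩ := exists_basis_of_det4 b (x := b 1) (y := b 0)
    (z := -b 2) (w := b 3) (u := ![0, 1, 0, 0]) (v := ![1, 0, 0, 0])
    (t := ![0, 0, -1, 0]) (s := ![0, 0, 0, 1]) (by simp) (by simp) (by simp)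
    (by simp) (by rw [det_four]; simp)
  have h10 : ⁅b 1, b 0⁆ = -b 2 := by rw [← lie_skew, hB.h01]
  refine ⟨c, ?_, ?_, ?_, ?_, ?_, ?_⟩ <;>
    simp only [c0, c1, c2, c3, lie_neg, neg_lie, h10, hB.h02, hB.h03, hB.h12, hB.h13, hB.h23] <;>
    module

/-- If `d = s ^ 2`, then `b 2 + s • b 1` and `b 2 - s • b 1` are eigenvectors of `ad (b 0)` for `s`
and `-s`, and with `b 0` they form an `sl₂`-triple up to scale. The central `b 3` is added to one of
them so that the pair generates everything. -/
theorem IsReductive.hasEngelGenerator [CharZero K] {s f : K} (hs : s ≠ 0) (hf : f ≠ 0)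
    (h : IsReductive K L (s ^ 2) f) : HasEngelGenerator K L := by
  obtain ⟨b, hB⟩ := h
  have h20 : ⁅b 2, b 0⁆ = -(s ^ 2 • b 1) := by rw [← lie_skew, hB.h02]
  have h10 : ⁅b 1, b 0⁆ = -b 2 := by rw [← lie_skew, hB.h01]
  have h30 : ⁅b 3, b 0⁆ = 0 := by rw [← lie_skew, hB.h03, neg_zero]
  have h21 : ⁅b 2, b 1⁆ = -(f • b 0) := by rw [← lie_skew, hB.h12]
  have h31 : ⁅b 3, b 1⁆ = 0 := by rw [← lie_skew, hB.h13, neg_zero]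
  have h32 : ⁅b 3, b 2⁆ = 0 := by rw [← lie_skew, hB.h23, neg_zero]
  obtain ⟨c, c0, c1, c2, c3⟩ := exists_basis_of_det4 b (x := b 2 - s • b 1 + b 3)
    (y := b 2 + s • b 1) (z := (-(2 * s * f)) • b 0)
    (w := (-(2 * s * f * s)) • (b 2 - s • b 1))
    (u := ![0, -s, 1, 1]) (v := ![0, s, 1, 0])
    (t := ![-(2 * s * f), 0, 0, 0]) (s := ![0, 2 * s * f * s * s, -(2 * s * f * s), 0])
    (by simp; module) (by simp; module) (by simp) (by simp; module) (by
      rw [det_four]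
      intro h0
      have h1 : (8 : K) * (s ^ 4 * f ^ 2) = 0 := by
        linear_combination (norm := (simp; ring)) h0
      simp [hs, hf] at h1)
  refine ⟨c, 2 * s * f * s, ?_, ?_, ?_⟩ <;>
    simp only [c0, c1, c2, c3, lie_add, add_lie, sub_lie, lie_smul, smul_lie, lie_self,
      h10, h20, h30, h21, h31, h32, hB.h12] <;>
    module

theorem GPair.engel_or [CharZero K] {x y : L} (h : GPair K x y) :
    HasNilpotentGenerator K L ∨ HasEngelGenerator K L ∨ (∃ d : K, d ≠ 0 ∧ IsQuadraticAffine K L d) ∨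
      ∃ d f : K, ¬ IsSquare d ∧ ¬ IsSquare (-f) ∧ IsReductive K L d f := by
  obtain ⟨c, d, e, hL, -⟩ | ⟨τ, a, -, hL, -⟩ | ⟨d, σ, hd, -, hL, -⟩ |
    ⟨a1, a2, d, hΔ, -, -, b, hb⟩ := h.normal_form
  · exact Or.inr (Or.inl hL.hasEngelGenerator)
  · exact Or.inl hL.hasNilpotentGenerator
  · exact Or.inr (Or.inr (Or.inl ⟨d, hd, hL⟩))
  · obtain ⟨c, hc⟩ := exists_split_center hΔ b hb
    obtain ⟨d, f, hd, hf, hL⟩ := exists_isReductive hΔ c hc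
    by_cases h1 : IsSquare d
    · obtain ⟨s, rfl⟩ := h1
      have hs : s ≠ 0 := by rintro rfl; simp at hd
      exact Or.inr (Or.inl (IsReductive.hasEngelGenerator hs hf (by rwa [sq])))
    by_cases h3 : IsSquare (-f)
    · obtain ⟨s, hs'⟩ := h3
      have hs : s ≠ 0 := by rintro rfl; simp [hf] at hs'
      have := hL.swap
      rw [hs', ← sq] at this
      exact Or.inr (Or.inl (IsReductive.hasEngelGenerator hs (neg_ne_zero.mpr hd) this))
    exact Or.inr (Or.inr (Or.inr ⟨d, f, h1, h3, hL⟩))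

end Filtrations

/-! ### Algebras without special generators -/

section Obstructions

variable {𝕜 L : Type*} [RCLike 𝕜] [LieRing L] [LieAlgebra 𝕜 L]

theorem Brackets.adTrace_quadraticAffine {b : Basis (Fin 4) 𝕜 L} {d : 𝕜}
    (h : Brackets b (b 2) (b 3) (d • b 2) (b 2) (b 3) 0) (p q r s : 𝕜) :
    adTrace 𝕜 1 (p • b 0 + q • b 1 + r • b 2 + s • b 3) = 2 * q ∧
      adTrace 𝕜 2 (p • b 0 + q • b 1 + r • b 2 + s • b 3) = 2 * (d * p ^ 2 + q ^ 2) := by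
  have h10 : ⁅b 1, b 0⁆ = -b 2 := by rw [← lie_skew, h.h01]
  have h20 : ⁅b 2, b 0⁆ = -b 3 := by rw [← lie_skew, h.h02]
  have h30 : ⁅b 3, b 0⁆ = -(d • b 2) := by rw [← lie_skew, h.h03]
  have h21 : ⁅b 2, b 1⁆ = -b 2 := by rw [← lie_skew, h.h12]
  have h31 : ⁅b 3, b 1⁆ = -b 3 := by rw [← lie_skew, h.h13]
  have h32 : ⁅b 3, b 2⁆ = 0 := by rw [← lie_skew, h.h23, neg_zero]
  set x := p • b 0 + q • b 1 + r • b 2 + s • b 3 with hx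
  have e0 : ⁅x, b 0⁆ = (-(q + s * d)) • b 2 + (-r) • b 3 := by
    simp only [hx, add_lie, smul_lie, lie_self, h10, h20, h30]; module
  have e1 : ⁅x, b 1⁆ = (p - r) • b 2 + (-s) • b 3 := by
    simp only [hx, add_lie, smul_lie, lie_self, h.h01, h21, h31]; module
  have e2 : ⁅x, b 2⁆ = q • b 2 + p • b 3 := by
    simp only [hx, add_lie, smul_lie, lie_self, h.h02, h.h12, h32]; module
  have e3 : ⁅x, b 3⁆ = (p * d) • b 2 + q • b 3 := by
    simp only [hx, add_lie, smul_lie, lie_self, h.h03, h.h13, h.h23]; module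
  clear_value x
  constructor <;> rw [adTrace_eq b] <;> simp [Fin.sum_univ_four, pow_succ, e0, e1, e2, e3] <;> ring

theorem HasNilpotentGenerator.exists_traceless (h : HasNilpotentGenerator 𝕜 L) :
    ∃ (x : L) (c : Basis (Fin 4) 𝕜 L), adTrace 𝕜 1 x = 0 ∧ adTrace 𝕜 2 x = 0 ∧
      c 0 = x ∧ ⁅x, c 1⁆ = c 2 ∧ ⁅x, c 2⁆ = c 3 := by
  obtain ⟨b, s, h1, h2, h3⟩ := h
  obtain ⟨t1, t2, -⟩ := adTrace_of_gpair b (p := s) (c := 0) (d := 0) (e := 0) h1 h2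
    (by rw [h3]; module)
  exact ⟨b 0, b, t1, by rw [t2]; ring, rfl, h1, h2⟩

theorem HasEngelGenerator.exists_traceless (h : HasEngelGenerator 𝕜 L) :
    ∃ (x y : L) (c : Basis (Fin 4) 𝕜 L), adTrace 𝕜 1 y = 0 ∧ adTrace 𝕜 2 y = 0 ∧
      c 1 = y ∧ ⁅x, c 1⁆ = c 2 ∧ ⁅x, c 2⁆ = c 3 := by
  obtain ⟨b, s, h1, h2, h3⟩ := h
  have h10 : ⁅b 1, b 0⁆ = -b 2 := by rw [← lie_skew, h1]
  have h4 : ⁅b 1, b 3⁆ = s • b 2 := by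
    rw [← h2, leibniz_lie, h10, h3, neg_lie, lie_self, lie_smul, h1]; simp
  refine ⟨b 0, b 1, b, ?_, ?_, rfl, h1, h2⟩ <;> rw [adTrace_eq b] <;>
    simp [Fin.sum_univ_four, pow_succ, h10, h3, h4]

/-- A special generator has zero trace in degree two; anisotropy of the form makes such an element
central, so it generates nothing. -/
theorem IsReductive.not_exists_generator {d f : 𝕜} (h : IsReductive 𝕜 L d f)
    (ha : ∀ p q r : 𝕜, d * p ^ 2 - f * q ^ 2 + d * f * r ^ 2 = 0 → p = 0 ∧ q = 0 ∧ r = 0) :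
    ¬ (HasNilpotentGenerator 𝕜 L ∨ HasEngelGenerator 𝕜 L) := by
  obtain ⟨b, hb⟩ := h
  have key : ∀ x : L, adTrace 𝕜 2 x = 0 → ∀ y : L, ⁅x, y⁆ = 0 := by
    intro x hx y
    obtain ⟨p, q, r, s, rfl⟩ := exists_coords b x
    rw [(hb.adTrace_reductive p q r s).2] at hx
    obtain ⟨rfl, rfl, rfl⟩ := ha p q r (by simpa using hx)
    obtain ⟨p', q', r', s', rfl⟩ := exists_coords b y
    rw [hb.lie_comb]; simp
  rintro (h | h)
  · obtain ⟨x, c, -, t2, -, h1, -⟩ := h.exists_traceless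
    exact c.ne_zero 2 (by rw [← h1, key x t2])
  · obtain ⟨x, y, c, -, t2, c1, h1, -⟩ := h.exists_traceless
    exact c.ne_zero 2 (by rw [← h1, c1, ← lie_skew, key y t2, neg_zero])

/-- Vanishing traces in degrees one and two place an element in the abelian ideal spanned by `b 2`
and `b 3`. There its adjoint squares to zero, and no three independent vectors fit into the ideal.
-/
theorem IsQuadraticAffine.not_exists_generator {d : 𝕜} (hd : d ≠ 0)
    (h : IsQuadraticAffine 𝕜 L d) :
    ¬ (HasNilpotentGenerator 𝕜 L ∨ HasEngelGenerator 𝕜 L) := by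
  obtain ⟨b, hb⟩ := h
  have key : ∀ x : L, adTrace 𝕜 1 x = 0 → adTrace 𝕜 2 x = 0 → ∃ r s : 𝕜,
      x = r • b 2 + s • b 3 := by
    intro x t1 t2
    obtain ⟨p, q, r, s, rfl⟩ := exists_coords b x
    rw [(hb.adTrace_quadraticAffine p q r s).1] at t1
    rw [(hb.adTrace_quadraticAffine p q r s).2] at t2
    have hq : q = 0 := by simpa using t1
    subst hq
    have hp : p = 0 := by simpa [hd] using t2
    exact ⟨r, s, by rw [hp]; simp⟩
  have ideal : ∀ (x : L) (r s : 𝕜), ∃ r' s' : 𝕜,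
      ⁅x, r • b 2 + s • b 3⁆ = r' • b 2 + s' • b 3 := by
    intro x r s
    obtain ⟨p', q', r', s', rfl⟩ := exists_coords b x
    refine ⟨p' * s * d + q' * r, p' * r + q' * s, ?_⟩
    have := hb.lie_comb p' q' r' s' 0 0 r s
    simp only [zero_smul, zero_add] at this
    rw [this]; module
  have abel : ∀ r s r' s' : 𝕜, ⁅r • b 2 + s • b 3, r' • b 2 + s' • b 3⁆ = 0 := by
    intro r s r' s'
    have := hb.lie_comb 0 0 r s 0 0 r' s'
    simp only [zero_smul, zero_add] at this
    rw [this]; simp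
  rintro (h | h)
  · obtain ⟨x, c, t1, t2, -, h1, h2⟩ := h.exists_traceless
    obtain ⟨r, s, rfl⟩ := key x t1 t2
    obtain ⟨r', s', hc⟩ := ideal (c 1) r s
    refine c.ne_zero 3 ?_
    rw [← h2, ← h1, ← lie_skew (r • b 2 + s • b 3) (c 1), hc, lie_neg, abel, neg_zero]
  · obtain ⟨x, y, c, t1, t2, c1, h1, h2⟩ := h.exists_traceless
    obtain ⟨r1, s1, e1⟩ := key y t1 t2
    rw [← c1] at e1
    obtain ⟨r2, s2, e2⟩ := ideal x r1 s1
    rw [← e1, h1] at e2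
    obtain ⟨r3, s3, e3⟩ := ideal x r2 s2
    rw [← e2, h2] at e3
    -- Cramer's relation among three vectors of a plane; independence of `c 1`, `c 2`, `c 3` makes
    -- its coefficients vanish.
    obtain ⟨-, -, -, hm⟩ := coords_eq_zero c (p := 0) (q := r2 * s3 - r3 * s2)
      (r := r3 * s1 - r1 * s3) (s := r1 * s2 - r2 * s1) (by
        rw [e1, e2, e3]; module)
    obtain ⟨-, -, hr, -⟩ := coords_eq_zero c (p := 0) (q := -r2) (r := r1) (s := 0) (by
      rw [e1, e2]
      linear_combination (norm := module) hm • b 3)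
    obtain ⟨-, -, hs, -⟩ := coords_eq_zero c (p := 0) (q := -s2) (r := s1) (s := 0) (by
      rw [e1, e2]
      linear_combination (norm := module) (-hm) • b 2)
    exact c.ne_zero 1 (by rw [e1, hr, hs]; simp)

end Obstructions

/-! ### Weights of degenerations to `A41` -/

section NilpotentTarget

variable {𝕜 L L0 : Type*} [RCLike 𝕜] [LieRing L] [LieAlgebra 𝕜 L] [LieRing L0] [LieAlgebra 𝕜 L0]
  {α : Fin 4 → ℝ}

theorem HasNilpotentGenerator.degenerates (h : HasNilpotentGenerator 𝕜 L)
    (h0 : IsCyclicExt 𝕜 L0 0 0 0) :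
    Degenerates 𝕜 L L0 (fun i => ((![0, 1, 1, 1] : Fin 4 → ℕ) i : ℝ)) := by
  obtain ⟨a, ha⟩ := h0
  obtain ⟨b, s, h1, h2, h3⟩ := h
  refine degenerates_of_brackets _ ⟨h1, h2, h3, rfl, rfl, rfl⟩ ha
    ?_ ?_ ?_ ?_ ?_ ?_ <;> intro k <;> fin_cases k <;> simp

theorem HasEngelGenerator.degenerates (h : HasEngelGenerator 𝕜 L)
    (h0 : IsCyclicExt 𝕜 L0 0 0 0) :
    Degenerates 𝕜 L L0 (fun i => ((![1, 0, 1, 2] : Fin 4 → ℕ) i : ℝ)) := by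
  obtain ⟨a, ha⟩ := h0
  obtain ⟨b, s, h1, h2, h3⟩ := h
  have h10 : ⁅b 1, b 0⁆ = -b 2 := by rw [← lie_skew, h1]
  have h4 : ⁅b 1, b 3⁆ = s • b 2 := by
    rw [← h2, leibniz_lie, h10, h3, neg_lie, lie_self, lie_smul, h1]; simp
  refine degenerates_of_brackets _ ⟨h1, h2, rfl, h3, h4, rfl⟩ ha
    ?_ ?_ ?_ ?_ ?_ ?_ <;> intro k <;> fin_cases k <;> simp

/-- `v0` is the part of weight `s` of `v`, which has no part of higher weight. -/
def IsSymbol (α : Fin 4 → ℝ) (b : Basis (Fin 4) 𝕜 L) (b0 : Basis (Fin 4) 𝕜 L0) (s : ℝ) (v : L)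
    (v0 : L0) : Prop :=
  ∀ k, (s < α k → b.repr v k = 0) ∧ b0.repr v0 k = if s = α k then b.repr v k else 0

theorem isSymbol_basis (α : Fin 4 → ℝ) (b : Basis (Fin 4) 𝕜 L) (b0 : Basis (Fin 4) 𝕜 L0)
    (i : Fin 4) : IsSymbol α b b0 (α i) (b i) (b0 i) := by
  intro k
  by_cases h : i = k
  · subst h; simp
  · simp [h]

theorem IsSymbol.lie {b : Basis (Fin 4) 𝕜 L} {b0 : Basis (Fin 4) 𝕜 L0}
    (hb : IsGradation α b b0)
    {s t : ℝ} {u v : L} {u0 v0 : L0} (hu : IsSymbol α b b0 s u u0) (hv : IsSymbol α b b0 t v v0) :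
    IsSymbol α b b0 (s + t) ⁅u, v⁆ ⁅u0, v0⁆ := by
  intro k
  rw [repr_lie_eq_sum b, repr_lie_eq_sum b0]
  constructor
  · intro hk
    refine Finset.sum_eq_zero fun i _ => Finset.sum_eq_zero fun j _ => ?_
    by_cases hi : s < α i
    · rw [(hu i).1 hi]; ring
    by_cases hj : t < α j
    · rw [(hv j).1 hj]; ring
    rw [(hb i j k).1 (by linarith), mul_zero]
  · split_ifs with hk
    · refine Finset.sum_congr rfl fun i _ => Finset.sum_congr rfl fun j _ => ?_
      rw [(hu i).2, (hv j).2, (hb i j k).2]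
      rcases lt_trichotomy s (α i) with hi | hi | hi
      · rw [(hu i).1 hi]; simp
      · rcases lt_trichotomy t (α j) with hj | hj | hj
        · rw [(hv j).1 hj]; simp
        · rw [if_pos hi, if_pos hj, if_pos (by linarith)]
        · rw [if_neg hj.ne', (hb i j k).1 (by linarith)]; simp
      · rcases lt_or_ge t (α j) with hj | hj
        · rw [(hv j).1 hj]; simp
        · rw [if_neg hi.ne', (hb i j k).1 (by linarith)]; simp
    · refine Finset.sum_eq_zero fun i _ => Finset.sum_eq_zero fun j _ => ?_
      rw [(hu i).2, (hv j).2, (hb i j k).2]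
      by_cases hi : s = α i
      · by_cases hj : t = α j
        · rw [if_neg (c := α i + α j = α k) (by rw [← hi, ← hj]; exact hk), mul_zero]
        · rw [if_neg hj]; ring
      · rw [if_neg hi]; ring

/-- A homogeneous basis contains a vector outside the abelian ideal and a second one independent of
it modulo the derived algebra; two such vectors generate. -/
theorem exists_graded_gpair (h0 : IsCyclicExt 𝕜 L0 0 0 0) (b0 : Basis (Fin 4) 𝕜 L0) :
    ∃ (i j : Fin 4) (t : 𝕜) (c : Basis (Fin 4) 𝕜 L0), c 0 = b0 i ∧ c 1 = b0 j ∧ ⁅c 0, c 1⁆ = c 2 ∧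
      ⁅c 0, c 2⁆ = c 3 ∧ ⁅c 0, c 3⁆ = 0 ∧ ⁅c 1, c 2⁆ = t • c 3 := by
  obtain ⟨a, ha⟩ := h0
  simp only [zero_smul, add_zero] at ha
  obtain ⟨i, hi⟩ : ∃ i, a.repr (b0 i) 0 ≠ 0 := by
    by_contra! h'
    have h1 : a.coord 0 = 0 := b0.ext fun i => by simpa using h' i
    have h2 : a.coord 0 (a 0) = 1 := by simp
    rw [h1] at h2
    simp at h2
  obtain ⟨j, hj⟩ : ∃ j, a.repr (b0 i) 0 * a.repr (b0 j) 1 - a.repr (b0 i) 1 * a.repr (b0 j) 0 ≠ 0 := by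
    by_contra! h'
    have h1 : a.repr (b0 i) 0 • a.coord 1 - a.repr (b0 i) 1 • a.coord 0 = 0 :=
      b0.ext fun j => by simpa using h' j
    have h2 := congrArg (fun φ => φ (a 1)) h1
    simp at h2
    exact hi h2
  refine ⟨i, j, ?_⟩
  generalize b0 i = u at *
  generalize b0 j = v at *
  obtain ⟨p, q, r, s, rfl⟩ := exists_coords a u
  obtain ⟨p', q', r', s', rfl⟩ := exists_coords a v
  have hp : p ≠ 0 := by simpa using hi
  have hD : p * q' - q * p' ≠ 0 := by simpa using hj
  obtain ⟨D, hD'⟩ : ∃ D, D = p * q' - q * p' := ⟨_, rfl⟩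
  rw [← hD'] at hD
  obtain ⟨c, c0, c1, c2, c3⟩ := exists_basis_of_det4 a
    (x := p • a 0 + q • a 1 + r • a 2 + s • a 3) (y := p' • a 0 + q' • a 1 + r' • a 2 + s' • a 3)
    (z := (0 : 𝕜) • a 0 + (0 : 𝕜) • a 1 + D • a 2 + (p * r' - r * p') • a 3)
    (w := (0 : 𝕜) • a 0 + (0 : 𝕜) • a 1 + (0 : 𝕜) • a 2 + (p * D) • a 3)
    (u := ![p, q, r, s]) (v := ![p', q', r', s']) (t := ![0, 0, D, p * r' - r * p'])
    (s := ![0, 0, 0, p * D]) (by simp) (by simp) (by simp) (by simp) (by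
      rw [det_four]
      intro h0
      refine mul_ne_zero (mul_ne_zero (mul_ne_zero hD hD) hp) hD ?_
      linear_combination (norm := (simp; ring)) h0 + D * D * p * hD')
  refine ⟨p' / p, c, c0, c1, ?_, ?_, ?_, ?_⟩
  · rw [c0, c1, c2, ha.lie_comb, hD']; module
  · rw [c0, c2, c3, ha.lie_comb]; module
  · rw [c0, c3, ha.lie_comb]; module
  · rw [c1, c2, c3, ha.lie_comb, smul_add, smul_smul (p' / p) (p * D),
      show p' / p * (p * D) = p' * D by field_simp]
    module

/-- Brackets add weights, so a nonzero coordinate of `z0` or `w0` identifies the weight of the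
corresponding basis vector. Brackets that vanish in the target lose their top-weight part in the
source; for `⁅c 1, c 2⁆` this uses that `t • w0` would have the wrong weight unless the two
generators have equal weights. -/
theorem exists_adapted_of_minor {b : Basis (Fin 4) 𝕜 L} {b0 : Basis (Fin 4) 𝕜 L0}
    (hb : IsGradation α b b0)
    {t : 𝕜} {z0 w0 : L0} (h01 : ⁅b0 0, b0 1⁆ = z0) (h02 : ⁅b0 0, z0⁆ = w0)
    (h03 : ⁅b0 0, w0⁆ = 0) (h12 : ⁅b0 1, z0⁆ = t • w0)
    (hm : b0.repr z0 2 * b0.repr w0 3 - b0.repr z0 3 * b0.repr w0 2 ≠ 0)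
    (hz : b0.repr z0 2 ≠ 0) (hw : b0.repr w0 3 ≠ 0) :
    ∃ c : Basis (Fin 4) 𝕜 L, α 2 = α 0 + α 1 ∧ α 3 = 2 * α 0 + α 1 ∧
      c 0 = b 0 ∧ c 1 = b 1 ∧ ⁅c 0, c 1⁆ = c 2 ∧ ⁅c 0, c 2⁆ = c 3 ∧
      (∀ k, 3 * α 0 + α 1 ≤ α k → b.repr ⁅c 0, c 3⁆ k = 0) ∧
      (α 0 ≠ α 1 → ∀ k, α 0 + 2 * α 1 ≤ α k → b.repr ⁅c 1, c 2⁆ k = 0) := by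
  have s0 := isSymbol_basis α b b0 0
  have s1 := isSymbol_basis α b b0 1
  have s2 := s0.lie hb s1
  rw [h01] at s2
  have s3 := s0.lie hb s2
  rw [h02] at s3
  have s4 := s0.lie hb s3
  rw [h03] at s4
  have s5 := s1.lie hb s2
  rw [h12] at s5
  have e2 : α 0 + α 1 = α 2 := by
    by_contra h
    exact hz (by rw [(s2 2).2, if_neg h])
  have e3 : α 0 + (α 0 + α 1) = α 3 := by
    by_contra h
    exact hw (by rw [(s3 3).2, if_neg h])
  have z2 : b.repr ⁅b 0, b 1⁆ 2 = b0.repr z0 2 := by rw [(s2 2).2, if_pos e2]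
  have w3 : b.repr ⁅b 0, ⁅b 0, b 1⁆⁆ 3 = b0.repr w0 3 := by rw [(s3 3).2, if_pos e3]
  -- For `α 0 ≠ 0` the minor is triangular by weights; for `α 0 = 0` it equals the minor in the
  -- target.
  have hdet : b.repr ⁅b 0, b 1⁆ 2 * b.repr ⁅b 0, ⁅b 0, b 1⁆⁆ 3 -
      b.repr ⁅b 0, b 1⁆ 3 * b.repr ⁅b 0, ⁅b 0, b 1⁆⁆ 2 ≠ 0 := by
    rw [z2, w3]
    rcases lt_trichotomy (α 0) 0 with h | h | h
    · rw [(s3 2).1 (by linarith), mul_zero, sub_zero]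
      exact mul_ne_zero hz hw
    · have z3 := (s2 3).2
      have w2 := (s3 2).2
      rw [if_pos (by linarith)] at z3 w2
      rwa [← z3, ← w2]
    · rw [(s2 3).1 (by linarith), zero_mul, sub_zero]
      exact mul_ne_zero hz hw
  obtain ⟨c, c0, c1, c2, c3⟩ := exists_basis_of_det4 b (x := b 0) (y := b 1)
    (z := ⁅b 0, b 1⁆) (w := ⁅b 0, ⁅b 0, b 1⁆⁆) (u := ![1, 0, 0, 0]) (v := ![0, 1, 0, 0])
    (t := b.repr ⁅b 0, b 1⁆) (s := b.repr ⁅b 0, ⁅b 0, b 1⁆⁆) (by simp) (by simp)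
    (by rw [← Fin.sum_univ_four (f := fun i => b.repr ⁅b 0, b 1⁆ i • b i), b.sum_repr])
    (by rw [← Fin.sum_univ_four (f := fun i => b.repr ⁅b 0, ⁅b 0, b 1⁆⁆ i • b i), b.sum_repr])
    (by rw [det_four]; simpa using hdet)
  refine ⟨c, e2.symm, by linarith, c0, c1, by rw [c0, c1, c2], by rw [c0, c2, c3], ?_, ?_⟩
  · intro k hk
    rw [c0, c3]
    rcases eq_or_lt_of_le hk with hk | hk
    · have := (s4 k).2
      rw [if_pos (by linarith)] at this
      rw [← this]; simp
    · exact (s4 k).1 (by linarith)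
  · intro hne k hk
    rw [c1, c2]
    rcases eq_or_lt_of_le hk with hk | hk
    · have := (s5 k).2
      rw [if_pos (by linarith)] at this
      rw [← this, map_smul, Finsupp.smul_apply, (s3 k).2, if_neg, smul_zero]
      intro h
      exact hne (by linarith)
    · exact (s5 k).1 (by linarith)

theorem Degenerates.exists_adapted (h : Degenerates 𝕜 L L0 α) (h0 : IsCyclicExt 𝕜 L0 0 0 0) :
    ∃ (σ : Equiv.Perm (Fin 4)) (b c : Basis (Fin 4) 𝕜 L), α (σ 2) = α (σ 0) + α (σ 1) ∧
      α (σ 3) = 2 * α (σ 0) + α (σ 1) ∧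
      c 0 = b 0 ∧ c 1 = b 1 ∧ ⁅c 0, c 1⁆ = c 2 ∧ ⁅c 0, c 2⁆ = c 3 ∧
      (∀ k, 3 * α (σ 0) + α (σ 1) ≤ α (σ k) → b.repr ⁅c 0, c 3⁆ k = 0) ∧
      (α (σ 0) ≠ α (σ 1) → ∀ k, α (σ 0) + 2 * α (σ 1) ≤ α (σ k) → b.repr ⁅c 1, c 2⁆ k = 0) := by
  obtain ⟨b, b0, hb⟩ := h
  obtain ⟨i, j, t, c, c0, c1, c01, c02, c03, c12⟩ := exists_graded_gpair h0 b0
  have hij : i ≠ j := by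
    rintro rfl
    exact absurd (c.injective (c0.trans c1.symm)) (by decide)
  have hperm : ∀ i j : Fin 4, i ≠ j → ∃ σ : Equiv.Perm (Fin 4), σ 0 = i ∧ σ 1 = j := by decide
  obtain ⟨σ, hσ0, hσ1⟩ := hperm i j hij
  subst hσ0 hσ1
  rw [c0, c1] at c01
  rw [c0] at c02 c03
  rw [c1] at c12
  have hrepr : ∀ τ : Equiv.Perm (Fin 4), IsGradation (fun i => α (τ i)) (b.reindex τ.symm)
      (b0.reindex τ.symm) := by
    intro τ i j k
    simpa using hb (τ i) (τ j) (τ k)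
  -- The four vectors `c i` form a basis whose first two members are homogeneous basis vectors, so
  -- the complementary minor of `c 2`, `c 3` is nonzero.
  have hm : b0.repr (c 2) (σ 2) * b0.repr (c 3) (σ 3) -
      b0.repr (c 2) (σ 3) * b0.repr (c 3) (σ 2) ≠ 0 := by
    intro hm
    have expand : ∀ v, v = b0.repr v (σ 0) • c 0 + b0.repr v (σ 1) • c 1 +
        b0.repr v (σ 2) • b0 (σ 2) + b0.repr v (σ 3) • b0 (σ 3) := by
      intro v
      rw [c0, c1]
      have := (b0.reindex σ.symm).sum_repr v
      rw [Fin.sum_univ_four] at this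
      simpa using this.symm
    have h2 := expand (c 2)
    have h3 := expand (c 3)
    generalize b0.repr (c 2) (σ 0) = p0 at *
    generalize b0.repr (c 2) (σ 1) = p1 at *
    generalize b0.repr (c 2) (σ 2) = p2 at *
    generalize b0.repr (c 2) (σ 3) = p3 at *
    generalize b0.repr (c 3) (σ 0) = q0 at *
    generalize b0.repr (c 3) (σ 1) = q1 at *
    generalize b0.repr (c 3) (σ 2) = q2 at *
    generalize b0.repr (c 3) (σ 3) = q3 at *
    obtain ⟨-, -, -, hp3⟩ := coords_eq_zero c (p := q0 * p3 - p0 * q3) (q := q1 * p3 - p1 * q3)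
      (r := q3) (s := -p3)
      (by linear_combination (norm := module) q3 • h2 - p3 • h3 + hm • b0 (σ 2))
    obtain ⟨-, -, -, hp2⟩ := coords_eq_zero c (p := q0 * p2 - p0 * q2) (q := q1 * p2 - p1 * q2)
      (r := q2) (s := -p2)
      (by linear_combination (norm := module) q2 • h2 - p2 • h3 - hm • b0 (σ 3))
    obtain ⟨-, -, h1, -⟩ := coords_eq_zero c (p := -p0) (q := -p1) (r := 1) (s := 0) (by
      rw [neg_eq_zero.mp hp2, neg_eq_zero.mp hp3] at h2
      linear_combination (norm := module) h2)
    exact one_ne_zero h1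
  by_cases hcase : b0.repr (c 2) (σ 2) ≠ 0 ∧ b0.repr (c 3) (σ 3) ≠ 0
  · obtain ⟨d, hd⟩ := exists_adapted_of_minor (α := fun i => α (σ i)) (hrepr σ) (t := t)
      (z0 := c 2) (w0 := c 3) (by simpa using c01) (by simpa using c02) (by simpa using c03)
      (by simpa using c12) (by simpa using hm) (by simpa using hcase.1) (by simpa using hcase.2)
    exact ⟨σ, _, d, hd⟩
  · have hcase' : b0.repr (c 2) (σ 3) ≠ 0 ∧ b0.repr (c 3) (σ 2) ≠ 0 := by
      constructor <;> intro h0 <;> rw [h0] at hm <;> apply hcase <;> constructor <;> intro h1 <;>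
        rw [h1] at hm <;> simp at hm
    obtain ⟨τ, t0, t1, t2, t3⟩ : ∃ τ : Equiv.Perm (Fin 4), τ 0 = σ 0 ∧ τ 1 = σ 1 ∧ τ 2 = σ 3 ∧
        τ 3 = σ 2 := ⟨Equiv.trans (Equiv.swap 2 3) σ, by
      refine ⟨congrArg σ ?_, congrArg σ ?_, congrArg σ ?_, congrArg σ ?_⟩ <;> decide⟩
    obtain ⟨d, hd⟩ := exists_adapted_of_minor (α := fun i => α (τ i)) (hrepr τ) (t := t)
      (z0 := c 2) (w0 := c 3) (by simpa [t0, t1] using c01) (by simpa [t0] using c02)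
      (by simpa [t0] using c03) (by simpa [t1] using c12)
      (by
        simp only [Basis.repr_reindex, Finsupp.mapDomain_equiv_apply, Equiv.symm_symm, t2, t3]
        exact fun h => hm (by linear_combination -h))
      (by simpa [t2] using hcase'.1) (by simpa [t3] using hcase'.2)
    exact ⟨_, _, d, hd⟩

/-- The weights of a degeneration to the nilpotent Lie algebra of maximal class. -/
theorem Degenerates.generator_or (h : Degenerates 𝕜 L L0 α) (h0 : IsCyclicExt 𝕜 L0 0 0 0)
    (hα : ∀ i, 0 ≤ α i) : HasNilpotentGenerator 𝕜 L ∨ HasEngelGenerator 𝕜 L ∨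
      ∃ σ : Equiv.Perm (Fin 4), 0 < α (σ 0) ∧ 0 < α (σ 1) ∧ α (σ 2) = α (σ 0) + α (σ 1) ∧
      α (σ 3) = 2 * α (σ 0) + α (σ 1) := by
  obtain ⟨σ, b, c, e2, e3, c0, c1, c01, c02, h03, h12⟩ := h.exists_adapted h0
  have hn := hα (σ 1)
  rcases (hα (σ 0)).eq_or_lt with hm | hm
  -- With the first weight zero the other three are equal, and `⁅c 0, c 3⁆` keeps only its component
  -- along `c 0`.
  · refine Or.inl ⟨c, b.repr ⁅c 0, c 3⁆ 0, c01, c02, ?_⟩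
    rw [← hm] at e2 e3 h03
    refine (b.sum_repr _).symm.trans ?_
    rw [Fin.sum_univ_four, h03 1 (by linarith), h03 2 (by linarith), h03 3 (by linarith), c0]
    simp
  rcases hn.eq_or_lt with hn | hn
  -- The weights are now `m`, 0, `m`, `2 * m` with `m > 0`, and `⁅c 1, c 2⁆` keeps only its
  -- component along `c 1`.
  · refine Or.inr (Or.inl ⟨c, b.repr ⁅c 1, c 2⁆ 1, c01, c02, ?_⟩)
    rw [← hn] at e2 e3 h12
    replace h12 := h12 hm.ne'
    refine (b.sum_repr _).symm.trans ?_
    rw [Fin.sum_univ_four, h12 0 (by linarith), h12 2 (by linarith), h12 3 (by linarith), c1]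
    simp
  · exact Or.inr (Or.inr ⟨σ, hm, hn, e2, e3⟩)

end NilpotentTarget

/-! ### Invertible matrices as bases -/

section Matrices

variable {𝕜 : Type*} [RCLike 𝕜] {n : ℕ}

theorem exists_basis_of_isUnit (S : LieStructure 𝕜 n) {M : Matrix (Fin n) (Fin n) 𝕜}
    (hM : IsUnit M) : ∃ b : Basis (Fin n) 𝕜 S.Alg, ∀ (v : S.Alg) k,
      b.repr v k = M.mulVec v k := by
  have hdet : IsUnit M.det := (Matrix.isUnit_iff_isUnit_det M).mp hM
  have h1 : ∀ v : Fin n → 𝕜, M⁻¹.mulVec (M.mulVec v) = v := fun v => by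
    rw [Matrix.mulVec_mulVec, Matrix.nonsing_inv_mul _ hdet, Matrix.one_mulVec]
  have h2 : ∀ v : Fin n → 𝕜, M.mulVec (M⁻¹.mulVec v) = v := fun v => by
    rw [Matrix.mulVec_mulVec, Matrix.mul_nonsing_inv _ hdet, Matrix.one_mulVec]
  let e : S.Alg ≃ₗ[𝕜] (Fin n → 𝕜) :=
    { toFun := fun v => M.mulVec v
      map_add' := fun u v => Matrix.mulVec_add M u v
      map_smul' := fun r v => Matrix.mulVec_smul M r v
      invFun := fun v => M⁻¹.mulVec v
      left_inv := h1
      right_inv := h2 }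
  exact ⟨Basis.ofEquivFun e, fun v k => rfl⟩

theorem exists_isUnit_of_basis {S : LieStructure 𝕜 n} (b : Basis (Fin n) 𝕜 S.Alg) :
    ∃ M : Matrix (Fin n) (Fin n) 𝕜, IsUnit M ∧ ∀ (v : S.Alg) k, b.repr v k = M.mulVec v k := by
  let e : (Fin n → 𝕜) ≃ₗ[𝕜] (Fin n → 𝕜) := b.equivFun
  refine ⟨LinearMap.toMatrix' e.toLinearMap, ?_, fun v k => ?_⟩
  · refine IsUnit.of_mul_eq_one (LinearMap.toMatrix' e.symm.toLinearMap) ?_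
    rw [← LinearMap.toMatrix'_comp, LinearEquiv.comp_coe, LinearEquiv.symm_trans_self,
      LinearEquiv.refl_toLinearMap, LinearMap.toMatrix'_id]
  · have h : ∀ w : Fin n → 𝕜, e w k = (LinearMap.toMatrix' e.toLinearMap).mulVec w k := fun w => by
      rw [LinearMap.toMatrix'_mulVec]; rfl
    exact h v

end Matrices

/-! ### Contractions and filtrations are the same data -/

section Bridge

variable {𝕜 : Type*} [RCLike 𝕜] {S T : LieStructure 𝕜 4} {A P : Matrix (Fin 4) (Fin 4) 𝕜}
  {b : Basis (Fin 4) 𝕜 S.Alg} {b0 : Basis (Fin 4) 𝕜 T.Alg} {α : Fin 4 → ℝ}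

theorem isUnit_diagonal_rpow (α : Fin 4 → ℝ) {ε : ℝ} (hε : 0 < ε) :
    IsUnit (Matrix.diagonal fun i => ((ε ^ α i : ℝ) : 𝕜)) := by
  rw [Matrix.isUnit_diagonal, Pi.isUnit_iff]
  intro i
  rw [isUnit_iff_ne_zero]
  exact_mod_cast (Real.rpow_pos_of_pos hε _).ne'

/-- The coordinates of the bracket transported by the matrix `A diag(ε ^ α) P`. -/
theorem repr_transported_bracket (hA : IsUnit A) (hP : IsUnit P)
    (hb : ∀ v k, b.repr v k = A⁻¹.mulVec v k) {ε : ℝ} (hε : 0 < ε) {U : Matrix (Fin 4) (Fin 4) 𝕜}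
    (hU : U = A * Matrix.diagonal (fun i => ((ε ^ α i : ℝ) : 𝕜)) * P) (x y : Fin 4 → 𝕜)
    (k : Fin 4) :
    P.mulVec (U⁻¹.mulVec (S.bracket (U.mulVec x) (U.mulVec y))) k =
      ∑ i, ∑ j, P.mulVec x i * P.mulVec y j *
        (((ε ^ (α i + α j - α k) : ℝ) : 𝕜) * b.repr ⁅b i, b j⁆ k) := by
  have hAd : IsUnit A.det := (Matrix.isUnit_iff_isUnit_det A).mp hA
  have hUd : IsUnit U.det := by
    rw [← Matrix.isUnit_iff_isUnit_det, hU]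
    exact (hA.mul (isUnit_diagonal_rpow α hε)).mul hP
  have hcoord : ∀ (v : Fin 4 → 𝕜) i, A⁻¹.mulVec (U.mulVec v) i =
      ((ε ^ α i : ℝ) : 𝕜) * P.mulVec v i := by
    intro v i
    rw [hU, Matrix.mul_assoc, ← Matrix.mulVec_mulVec, Matrix.mulVec_mulVec (M := A⁻¹),
      Matrix.nonsing_inv_mul _ hAd, Matrix.one_mulVec, ← Matrix.mulVec_mulVec,
      Matrix.mulVec_diagonal]
  have hne : ((ε ^ α k : ℝ) : 𝕜) ≠ 0 := by exact_mod_cast (Real.rpow_pos_of_pos hε _).ne'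
  have h1 := hcoord (U⁻¹.mulVec (S.bracket (U.mulVec x) (U.mulVec y))) k
  rw [Matrix.mulVec_mulVec (M := U), Matrix.mul_nonsing_inv _ hUd, Matrix.one_mulVec] at h1
  have h2 : A⁻¹.mulVec (S.bracket (U.mulVec x) (U.mulVec y)) k =
      ∑ i, ∑ j, (((ε ^ α i : ℝ) : 𝕜) * P.mulVec x i) * (((ε ^ α j : ℝ) : 𝕜) * P.mulVec y j) *
        b.repr ⁅b i, b j⁆ k := by
    refine (hb _ k).symm.trans ((repr_lie_eq_sum b (U.mulVec x) (U.mulVec y) k).trans ?_)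
    refine Finset.sum_congr rfl fun i _ => Finset.sum_congr rfl fun j _ => ?_
    exact congrArg₂ (fun s t => s * t * b.repr ⁅b i, b j⁆ k) ((hb _ i).trans (hcoord x i))
      ((hb _ j).trans (hcoord y j))
  rw [h2] at h1
  apply mul_left_cancel₀ hne
  rw [← h1, Finset.mul_sum]
  refine Finset.sum_congr rfl fun i _ => ?_
  rw [Finset.mul_sum]
  refine Finset.sum_congr rfl fun j _ => ?_
  have h4 : (ε ^ α i : ℝ) * ε ^ α j = ε ^ α k * ε ^ (α i + α j - α k) := by
    rw [← Real.rpow_add hε, ← Real.rpow_add hε]; congr 1; ring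
  have h5 : ((ε ^ α i : ℝ) : 𝕜) * ((ε ^ α j : ℝ) : 𝕜) =
      ((ε ^ α k : ℝ) : 𝕜) * ((ε ^ (α i + α j - α k) : ℝ) : 𝕜) := by exact_mod_cast h4
  linear_combination (P.mulVec x i * P.mulVec y j * b.repr ⁅b i, b j⁆ k) * h5

theorem tendsto_rpow_mul {s : ℝ} {c l : 𝕜} (h : (s < 0 → c = 0) ∧ l = if s = 0 then c else 0) :
    Tendsto (fun ε : ℝ => ((ε ^ s : ℝ) : 𝕜) * c) (𝓝[>] 0) (𝓝 l) := by
  obtain ⟨h1, rfl⟩ := h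
  rcases lt_trichotomy s 0 with hs | rfl | hs
  · simp [h1 hs]
  · simp
  · rw [if_neg hs.ne']
    have h5 := (Real.continuousAt_rpow_const 0 s (Or.inr hs.le)).tendsto
    rw [Real.zero_rpow hs.ne'] at h5
    have h6 := ((RCLike.continuous_ofReal (K := 𝕜)).tendsto 0).comp
      (h5.mono_left (nhdsWithin_le_nhds (s := Ioi 0)))
    simpa using h6.mul_const c

/-- A monomial with negative exponent is unbounded near zero unless its coefficient vanishes. -/
theorem of_tendsto_rpow_mul {s : ℝ} {c l : 𝕜}
    (h : Tendsto (fun ε : ℝ => ((ε ^ s : ℝ) : 𝕜) * c) (𝓝[>] 0) (𝓝 l)) :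
    (s < 0 → c = 0) ∧ l = if s = 0 then c else 0 := by
  by_cases hs : s < 0
  · have hc : c = 0 := by
      have h1 : Tendsto (fun ε : ℝ => ((ε ^ (-s) : ℝ) : 𝕜) * 1) (𝓝[>] 0) (𝓝 0) :=
        tendsto_rpow_mul ⟨fun h => absurd h (by linarith), by rw [if_neg (by linarith)]⟩
      have h2 := h1.mul h
      have h3 : Tendsto (fun _ : ℝ => c) (𝓝[>] 0) (𝓝 (0 * l)) := by
        refine h2.congr' ?_
        filter_upwards [self_mem_nhdsWithin] with ε hε
        have hε : 0 < ε := hε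
        have h4 : ((ε ^ (-s) : ℝ) : 𝕜) * ((ε ^ s : ℝ) : 𝕜) = 1 := by
          rw [← RCLike.ofReal_mul, ← Real.rpow_add hε]; simp
        linear_combination c * h4
      simpa using tendsto_nhds_unique tendsto_const_nhds h3
    refine ⟨fun _ => hc, ?_⟩
    rw [if_neg hs.ne]
    refine tendsto_nhds_unique h ?_
    simp [hc]
  · exact ⟨fun h => absurd h hs, tendsto_nhds_unique h
      (tendsto_rpow_mul ⟨fun h => absurd h hs, rfl⟩)⟩

theorem exists_contraction (hA : IsUnit A) (hP : IsUnit P)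
    (hb : ∀ v k, b.repr v k = A⁻¹.mulVec v k) (hb0 : ∀ v k, b0.repr v k = P.mulVec v k)
    (h : IsGradation α b b0) : ∃ C : Contraction 𝕜 4, C.source = S ∧ C.target = T ∧
      ∀ ε ∈ Ioc (0 : ℝ) 1, C.U ε =
        A * Matrix.diagonal (fun i => ((ε ^ α i : ℝ) : 𝕜)) * P := by
  let U : ℝ → Matrix (Fin 4) (Fin 4) 𝕜 := fun ε =>
    A * Matrix.diagonal (fun i => ((ε ^ α i : ℝ) : 𝕜)) * P
  have hPd : IsUnit P.det := (Matrix.isUnit_iff_isUnit_det P).mp hP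
  have hcont : ContinuousOn U (Ioc 0 1) := by
    have h1 : ContinuousOn (fun ε : ℝ => fun i => ((ε ^ α i : ℝ) : 𝕜)) (Ioc 0 1) := by
      refine continuousOn_pi.mpr fun i => ?_
      refine RCLike.continuous_ofReal.comp_continuousOn ?_
      exact fun ε hε => (Real.continuousAt_rpow_const ε _ (Or.inl hε.1.ne')).continuousWithinAt
    have h2 : Continuous fun v : Fin 4 → 𝕜 => A * Matrix.diagonal v * P := by fun_prop
    exact h2.comp_continuousOn h1
  refine ⟨⟨S, T, U, hcont, fun ε hε => (hA.mul (isUnit_diagonal_rpow α hε.1)).mul hP, ?_⟩, rfl,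
    rfl, fun ε _ => rfl⟩
  intro x y
  have h1 : Tendsto (fun ε => P.mulVec ((U ε)⁻¹.mulVec
      (S.bracket ((U ε).mulVec x) ((U ε).mulVec y)))) (𝓝[>] 0) (𝓝 (P.mulVec (T.bracket x y))) := by
    refine tendsto_pi_nhds.mpr fun k => ?_
    have h2 : P.mulVec (T.bracket x y) k = ∑ i, ∑ j, P.mulVec x i * P.mulVec y j *
        b0.repr ⁅b0 i, b0 j⁆ k := by
      refine (hb0 _ k).symm.trans ((repr_lie_eq_sum b0 x y k).trans ?_)
      refine Finset.sum_congr rfl fun i _ => Finset.sum_congr rfl fun j _ => ?_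
      exact congrArg₂ (fun s t => s * t * b0.repr ⁅b0 i, b0 j⁆ k) (hb0 x i) (hb0 y j)
    rw [h2]
    refine Tendsto.congr' (f₁ := fun ε : ℝ => ∑ i, ∑ j, P.mulVec x i * P.mulVec y j *
        (((ε ^ (α i + α j - α k) : ℝ) : 𝕜) * b.repr ⁅b i, b j⁆ k)) ?_ ?_
    · filter_upwards [self_mem_nhdsWithin] with ε hε
      exact (repr_transported_bracket hA hP hb hε rfl x y k).symm
    · refine tendsto_finsetSum _ fun i _ => tendsto_finsetSum _ fun j _ =>
        (tendsto_rpow_mul ?_).const_mul _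
      obtain ⟨h4, h5⟩ := h i j k
      exact ⟨fun h => h4 (by linarith), by rw [h5]; simp only [sub_eq_zero]⟩
  have h2 : Continuous fun v : Fin 4 → 𝕜 => P⁻¹.mulVec v := by fun_prop
  have h3 := (h2.tendsto _).comp h1
  simpa only [Function.comp_def, Matrix.mulVec_mulVec, Matrix.nonsing_inv_mul_cancel_left _ _ hPd,
    Matrix.nonsing_inv_mul _ hPd, Matrix.one_mulVec] using h3

theorem HasSignature.degenerates {C : Contraction 𝕜 4} (h : C.HasSignature α) :
    Degenerates 𝕜 C.source.Alg C.target.Alg α := by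
  obtain ⟨A, P, hA, hP, hU⟩ := h
  have hA' : IsUnit A⁻¹ := by
    rw [Matrix.isUnit_iff_isUnit_det] at *
    exact Matrix.isUnit_nonsing_inv_det A hA
  obtain ⟨b, hb⟩ := exists_basis_of_isUnit C.source hA'
  obtain ⟨b0, hb0⟩ := exists_basis_of_isUnit C.target hP
  refine ⟨b, b0, fun i j k => ?_⟩
  have h1 := C.tendsto_bracket (b0 i) (b0 j)
  have h2 : Continuous fun v : Fin 4 → 𝕜 => P.mulVec v k :=
    (continuous_apply k).comp (by fun_prop : Continuous fun v : Fin 4 → 𝕜 => P.mulVec v)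
  have h3 : Tendsto (fun ε : ℝ => ((ε ^ (α i + α j - α k) : ℝ) : 𝕜) * b.repr ⁅b i, b j⁆ k)
      (𝓝[>] 0) (𝓝 (b0.repr ⁅b0 i, b0 j⁆ k)) := by
    rw [hb0]
    refine ((h2.tendsto _).comp h1).congr' ?_
    filter_upwards [Ioc_mem_nhdsGT (zero_lt_one (α := ℝ))] with ε hε
    rw [Function.comp_apply,
      repr_transported_bracket hA hP hb hε.1 (hU ε hε) (b0 i) (b0 j) k]
    simp only [← hb0, Basis.repr_self]
    rw [Finset.sum_eq_single i, Finset.sum_eq_single j]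
    · simp
    · intro j' _ hj
      simp [hj.symm]
    · simp
    · intro i' _ hi
      simp [Finsupp.single_apply, hi.symm]
    · simp
  obtain ⟨h4, h5⟩ := of_tendsto_rpow_mul h3
  exact ⟨fun h => h4 (by linarith), by rw [h5]; simp only [sub_eq_zero]⟩

theorem Degenerates.exists_contraction (h : Degenerates 𝕜 S.Alg T.Alg α) :
    ∃ C : Contraction 𝕜 4, C.source = S ∧ C.target = T ∧ C.HasSignature α := by
  obtain ⟨b, b0, hbb⟩ := h
  obtain ⟨M, hM, hb⟩ := exists_isUnit_of_basis b
  obtain ⟨P, hP, hb0⟩ := exists_isUnit_of_basis b0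
  have hMd := (Matrix.isUnit_iff_isUnit_det M).mp hM
  have hM' : IsUnit M⁻¹ := (Matrix.isUnit_iff_isUnit_det _).mpr (Matrix.isUnit_nonsing_inv_det M hMd)
  obtain ⟨C, hS, hT, hU⟩ := LieDegeneration.exists_contraction hM' hP
    (by rwa [Matrix.nonsing_inv_nonsing_inv _ hMd]) hb0 hbb
  exact ⟨C, hS, hT, _, _, hM', hP, hU⟩

theorem realizableWith_iff {C : Contraction 𝕜 4} :
    C.RealizableWith α ↔ Degenerates 𝕜 C.source.Alg C.target.Alg α := by
  constructor
  · rintro ⟨C', ⟨⟨e⟩, ⟨e0⟩⟩, h⟩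
    exact (HasSignature.degenerates h).congr e.symm e0.symm
  · intro h
    obtain ⟨C', hS, hT, h⟩ := h.exists_contraction
    refine ⟨C', ⟨?_, ?_⟩, h⟩
    · rw [hS]; exact ⟨LieEquiv.refl⟩
    · rw [hT]; exact ⟨LieEquiv.refl⟩

end Bridge

/-! ### Invariance under isomorphism -/

section Transport

variable {K L L' : Type*} [Field K] [LieRing L] [LieAlgebra K L] [LieRing L'] [LieAlgebra K L']

theorem IsCyclicExt.congr {c d e : K} (h : IsCyclicExt K L c d e) (f : L ≃ₗ⁅K⁆ L') :
    IsCyclicExt K L' c d e := by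
  obtain ⟨b, hb⟩ := h
  refine ⟨b.map f.toLinearEquiv, ?_, ?_, ?_, ?_, ?_, ?_⟩ <;>
    simp [← LieEquiv.map_lie, hb.h01, hb.h02, hb.h03, hb.h12, hb.h13, hb.h23]

theorem IsQuadraticAffine.congr {d : K} (h : IsQuadraticAffine K L d) (f : L ≃ₗ⁅K⁆ L') :
    IsQuadraticAffine K L' d := by
  obtain ⟨b, hb⟩ := h
  refine ⟨b.map f.toLinearEquiv, ?_, ?_, ?_, ?_, ?_, ?_⟩ <;>
    simp [← LieEquiv.map_lie, hb.h01, hb.h02, hb.h03, hb.h12, hb.h13, hb.h23]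

theorem IsReductive.congr {d e : K} (h : IsReductive K L d e) (f : L ≃ₗ⁅K⁆ L') :
    IsReductive K L' d e := by
  obtain ⟨b, hb⟩ := h
  refine ⟨b.map f.toLinearEquiv, ?_, ?_, ?_, ?_, ?_, ?_⟩ <;>
    simp [← LieEquiv.map_lie, hb.h01, hb.h02, hb.h03, hb.h12, hb.h13, hb.h23]

theorem IsQuadraticAffine.exists_gpair {d : K} (h : IsQuadraticAffine K L d) :
    ∃ x y : L, GPair K x y := by
  obtain ⟨b, hb⟩ := h
  exact ⟨b 0, b 1, b, rfl, rfl, by rw [hb.h01], by rw [hb.h01, hb.h02]⟩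

/-- The central vector is added to the second generator because `b 0` and `b 1` alone stay in the
simple ideal. -/
theorem IsReductive.exists_gpair {d f : K} (hd : d ≠ 0) (h : IsReductive K L d f) :
    ∃ x y : L, GPair K x y := by
  obtain ⟨b, hb⟩ := h
  exact ⟨_, _, gpair_of_det4 b (x := b 0) (y := b 1 + b 3) (z := b 2) (w := d • b 1)
    (u := ![1, 0, 0, 0]) (v := ![0, 1, 0, 1]) (t := ![0, 0, 1, 0]) (s := ![0, d, 0, 0])
    (by simp) (by simp) (by simp) (by simp) (by rw [det_four]; simpa using hd)
    (by rw [lie_add, hb.h01, hb.h03, add_zero]) hb.h02⟩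

end Transport

/-! ### The four named algebras in normal form -/

section Tables

variable {𝕜 : Type*} [RCLike 𝕜]

theorem exists_standard_basis {n : ℕ} (S : LieStructure 𝕜 n) : ∃ e : Basis (Fin n) 𝕜 S.Alg,
    (∀ (v : S.Alg) k, e.repr v k = v k) ∧ ∀ i j k, e.repr ⁅e i, e j⁆ k = S.c i j k := by
  obtain ⟨e, he⟩ := exists_basis_of_isUnit S isUnit_one
  have he' : ∀ (v : S.Alg) k, e.repr v k = v k := fun v k =>
    (he v k).trans (congrFun (Matrix.one_mulVec (v : Fin n → 𝕜)) k)
  refine ⟨e, he', fun i j k => ?_⟩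
  have h1 : ∀ i k, e i k = if i = k then (1 : 𝕜) else 0 := fun i k =>
    (he' (e i) k).symm.trans (by rw [Basis.repr_self, Finsupp.single_apply])
  refine (he' _ k).trans ?_
  calc (⁅e i, e j⁆ : S.Alg) k = ∑ a, ∑ b, e i a * e j b * S.c a b k := rfl
    _ = ∑ a, ∑ b, (if i = a then (1 : 𝕜) else 0) * (if j = b then (1 : 𝕜) else 0) * S.c a b k :=
        Finset.sum_congr rfl fun a _ => Finset.sum_congr rfl fun b _ => by
          congr 2
          · exact h1 i a
          · exact h1 j b
    _ = S.c i j k := by simp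

theorem lie_eq_of_consts {S : LieStructure 𝕜 4} {e : Basis (Fin 4) 𝕜 S.Alg}
    (hc : ∀ i j k, e.repr ⁅e i, e j⁆ k = S.c i j k) (i j : Fin 4) (v : Fin 4 → 𝕜)
    (h : ∀ k, S.c i j k = v k) :
    ⁅e i, e j⁆ = v 0 • e 0 + v 1 • e 1 + v 2 • e 2 + v 3 • e 3 := by
  rw [← Fin.sum_univ_four (fun k => v k • e k), ← e.sum_repr ⁅e i, e j⁆]
  exact Finset.sum_congr rfl fun k _ => by rw [hc, h]

theorem finrank_alg (S : LieStructure 𝕜 4) : finrank 𝕜 S.Alg = 4 := by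
  obtain ⟨e, -⟩ := exists_standard_basis S
  simpa using finrank_eq_card_basis e

theorem exists_brackets_twoA21 : ∃ e : Basis (Fin 4) 𝕜 (twoA21 𝕜).Alg,
    (∀ v k, e.repr v k = v k) ∧ Brackets e (e 0) 0 0 0 0 (e 2) := by
  obtain ⟨e, he, hc⟩ := exists_standard_basis (twoA21 𝕜)
  exact ⟨e, he, 
    (lie_eq_of_consts hc 0 1 ![1, 0, 0, 0] (by
      intro k; fin_cases k <;> simp [twoA21, LieStructure.ofInt, tableConst])).trans (by simp),
    (lie_eq_of_consts hc 0 2 ![0, 0, 0, 0] (by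
      intro k; fin_cases k <;> simp [twoA21, LieStructure.ofInt, tableConst])).trans (by simp),
    (lie_eq_of_consts hc 0 3 ![0, 0, 0, 0] (by
      intro k; fin_cases k <;> simp [twoA21, LieStructure.ofInt, tableConst])).trans (by simp),
    (lie_eq_of_consts hc 1 2 ![0, 0, 0, 0] (by
      intro k; fin_cases k <;> simp [twoA21, LieStructure.ofInt, tableConst])).trans (by simp),
    (lie_eq_of_consts hc 1 3 ![0, 0, 0, 0] (by
      intro k; fin_cases k <;> simp [twoA21, LieStructure.ofInt, tableConst])).trans (by simp),
    (lie_eq_of_consts hc 2 3 ![0, 0, 1, 0] (by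
      intro k; fin_cases k <;> simp [twoA21, LieStructure.ofInt, tableConst])).trans (by simp)⟩

theorem exists_brackets_A41 : ∃ e : Basis (Fin 4) 𝕜 (A41 𝕜).Alg,
    (∀ v k, e.repr v k = v k) ∧ Brackets e 0 0 0 0 (e 0) (e 1) := by
  obtain ⟨e, he, hc⟩ := exists_standard_basis (A41 𝕜)
  exact ⟨e, he, 
    (lie_eq_of_consts hc 0 1 ![0, 0, 0, 0] (by
      intro k; fin_cases k <;> simp [A41, LieStructure.ofInt, tableConst])).trans (by simp),
    (lie_eq_of_consts hc 0 2 ![0, 0, 0, 0] (by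
      intro k; fin_cases k <;> simp [A41, LieStructure.ofInt, tableConst])).trans (by simp),
    (lie_eq_of_consts hc 0 3 ![0, 0, 0, 0] (by
      intro k; fin_cases k <;> simp [A41, LieStructure.ofInt, tableConst])).trans (by simp),
    (lie_eq_of_consts hc 1 2 ![0, 0, 0, 0] (by
      intro k; fin_cases k <;> simp [A41, LieStructure.ofInt, tableConst])).trans (by simp),
    (lie_eq_of_consts hc 1 3 ![1, 0, 0, 0] (by
      intro k; fin_cases k <;> simp [A41, LieStructure.ofInt, tableConst])).trans (by simp),
    (lie_eq_of_consts hc 2 3 ![0, 1, 0, 0] (by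
      intro k; fin_cases k <;> simp [A41, LieStructure.ofInt, tableConst])).trans (by simp)⟩

theorem exists_brackets_A410 : ∃ e : Basis (Fin 4) ℝ A410.Alg,
    Brackets e 0 (e 0) (-e 1) (e 1) (e 0) 0 := by
  obtain ⟨e, he, hc⟩ := exists_standard_basis A410
  exact ⟨e, 
    (lie_eq_of_consts hc 0 1 ![0, 0, 0, 0] (by
      intro k; fin_cases k <;> simp [A410, LieStructure.ofInt, tableConst])).trans (by simp),
    (lie_eq_of_consts hc 0 2 ![1, 0, 0, 0] (by
      intro k; fin_cases k <;> simp [A410, LieStructure.ofInt, tableConst])).trans (by simp),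
    (lie_eq_of_consts hc 0 3 ![0, -1, 0, 0] (by
      intro k; fin_cases k <;> simp [A410, LieStructure.ofInt, tableConst])).trans (by simp),
    (lie_eq_of_consts hc 1 2 ![0, 1, 0, 0] (by
      intro k; fin_cases k <;> simp [A410, LieStructure.ofInt, tableConst])).trans (by simp),
    (lie_eq_of_consts hc 1 3 ![1, 0, 0, 0] (by
      intro k; fin_cases k <;> simp [A410, LieStructure.ofInt, tableConst])).trans (by simp),
    (lie_eq_of_consts hc 2 3 ![0, 0, 0, 0] (by
      intro k; fin_cases k <;> simp [A410, LieStructure.ofInt, tableConst])).trans (by simp)⟩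

theorem exists_brackets_so3A1 : ∃ e : Basis (Fin 4) ℝ so3A1.Alg,
    Brackets e (e 2) (-e 1) 0 (e 0) 0 0 := by
  obtain ⟨e, he, hc⟩ := exists_standard_basis so3A1
  exact ⟨e, 
    (lie_eq_of_consts hc 0 1 ![0, 0, 1, 0] (by
      intro k; fin_cases k <;> simp [so3A1, LieStructure.ofInt, tableConst])).trans (by simp),
    (lie_eq_of_consts hc 0 2 ![0, -1, 0, 0] (by
      intro k; fin_cases k <;> simp [so3A1, LieStructure.ofInt, tableConst])).trans (by simp),
    (lie_eq_of_consts hc 0 3 ![0, 0, 0, 0] (by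
      intro k; fin_cases k <;> simp [so3A1, LieStructure.ofInt, tableConst])).trans (by simp),
    (lie_eq_of_consts hc 1 2 ![1, 0, 0, 0] (by
      intro k; fin_cases k <;> simp [so3A1, LieStructure.ofInt, tableConst])).trans (by simp),
    (lie_eq_of_consts hc 1 3 ![0, 0, 0, 0] (by
      intro k; fin_cases k <;> simp [so3A1, LieStructure.ofInt, tableConst])).trans (by simp),
    (lie_eq_of_consts hc 2 3 ![0, 0, 0, 0] (by
      intro k; fin_cases k <;> simp [so3A1, LieStructure.ofInt, tableConst])).trans (by simp)⟩

/-- On the plane of `e 0`, `e 2` the vector `-(e 1 + e 3)` acts as 1 and `e 3 - e 1` as a square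
root of 1; the extra terms make their bracket equal to the third basis vector. -/
theorem isQuadraticAffine_twoA21 : IsQuadraticAffine 𝕜 (twoA21 𝕜).Alg 1 := by
  obtain ⟨e, -, he⟩ := exists_brackets_twoA21 (𝕜 := 𝕜)
  obtain ⟨b, b0, b1, b2, b3⟩ := exists_basis_of_det4 e (x := e 3 - e 1 - e 0 + e 2)
    (y := -(e 1 + e 3)) (z := e 0 - e 2) (w := e 0 + e 2) (u := ![-1, -1, 1, 1])
    (v := ![0, -1, 0, -1]) (t := ![1, 0, -1, 0]) (s := ![1, 0, 1, 0]) (by simp; module)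
    (by simp; module) (by simp; module) (by simp) (by rw [det_four]; simp; norm_num)
  have h10 : ⁅e 1, e 0⁆ = -e 0 := by rw [← lie_skew, he.h01]
  have h20 : ⁅e 2, e 0⁆ = 0 := by rw [← lie_skew, he.h02, neg_zero]
  have h30 : ⁅e 3, e 0⁆ = 0 := by rw [← lie_skew, he.h03, neg_zero]
  have h21 : ⁅e 2, e 1⁆ = 0 := by rw [← lie_skew, he.h12, neg_zero]
  have h31 : ⁅e 3, e 1⁆ = 0 := by rw [← lie_skew, he.h13, neg_zero]
  have h32 : ⁅e 3, e 2⁆ = -e 2 := by rw [← lie_skew, he.h23]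
  refine ⟨b, ?_, ?_, ?_, ?_, ?_, ?_⟩ <;>
    simp only [b0, b1, b2, b3, lie_add, lie_sub, add_lie, sub_lie, lie_neg, neg_lie, lie_self,
      he.h01, he.h02, he.h03, he.h12, he.h13, he.h23, h10, h20, h30, h21, h31, h32] <;> module

theorem isCyclicExt_A41 : IsCyclicExt 𝕜 (A41 𝕜).Alg 0 0 0 := by
  obtain ⟨e, -, he⟩ := exists_brackets_A41 (𝕜 := 𝕜)
  obtain ⟨b, b0, b1, b2, b3⟩ := exists_basis_of_det4 e (x := e 3)
    (y := e 2) (z := -e 1) (w := e 0) (u := ![0, 0, 0, 1])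
    (v := ![0, 0, 1, 0]) (t := ![0, -1, 0, 0]) (s := ![1, 0, 0, 0]) (by simp)
    (by simp) (by simp) (by simp) (by rw [det_four]; simp)
  have h10 : ⁅e 1, e 0⁆ = 0 := by rw [← lie_skew, he.h01, neg_zero]
  have h20 : ⁅e 2, e 0⁆ = 0 := by rw [← lie_skew, he.h02, neg_zero]
  have h30 : ⁅e 3, e 0⁆ = 0 := by rw [← lie_skew, he.h03, neg_zero]
  have h21 : ⁅e 2, e 1⁆ = 0 := by rw [← lie_skew, he.h12, neg_zero]
  have h31 : ⁅e 3, e 1⁆ = -e 0 := by rw [← lie_skew, he.h13]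
  have h32 : ⁅e 3, e 2⁆ = -e 1 := by rw [← lie_skew, he.h23]
  refine ⟨b, ?_, ?_, ?_, ?_, ?_, ?_⟩ <;>
    simp only [b0, b1, b2, b3, lie_neg, neg_lie, h10, h20, h30, h21, h31, h32] <;> module

theorem isQuadraticAffine_A410 : IsQuadraticAffine ℝ A410.Alg (-1) := by
  obtain ⟨e, he⟩ := exists_brackets_A410
  obtain ⟨b, b0, b1, b2, b3⟩ := exists_basis_of_det4 e (x := e 3 - e 0)
    (y := -e 2) (z := e 0) (w := e 1) (u := ![-1, 0, 0, 1])
    (v := ![0, 0, -1, 0]) (t := ![1, 0, 0, 0]) (s := ![0, 1, 0, 0]) (by simp; module)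
    (by simp) (by simp) (by simp) (by rw [det_four]; simp)
  have h10 : ⁅e 1, e 0⁆ = 0 := by rw [← lie_skew, he.h01, neg_zero]
  have h20 : ⁅e 2, e 0⁆ = -e 0 := by rw [← lie_skew, he.h02]
  have h30 : ⁅e 3, e 0⁆ = e 1 := by rw [← lie_skew, he.h03, neg_neg]
  have h21 : ⁅e 2, e 1⁆ = -e 1 := by rw [← lie_skew, he.h12]
  have h31 : ⁅e 3, e 1⁆ = -e 0 := by rw [← lie_skew, he.h13]
  have h32 : ⁅e 3, e 2⁆ = 0 := by rw [← lie_skew, he.h23, neg_zero]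
  refine ⟨b, ?_, ?_, ?_, ?_, ?_, ?_⟩ <;>
    simp only [b0, b1, b2, b3, sub_lie, lie_neg, neg_lie, lie_self, he.h01, he.h02, h20, h30,
      h21, h31, h32] <;> module

theorem isReductive_so3A1 : IsReductive ℝ so3A1.Alg (-1) 1 := by
  obtain ⟨e, he⟩ := exists_brackets_so3A1
  exact ⟨e, he.h01, by rw [he.h02]; module, he.h03, by rw [he.h12]; module, he.h13, he.h23⟩

end Tables

/-! ### Exceptional contractions and minimal signatures -/

section Contractions

variable {𝕜 : Type*} [RCLike 𝕜] {C : Contraction 𝕜 4} {S : LieStructure 𝕜 4}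

theorem IsCyclicExt.lieEquiv {L L0 : Type*} [LieRing L] [LieAlgebra 𝕜 L] [LieRing L0]
    [LieAlgebra 𝕜 L0] {c d e : 𝕜} (h : IsCyclicExt 𝕜 L c d e) (h0 : IsCyclicExt 𝕜 L0 c d e) :
    Nonempty (L ≃ₗ⁅𝕜⁆ L0) := by
  obtain ⟨b, hb⟩ := h
  obtain ⟨b0, hb0⟩ := h0
  exact lieEquiv_of_brackets b b0 hb hb0 (by ext k; simp) (by ext k; simp) (by ext k; simp)
    (by ext k; simp) (by ext k; simp) (by ext k; simp)

theorem exists_degenerates (h : C.IsGenIW) :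
    ∃ α, Degenerates 𝕜 C.source.Alg C.target.Alg α := by
  obtain ⟨α, hα⟩ := h
  exact ⟨α, HasSignature.degenerates hα⟩

theorem IsCyclicExt.exists_gpair_of_isGenIW (h : C.IsGenIW)
    (h0 : IsCyclicExt 𝕜 C.target.Alg 0 0 0) : ∃ x y : C.source.Alg, GPair 𝕜 x y := by
  obtain ⟨α, hα⟩ := exists_degenerates h
  obtain ⟨e, he⟩ := h0
  obtain ⟨x, y, hxy, -⟩ := hα.exists_gpair_near (x0 := e 0) (y0 := e 1)
    ⟨e, rfl, rfl, by rw [he.h01], by rw [he.h01, he.h02]⟩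
  exact ⟨x, y, hxy⟩

theorem exists_weights_le_three (hsq : ∀ r : 𝕜, ‖r - 1‖ < 1 → ∃ s, s ^ 2 = r) (h : C.IsGenIW) :
    ∃ α : Fin 4 → ℕ, (∀ i, α i ≤ 3) ∧ C.RealizableWith (fun i => (α i : ℝ)) := by
  by_cases h0 : IsCyclicExt 𝕜 C.target.Alg 0 0 0
  · obtain ⟨x, y, hxy⟩ := h0.exists_gpair_of_isGenIW h
    exact ⟨_, by decide, realizableWith_iff.mpr (hxy.degenerates h0)⟩
  · obtain ⟨α, hα⟩ := exists_degenerates h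
    obtain ⟨β, hβ, hD⟩ := hα.exists_weights_le_two hsq (finrank_alg _) (finrank_alg _) h0
    exact ⟨β, fun i => (hβ i).trans (by norm_num), realizableWith_iff.mpr hD⟩

theorem requires_exponent_iff (hsq : ∀ r : 𝕜, ‖r - 1‖ < 1 → ∃ s, s ^ 2 = r) (h : C.IsGenIW) :
    (∀ α : Fin 4 → ℝ, C.RealizableWith α → ∃ i, α i ∉ ({0, 1, 2} : Set ℝ)) ↔
      IsCyclicExt 𝕜 C.target.Alg 0 0 0 ∧
        ¬ (HasNilpotentGenerator 𝕜 C.source.Alg ∨ HasEngelGenerator 𝕜 C.source.Alg) := by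
  constructor
  · intro hα
    have key : ∀ β : Fin 4 → ℕ, (∀ i, β i ≤ 2) →
        ¬ Degenerates 𝕜 C.source.Alg C.target.Alg (fun i => (β i : ℝ)) := by
      intro β hβ hD
      obtain ⟨i, hi⟩ := hα _ (realizableWith_iff.mpr hD)
      apply hi
      have := hβ i
      interval_cases β i <;> simp
    have h0 : IsCyclicExt 𝕜 C.target.Alg 0 0 0 := by
      by_contra h0
      obtain ⟨α, hα⟩ := exists_degenerates h
      obtain ⟨β, hβ, hD⟩ := hα.exists_weights_le_two hsq (finrank_alg _) (finrank_alg _) h0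
      exact key β hβ hD
    refine ⟨h0, ?_⟩
    rintro (hA | hB)
    · exact key _ (by decide) (hA.degenerates h0)
    · exact key _ (by decide) (hB.degenerates h0)
  · rintro ⟨h0, hne⟩ α hα
    by_contra! hmem
    simp only [mem_insert_iff, mem_singleton_iff] at hmem
    have hnn : ∀ i, 0 ≤ α i := fun i => by
      rcases hmem i with h | h | h <;> rw [h] <;> norm_num
    have hone : ∀ i, 0 < α i → 1 ≤ α i := fun i => by
      rcases hmem i with h | h | h <;> rw [h] <;> norm_num
    obtain hA | hB | ⟨σ, s0, s1, -, s3⟩ := (realizableWith_iff.mp hα).generator_or h0 hnn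
    · exact hne (Or.inl hA)
    · exact hne (Or.inr hB)
    · have h1 := hone _ s0
      have h2 := hone _ s1
      -- Positive weights in `{0, 1, 2}` are at least 1, so the largest weight `2 m + n` is at least
      -- 3.
      rcases hmem (σ 3) with h | h | h <;> rw [h] at s3 <;> linarith

theorem isMinimalSignature_of (h0 : IsCyclicExt 𝕜 C.target.Alg 0 0 0)
    (hG : ∃ x y : C.source.Alg, GPair 𝕜 x y)
    (hne : ¬ (HasNilpotentGenerator 𝕜 C.source.Alg ∨ HasEngelGenerator 𝕜 C.source.Alg)) :
    C.IsMinimalSignature ![3, 2, 1, 1] := by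
  refine ⟨?_, ?_, ?_⟩
  · intro i j
    revert i j
    decide
  · obtain ⟨x, y, hxy⟩ := hG
    -- Reversal turns the weights 1, 1, 2, 3 into the nonincreasing tuple 3, 2, 1, 1.
    have := (hxy.degenerates h0).reindex Fin.revPerm
    rw [realizableWith_iff]
    convert this using 2 with i
    fin_cases i <;> simp [Fin.rev]
  · intro β hanti hβ
    obtain hA | hB | ⟨σ, s0, s1, s2, s3⟩ :=
      (realizableWith_iff.mp hβ).generator_or h0 (fun i => Nat.cast_nonneg _)
    · exact absurd (Or.inl hA) hne
    · exact absurd (Or.inr hB) hne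
    · have s0 : 1 ≤ β (σ 0) := by exact_mod_cast s0
      have s1 : 1 ≤ β (σ 1) := by exact_mod_cast s1
      have s2 : β (σ 2) = β (σ 0) + β (σ 1) := by exact_mod_cast s2
      have s3 : β (σ 3) = 2 * β (σ 0) + β (σ 1) := by exact_mod_cast s3
      have hpos : ∀ i, 1 ≤ β i := by
        have h : ∀ j, 1 ≤ β (σ j) := by
          intro j
          fin_cases j <;> simp <;> omega
        intro i
        simpa using h (σ.symm i)
      have h0 : 3 ≤ β 0 := le_trans (by omega) (hanti (Fin.zero_le (σ 3)))
      -- At least one of the indices `σ 2`, `σ 3`, both of weight at least 2, is not 0, and `β` is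
      -- nonincreasing.
      have h1 : 2 ≤ β 1 := by
        have h23 : σ 2 ≠ σ 3 := fun h => absurd (σ.injective h) (by decide)
        have hle : ∀ i : Fin 4, i ≠ 0 → 1 ≤ i := by decide
        by_cases h : σ 2 = 0
        · exact le_trans (by omega) (hanti (hle (σ 3) (fun h' => h23 (h.trans h'.symm))))
        · exact le_trans (by omega) (hanti (hle (σ 2) h))
      refine Pi.toLex_monotone fun i => ?_
      fin_cases i
      · exact h0
      · exact h1
      · exact hpos 2
      · exact hpos 3

theorem three_le_of_bound (h0 : IsCyclicExt 𝕜 C.target.Alg 0 0 0)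
    (hne : ¬ (HasNilpotentGenerator 𝕜 C.source.Alg ∨ HasEngelGenerator 𝕜 C.source.Alg)) {m : ℕ}
    (h : ∃ α : Fin 4 → ℕ, (∀ i, α i ≤ m) ∧ C.RealizableWith (fun i => (α i : ℝ))) : 3 ≤ m := by
  obtain ⟨α, hm, hα⟩ := h
  obtain hA | hB | ⟨σ, s0, s1, -, s3⟩ :=
    (realizableWith_iff.mp hα).generator_or h0 (fun i => Nat.cast_nonneg _)
  · exact absurd (Or.inl hA) hne
  · exact absurd (Or.inr hB) hne
  · have s0 : 1 ≤ α (σ 0) := by exact_mod_cast s0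
    have s1 : 1 ≤ α (σ 1) := by exact_mod_cast s1
    have s3 : α (σ 3) = 2 * α (σ 0) + α (σ 1) := by exact_mod_cast s3
    have := hm (σ 3)
    omega

theorem exists_isGenIW (hG : ∃ x y : S.Alg, GPair 𝕜 x y) :
    ∃ C : Contraction 𝕜 4, C.IsBetween S (A41 𝕜) ∧ C.IsGenIW := by
  obtain ⟨x, y, hxy⟩ := hG
  obtain ⟨C, rfl, hT, hC⟩ := (hxy.degenerates isCyclicExt_A41).exists_contraction
  exact ⟨C, ⟨⟨LieEquiv.refl⟩, by rw [hT]; exact ⟨LieEquiv.refl⟩⟩, _, hC⟩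

theorem isCyclicExt_target (h : C.IsBetween S (A41 𝕜)) : IsCyclicExt 𝕜 C.target.Alg 0 0 0 := by
  obtain ⟨-, ⟨e⟩⟩ := h
  exact isCyclicExt_A41.congr e.symm

theorem exists_explicit_contraction : ∃ C : Contraction ℂ 4, C.source = twoA21 ℂ ∧
    C.target = A41 ℂ ∧ ∀ ε ∈ Set.Ioc (0 : ℝ) 1, C.U ε =
      !![1, 0, 0, 1; 0, 0, 1, 0; 0, 0, 0, 1; 0, 1, 1, 1] *
        Matrix.diagonal ![(ε : ℂ) ^ 3, (ε : ℂ) ^ 2, (ε : ℂ), (ε : ℂ)] := by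
  set A : Matrix (Fin 4) (Fin 4) ℂ := !![1, 0, 0, 1; 0, 0, 1, 0; 0, 0, 0, 1; 0, 1, 1, 1] with hAdef
  have hAd : IsUnit A.det := by
    rw [isUnit_iff_ne_zero, det_four]
    simp [hAdef]
  have hA : IsUnit A := (Matrix.isUnit_iff_isUnit_det A).mpr hAd
  have hA' : IsUnit A⁻¹ := (Matrix.isUnit_iff_isUnit_det _).mpr (Matrix.isUnit_nonsing_inv_det A hAd)
  obtain ⟨e, he, hB⟩ := exists_brackets_twoA21 (𝕜 := ℂ)
  obtain ⟨e0, he0, hB0⟩ := exists_brackets_A41 (𝕜 := ℂ)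
  obtain ⟨b, hb⟩ := exists_basis_of_isUnit (twoA21 ℂ) hA'
  -- The basis `b` consists of the columns of the given matrix; its brackets are then graded by the
  -- weights 3, 2, 1, 1.
  have hcol : ∀ (w : (twoA21 ℂ).Alg) i, (∀ k, e.repr w k = A k i) → b i = w := by
    intro w i hw
    refine b.ext_elem fun k => ?_
    have h1 : A⁻¹.mulVec w k = (A⁻¹ * A) k i := by
      simp only [Matrix.mulVec, dotProduct, Matrix.mul_apply]
      exact Finset.sum_congr rfl fun l _ => congrArg (A⁻¹ k l * ·) ((he w l).symm.trans (hw l))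
    rw [hb w k]
    refine Eq.trans ?_ h1.symm
    rw [Matrix.nonsing_inv_mul _ hAd, Basis.repr_self, Finsupp.single_apply, Matrix.one_apply]
    simp only [eq_comm]
  have b0 : b 0 = e 0 := hcol _ _ fun k => by fin_cases k <;> simp [hAdef]
  have b1 : b 1 = e 3 := hcol _ _ fun k => by fin_cases k <;> simp [hAdef]
  have b2 : b 2 = e 1 + e 3 := hcol _ _ fun k => by fin_cases k <;> simp [hAdef]
  have b3 : b 3 = e 0 + e 2 + e 3 := hcol _ _ fun k => by fin_cases k <;> simp [hAdef]
  have h30 : ⁅e 3, e 0⁆ = 0 := by rw [← lie_skew, hB.h03, neg_zero]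
  have h31 : ⁅e 3, e 1⁆ = 0 := by rw [← lie_skew, hB.h13, neg_zero]
  have h10 : ⁅e 1, e 0⁆ = -e 0 := by rw [← lie_skew, hB.h01]
  have h32 : ⁅e 3, e 2⁆ = -e 2 := by rw [← lie_skew, hB.h23]
  have c01 : ⁅b 0, b 1⁆ = 0 := by rw [b0, b1, hB.h03]
  have c02 : ⁅b 0, b 2⁆ = b 0 := by rw [b0, b2, lie_add, hB.h01, hB.h03, add_zero]
  have c03 : ⁅b 0, b 3⁆ = 0 := by rw [b0, b3, lie_add, lie_add, hB.h02, hB.h03, lie_self]; simp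
  have c12 : ⁅b 1, b 2⁆ = 0 := by rw [b1, b2, lie_add, h31, lie_self, add_zero]
  have c13 : ⁅b 1, b 3⁆ = b 0 + b 1 - b 3 := by
    rw [b0, b1, b3, lie_add, lie_add, h30, h32, lie_self]; module
  have c23 : ⁅b 2, b 3⁆ = b 1 - b 3 := by
    rw [b1, b2, b3]
    simp only [lie_add, add_lie, h10, hB.h12, hB.h13, h30, h32, lie_self]; module
  have hgrad := isGradation_of_brackets ![3, 2, 1, 1] (b := b) (b0 := e0)
    ⟨c01, c02, c03, c12, c13, c23⟩ hB0
    (by intro k; fin_cases k <;> simp) (by intro k; fin_cases k <;> simp)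
    (by intro k; fin_cases k <;> simp) (by intro k; fin_cases k <;> simp)
    (by intro k; fin_cases k <;> simp) (by intro k; fin_cases k <;> simp)
  obtain ⟨C, hS, hT, hU⟩ := exists_contraction hA isUnit_one hb (fun v k =>
    (he0 v k).trans (congrFun (Matrix.one_mulVec (v : Fin 4 → ℂ)) k).symm) hgrad
  refine ⟨C, hS, hT, fun ε hε => ?_⟩
  rw [hU ε hε, mul_one]
  congr 2
  funext i
  fin_cases i <;> simp

end Contractions

/-! ### Square roots and the exceptional sources over each field -/

section Squares

theorem exists_sq_of_near_one_real (r : ℝ) (h : ‖r - 1‖ < 1) : ∃ s, s ^ 2 = r :=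
  ⟨√r, Real.sq_sqrt (by rw [Real.norm_eq_abs, abs_lt] at h; linarith)⟩

theorem exists_sq_complex (r : ℂ) : ∃ s, s ^ 2 = r := IsAlgClosed.exists_pow_nat_eq r two_pos

variable {L : Type*} [LieRing L]

theorem IsReductive.not_exists_generator_real [LieAlgebra ℝ L] (h : IsReductive ℝ L (-1) 1) :
    ¬ (HasNilpotentGenerator ℝ L ∨ HasEngelGenerator ℝ L) :=
  h.not_exists_generator fun p q r h => by
    refine ⟨?_, ?_, ?_⟩ <;> nlinarith [sq_nonneg p, sq_nonneg q, sq_nonneg r]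

theorem lieEquiv_of_exceptional_complex [LieAlgebra ℂ L] (hG : ∃ x y : L, GPair ℂ x y)
    (hne : ¬ (HasNilpotentGenerator ℂ L ∨ HasEngelGenerator ℂ L)) :
    Nonempty (L ≃ₗ⁅ℂ⁆ (twoA21 ℂ).Alg) := by
  obtain ⟨x, y, hxy⟩ := hG
  obtain hA | hB | ⟨d, hd, hL⟩ | ⟨d, f, hd, -⟩ := hxy.engel_or
  · exact absurd (Or.inl hA) hne
  · exact absurd (Or.inr hB) hne
  · obtain ⟨s, rfl⟩ := exists_sq_complex d
    have h1 := (isQuadraticAffine_twoA21 (𝕜 := ℂ)).mul_sq (t := s) (by rintro rfl; simp at hd)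
    rw [one_mul] at h1
    exact hL.lieEquiv h1
  · obtain ⟨s, rfl⟩ := exists_sq_complex d
    exact absurd ⟨s, sq s⟩ hd

theorem lieEquiv_of_exceptional_real [LieAlgebra ℝ L] (hG : ∃ x y : L, GPair ℝ x y)
    (hne : ¬ (HasNilpotentGenerator ℝ L ∨ HasEngelGenerator ℝ L)) :
    Nonempty (L ≃ₗ⁅ℝ⁆ (twoA21 ℝ).Alg) ∨ Nonempty (L ≃ₗ⁅ℝ⁆ A410.Alg) ∨
      Nonempty (L ≃ₗ⁅ℝ⁆ so3A1.Alg) := by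
  obtain ⟨x, y, hxy⟩ := hG
  obtain hA | hB | ⟨d, hd, hL⟩ | ⟨d, f, hd, hf, hL⟩ := hxy.engel_or
  · exact absurd (Or.inl hA) hne
  · exact absurd (Or.inr hB) hne
  · rcases hd.lt_or_gt with hd | hd
    · have h1 := isQuadraticAffine_A410.mul_sq (t := √(-d)) (Real.sqrt_ne_zero'.mpr (by linarith))
      rw [Real.sq_sqrt (by linarith), neg_one_mul, neg_neg] at h1
      exact Or.inr (Or.inl (hL.lieEquiv h1))
    · have h1 := (isQuadraticAffine_twoA21 (𝕜 := ℝ)).mul_sq (t := √d) (Real.sqrt_ne_zero'.mpr hd)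
      rw [Real.sq_sqrt hd.le, one_mul] at h1
      exact Or.inl (hL.lieEquiv h1)
  · have hd : d < 0 := by
      by_contra! h
      exact hd ⟨√d, (Real.mul_self_sqrt h).symm⟩
    have hf : 0 < f := by
      by_contra! h
      exact hf ⟨√(-f), (Real.mul_self_sqrt (by linarith)).symm⟩
    have h1 := isReductive_so3A1.mul_sq (p := √(-d)) (q := √f)
      (Real.sqrt_ne_zero'.mpr (by linarith)) (Real.sqrt_ne_zero'.mpr hf)
    rw [Real.sq_sqrt (by linarith), Real.sq_sqrt hf.le, neg_one_mul, neg_neg, one_mul] at h1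
    exact Or.inr (Or.inr (hL.lieEquiv h1))

theorem exceptional_twoA21 {𝕜 : Type*} [RCLike 𝕜] [LieAlgebra 𝕜 L] (e : L ≃ₗ⁅𝕜⁆ (twoA21 𝕜).Alg) :
    (∃ x y : L, GPair 𝕜 x y) ∧ ¬ (HasNilpotentGenerator 𝕜 L ∨ HasEngelGenerator 𝕜 L) :=
  have h := isQuadraticAffine_twoA21.congr e.symm
  ⟨h.exists_gpair, h.not_exists_generator one_ne_zero⟩

theorem exceptional_real [LieAlgebra ℝ L] {S : LieStructure ℝ 4}
    (hS : S ∈ ({twoA21 ℝ, A410, so3A1} : Set (LieStructure ℝ 4))) (e : L ≃ₗ⁅ℝ⁆ S.Alg) :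
    (∃ x y : L, GPair ℝ x y) ∧ ¬ (HasNilpotentGenerator ℝ L ∨ HasEngelGenerator ℝ L) := by
  rcases hS with rfl | rfl | rfl
  · exact exceptional_twoA21 e
  · have h := isQuadraticAffine_A410.congr e.symm
    exact ⟨h.exists_gpair, h.not_exists_generator (by norm_num)⟩
  · have h := isReductive_so3A1.congr e.symm
    exact ⟨h.exists_gpair (by norm_num), h.not_exists_generator_real⟩

end Squares

end LieDegeneration

/-! ### Assembly of the main theorem -/

open LieDegeneration

theorem theorem2 :
    -- Complex case: all exponents can be chosen as nonnegative integers not greater than three.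
    (∀ C : Contraction ℂ 4, C.IsGenIW →
      ∃ α : Fin 4 → ℕ, (∀ i, α i ≤ 3) ∧ C.RealizableWith (fun i => (α i : ℝ))) ∧
    -- The bound is exact.
    (∀ m : ℕ, (∀ C : Contraction ℂ 4, C.IsGenIW →
      ∃ α : Fin 4 → ℕ, (∀ i, α i ≤ m) ∧ C.RealizableWith (fun i => (α i : ℝ))) → 3 ≤ m) ∧
    -- The only one that needs exponents outside {0, 1, 2}.
    (∀ C : Contraction ℂ 4, C.IsGenIW →
      ((∀ α : Fin 4 → ℝ, C.RealizableWith α → ∃ i, α i ∉ ({0, 1, 2} : Set ℝ)) ↔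
        C.IsBetween (twoA21 ℂ) (A41 ℂ))) ∧
    -- It exists, and its minimal signature is (3, 2, 1, 1).
    (∃ C : Contraction ℂ 4, C.IsBetween (twoA21 ℂ) (A41 ℂ) ∧ C.IsGenIW) ∧
    (∀ C : Contraction ℂ 4, C.IsBetween (twoA21 ℂ) (A41 ℂ) →
      C.IsMinimalSignature ![3, 2, 1, 1]) ∧
    -- An explicit contraction matrix, in the canonical bases.
    (∃ C : Contraction ℂ 4, C.source = twoA21 ℂ ∧ C.target = A41 ℂ ∧
      ∀ ε ∈ Set.Ioc (0 : ℝ) 1, C.U ε =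
        !![1, 0, 0, 1;
           0, 0, 1, 0;
           0, 0, 0, 1;
           0, 1, 1, 1] *
        Matrix.diagonal ![(ε : ℂ) ^ 3, (ε : ℂ) ^ 2, (ε : ℂ), (ε : ℂ)]) ∧
    -- Real case: all exponents can be chosen as nonnegative integers not greater than three.
    (∀ C : Contraction ℝ 4, C.IsGenIW →
      ∃ α : Fin 4 → ℕ, (∀ i, α i ≤ 3) ∧ C.RealizableWith (fun i => (α i : ℝ))) ∧
    -- The bound is exact.
    (∀ m : ℕ, (∀ C : Contraction ℝ 4, C.IsGenIW →
      ∃ α : Fin 4 → ℕ, (∀ i, α i ≤ m) ∧ C.RealizableWith (fun i => (α i : ℝ))) → 3 ≤ m) ∧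
    -- The only ones that need exponents outside {0, 1, 2}.
    (∀ C : Contraction ℝ 4, C.IsGenIW →
      ((∀ α : Fin 4 → ℝ, C.RealizableWith α → ∃ i, α i ∉ ({0, 1, 2} : Set ℝ)) ↔
        C.IsBetween (twoA21 ℝ) (A41 ℝ) ∨ C.IsBetween A410 (A41 ℝ) ∨
          C.IsBetween so3A1 (A41 ℝ))) ∧
    -- They exist, and the minimal signature of each of them is (3, 2, 1, 1).
    (∀ S ∈ ({twoA21 ℝ, A410, so3A1} : Set (LieStructure ℝ 4)),
      (∃ C : Contraction ℝ 4, C.IsBetween S (A41 ℝ) ∧ C.IsGenIW) ∧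
      (∀ C : Contraction ℝ 4, C.IsBetween S (A41 ℝ) → C.IsMinimalSignature ![3, 2, 1, 1])) := by
  have sqC : ∀ r : ℂ, ‖r - 1‖ < 1 → ∃ s, s ^ 2 = r := fun r _ => exists_sq_complex r
  refine ⟨fun C hC => exists_weights_le_three sqC hC, fun m hm => ?_, fun C hC => ?_,
    exists_isGenIW isQuadraticAffine_twoA21.exists_gpair, fun C h => ?_,
    exists_explicit_contraction,
    fun C hC => exists_weights_le_three exists_sq_of_near_one_real hC, fun m hm => ?_,
    fun C hC => ?_, fun S hS => ⟨?_, fun C h => ?_⟩⟩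
  · obtain ⟨C, h, hC⟩ := exists_isGenIW (isQuadraticAffine_twoA21 (𝕜 := ℂ)).exists_gpair
    exact three_le_of_bound (isCyclicExt_target h) (exceptional_twoA21 h.1.some).2 (hm C hC)
  · rw [requires_exponent_iff sqC hC]
    refine ⟨fun ⟨h0, hne⟩ => ⟨lieEquiv_of_exceptional_complex (h0.exists_gpair_of_isGenIW hC) hne,
      h0.lieEquiv isCyclicExt_A41⟩, fun h => ⟨isCyclicExt_target h, (exceptional_twoA21 h.1.some).2⟩⟩
  · have he := exceptional_twoA21 h.1.some
    exact isMinimalSignature_of (isCyclicExt_target h) he.1 he.2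
  · obtain ⟨C, h, hC⟩ := exists_isGenIW (isQuadraticAffine_twoA21 (𝕜 := ℝ)).exists_gpair
    exact three_le_of_bound (isCyclicExt_target h) (exceptional_twoA21 h.1.some).2 (hm C hC)
  · rw [requires_exponent_iff exists_sq_of_near_one_real hC]
    constructor
    · rintro ⟨h0, hne⟩
      have hT := h0.lieEquiv (isCyclicExt_A41 (𝕜 := ℝ))
      exact (lieEquiv_of_exceptional_real (h0.exists_gpair_of_isGenIW hC) hne).imp (⟨·, hT⟩)
        (Or.imp (⟨·, hT⟩) (⟨·, hT⟩))
    · have key : ∀ S ∈ ({twoA21 ℝ, A410, so3A1} : Set (LieStructure ℝ 4)),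
          C.IsBetween S (A41 ℝ) → IsCyclicExt ℝ C.target.Alg 0 0 0 ∧
            ¬ (HasNilpotentGenerator ℝ C.source.Alg ∨ HasEngelGenerator ℝ C.source.Alg) :=
        fun S hS h => ⟨isCyclicExt_target h, (exceptional_real hS h.1.some).2⟩
      rintro (h | h | h)
      · exact key _ (by simp) h
      · exact key _ (by simp) h
      · exact key _ (by simp) h
  · exact exists_isGenIW (exceptional_real hS LieEquiv.refl).1
  · have he := exceptional_real hS h.1.some
    exact isMinimalSignature_of (isCyclicExt_target h) he.1 he.2
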